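/- Let $\Delta\subset\mathbb{R}^2$ be a reflexive polygon: $\Delta$ is a convex lattice polygon with the origin in its interior, and its dual $\Delta^\circ=\{u : u\cdot v\ge -1\ \text{for all } v\in\Delta\}$ is also a lattice polygon (up to $GL(2,\mathbb{Z})$ there are 16 of these). Let $\chi$ be the Euler number of the completely resolved toric surface of $\Delta$, given by the number of lattice points on the boundary of $\Delta$, and let $C_1=\int c_1^2$ be its Chern number, given by the number of lattice points on the boundary of $\Delta^\circ$. Let $\sigma\subset\mathbb{R}^3$ be the cone over $\Delta\times\{1\}$, $S=\sigma^\vee\cap\mathbb{Z}^3$, and $\mathcal{X}=\operatorname{Spec}\mathbb{C}[S]$ the associated toric Calabi–Yau 3-fold. Let $x_1,\dots,x_k$ be the minimal generators of $\mathbb{C}[S]$ (the indecomposable elements of $S$), and let $I$ be the ideal of relations, so that $\mathbb{C}[S]=\mathbb{C}[x_1,\dots,x_k]/I$. For numbers $b_\alpha$ attached to the vertices $v_\alpha$ of $\Delta$, give $m\in S$ the charge $\sum_\alpha b_\alpha\langle m,(v_\alpha,1)\rangle$. Call $b$ admissible if $\sum_\alpha b_\alpha=2$ and all nonzero $m\in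 S$ have positive charge. With $g$ the Hilbert series of $\mathbb{C}[S]$ in this grading, put $V(b)=\frac{8}{27}\lim_{s\to0^+}s^3\,g(t=e^{-s})$. The $U(1)_R$ symmetry $\zeta_R$ is the grading given by charges $r$ that minimize $V$ over all admissible $b$; write $R_h$ for the charge of $x_h$. For a grading $\zeta$ write the Laurent expansion of its Hilbert series as $g(t=e^{-s})=\frac{2A_0(\zeta)}{s^3}+\frac{A_1(\zeta)}{s^2}+\cdots$. Let $\eta_h$ be the test symmetry with weight $1$ on $x_h$ and weight $0$ on the other generators, and let $I_0$ be the ideal generated by the lowest $\eta_h$-weight parts of all elements of $I$. Let $A_i(\zeta_R+\epsilon\eta_h)$ be the coefficients for the central fibre $\mathbb{C}[x_1,\dots,x_k]/I_0$, where $x_j$ has weight $R_j+\epsilon\delta_{jh}$. The Futaki invariant is $$F(\mathcal{X};\zeta_R,\eta_h)=\frac{A_0(\zeta_R)}{2}\,\frac{d}{d\epsilon}\!\left[\frac{A_1(\zeta_R+\epsilon\eta_h)}{A_0(\zeta_R+\epsilon\eta_h)}\right]_{\epsilon=0}+\frac{A_1(\zeta_R)}{6A_0(\zeta_R)}\,\frac{d}{d\epsilon}A_0(\zeta_R+\epsilon\eta_h)\Big|_{\epsilon=0}.$$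 Then $C_1+\chi=12$, minimizing charges $r$ exist, and for every such $r$ and every generator $x_h$ the Futaki invariant is well defined, is positive, and satisfies $$\frac{1}{F(\mathcal{X};\zeta_R,\eta_h)}\le\frac{64}{27}\,\chi,\qquad\text{equivalently}\qquad \frac{1}{F(\mathcal{X};\zeta_R,\eta_h)}\le\frac{64}{27}\,(12-C_1).$$ -/

import Mathlib

open Filter Topology Asymptotics
open scoped Matrix

noncomputable section

namespace FutakiReflexive

/-! ### Reflexive polygons -/

/-- The inclusion of the lattice `ℤⁿ` into `ℝⁿ`. -/
def latticeToReal {n : ℕ} (v : Fin n → ℤ) : Fin n → ℝ := fun i => (v i : ℝ)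

/-- A convex lattice polytope in the plane: the convex hull of finitely many points of `ℤ²`. -/
def IsLatticePolytope (P : Set (Fin 2 → ℝ)) : Prop :=
  ∃ S : Finset (Fin 2 → ℤ), P = convexHull ℝ (latticeToReal '' (S : Set (Fin 2 → ℤ)))

/-- The dual polytope `P° = {u | u · v ≥ -1 for all v ∈ P}`. -/
def polarDual (P : Set (Fin 2 → ℝ)) : Set (Fin 2 → ℝ) := {u | ∀ v ∈ P, -1 ≤ u ⬝ᵥ v}

/-- A reflexive polygon, with its interior lattice point placed at the origin. Up to `GL(2, ℤ)`
there are 16 of them. -/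
structure IsReflexivePolygon (P : Set (Fin 2 → ℝ)) : Prop where
  lattice : IsLatticePolytope P
  zero_mem_interior : (0 : Fin 2 → ℝ) ∈ interior P
  dual_lattice : IsLatticePolytope (polarDual P)

/-- The number of lattice points on the perimeter of a polygon. -/
def perimeterPoints (P : Set (Fin 2 → ℝ)) : ℕ :=
  Set.ncard {v : Fin 2 → ℤ | latticeToReal v ∈ frontier P}

/-- The Euler number `χ = p` of the completely resolved toric surface of the polygon `P`:
the number of perimeter lattice points of `P`. -/
def eulerNumber (P : Set (Fin 2 → ℝ)) : ℕ := perimeterPoints P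

/-- The Chern number `C₁ = ∫ c₁² = p°` of the completely resolved toric surface of `P`:
the number of perimeter lattice points of the dual polygon. -/
def chernNumber (P : Set (Fin 2 → ℝ)) : ℕ := perimeterPoints (polarDual P)

/-! ### The toric Calabi-Yau 3-fold of a polygon -/

/-- The point `(u, 1)` of `ℝ³`. -/
def lift (u : Fin 2 → ℝ) : Fin 3 → ℝ := ![u 0, u 1, 1]

/-- The cone `σ` in `ℝ³` over the polygon placed at height 1. -/
def toricCone (P : Set (Fin 2 → ℝ)) : PointedCone ℝ (Fin 3 → ℝ) :=
  Submodule.span _ (lift '' P)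

/-- The monoid of lattice points of the dual cone `σ^∨`. -/
def dualMonoid (P : Set (Fin 2 → ℝ)) : AddSubmonoid (Fin 3 → ℤ) where
  carrier := {m | ∀ x ∈ toricCone P, 0 ≤ latticeToReal m ⬝ᵥ x}
  zero_mem' := by
    intro x _
    simp [latticeToReal, dotProduct]
  add_mem' := by
    intro a b ha hb x hx
    have h : latticeToReal (a + b) = latticeToReal a + latticeToReal b := by
      funext i
      simp [latticeToReal]
    rw [h, add_dotProduct]
    exact add_nonneg (ha x hx) (hb x hx)

/-- The coordinate ring `ℂ[σ^∨ ∩ ℤ³]` of the toric Calabi-Yau 3-fold. -/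
abbrev CoordinateRing (P : Set (Fin 2 → ℝ)) : Type := AddMonoidAlgebra ℂ (dualMonoid P)

/-- The (minimal) generators of the coordinate ring: the nonzero lattice points of the dual cone
that are not the sum of two nonzero ones. -/
def IsGenerator (P : Set (Fin 2 → ℝ)) (m : dualMonoid P) : Prop :=
  m ≠ 0 ∧ ∀ a b : dualMonoid P, m = a + b → a = 0 ∨ b = 0

/-- The index type of the generators `x_h`. -/
abbrev Generator (P : Set (Fin 2 → ℝ)) : Type := {m : dualMonoid P // IsGenerator P m}

/-- The presentation `ℂ[x₁, …, x_k] → ℂ[σ^∨ ∩ ℤ³]`. -/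
def presentation (P : Set (Fin 2 → ℝ)) :
    MvPolynomial (Generator P) ℂ →ₐ[ℂ] CoordinateRing P :=
  MvPolynomial.aeval (fun h : Generator P => AddMonoidAlgebra.single h.1 (1 : ℂ))

/-- The ideal `I` of relations between the generators, so that the coordinate ring is
`ℂ[x₁, …, x_k] / I`. -/
def toricIdeal (P : Set (Fin 2 → ℝ)) : Ideal (MvPolynomial (Generator P) ℂ) :=
  RingHom.ker (presentation P)

/-! ### Hilbert series and their Laurent expansion -/

section Hilbert

variable {ι : Type}

/-- The piece of degree `d` of `ℂ[x] / J`, where the variable `x_i` has the real degree `w i`. -/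
def gradedPiece (J : Ideal (MvPolynomial ι ℂ)) (w : ι → ℝ) (d : ℝ) :
    Submodule ℂ (MvPolynomial ι ℂ ⧸ J) :=
  (MvPolynomial.weightedHomogeneousSubmodule ℂ w d).map (Ideal.Quotient.mkₐ ℂ J).toLinearMap

/-- `g` is the Hilbert series `g(t) = ∑_d dim (ℂ[x] / J)_d t^d` for `0 < t < 1`, with
finite-dimensional graded pieces and a convergent sum. -/
def IsHilbertSeries (J : Ideal (MvPolynomial ι ℂ)) (w : ι → ℝ) (g : ℝ → ℝ) : Prop :=
  (∀ d : ℝ, FiniteDimensional ℂ (gradedPiece J w d)) ∧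
  ∀ t ∈ Set.Ioo (0 : ℝ) 1,
    HasSum (fun d : ℝ => (Module.finrank ℂ (gradedPiece J w d) : ℝ) * t ^ d) (g t)

/-- The Hilbert series has the Laurent expansion
`g(t = e^{-s}) = 2! A₀ / s³ + 1! A₁ / s² + …` as `s → 0⁺`. -/
def HasLaurentCoefficients (J : Ideal (MvPolynomial ι ℂ)) (w : ι → ℝ) (A₀ A₁ : ℝ) : Prop :=
  ∃ g : ℝ → ℝ, IsHilbertSeries J w g ∧
    (fun s : ℝ => g (Real.exp (-s)) - (2 * A₀ / s ^ 3 + A₁ / s ^ 2))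
      =O[𝓝[>] (0 : ℝ)] (fun s : ℝ => 1 / s)

/-! ### Test symmetries and Futaki invariants -/

/-- The form `in(f)`: the part of `f` of lowest weight under the test symmetry with
weights `η`. -/
def initialForm (η : ι → ℕ) (f : MvPolynomial ι ℂ) : MvPolynomial ι ℂ :=
  MvPolynomial.weightedHomogeneousComponent η
    (sInf {n : ℕ | MvPolynomial.weightedHomogeneousComponent η n f ≠ 0}) f

/-- The ideal `I₀` of the central fibre of the test configuration of `η`. -/
def centralFibreIdeal (I : Ideal (MvPolynomial ι ℂ)) (η : ι → ℕ) : Ideal (MvPolynomial ι ℂ) :=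
  Ideal.span (initialForm η '' (I : Set (MvPolynomial ι ℂ)))

open Classical in
/-- The test symmetry `η_h`, of weight 1 on `x_h` and 0 on the other generators. -/
def testSymmetry (h : ι) : ι → ℕ := Pi.single h 1

/-- `F` is the Futaki invariant (in complex dimension `n = 3`)
`F = A₀(ζ)/(n-1) · D_ε[A₁(ζ+εη)/A₀(ζ+εη)] + A₁(ζ)/(n(n-1)A₀(ζ)) · D_ε A₀(ζ+εη)` at `ε = 0`.
Here `ζ` is the grading of `ℂ[x]/I` with weights `q`, and the coefficients at `ζ + εη` are those of
the Hilbert series of the central fibre `ℂ[x]/I₀` of `η`, graded with the weights `q + εη`.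
All of the quantities involved are required to exist. -/
def IsFutakiInvariant (I : Ideal (MvPolynomial ι ℂ)) (q : ι → ℝ) (η : ι → ℕ) (F : ℝ) : Prop :=
  ∃ (a₀ a₁ : ℝ) (A₀ A₁ : ℝ → ℝ) (D D₀ : ℝ),
    HasLaurentCoefficients I q a₀ a₁ ∧ a₀ ≠ 0 ∧
    (∀ᶠ ε in 𝓝 (0 : ℝ),
      HasLaurentCoefficients (centralFibreIdeal I η) (fun i => q i + ε * (η i : ℝ))
        (A₀ ε) (A₁ ε)) ∧
    HasDerivAt (fun ε => A₁ ε / A₀ ε) D 0 ∧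
    HasDerivAt A₀ D₀ 0 ∧
    F = a₀ / (3 - 1) * D + a₁ / (3 * (3 - 1) * a₀) * D₀

end Hilbert

/-! ### The superconformal R-symmetry -/

/-- The extremal vertices of the toric diagram, which label the extremal GLSM fields `p_α`. -/
abbrev Vertex (P : Set (Fin 2 → ℝ)) : Type := P.extremePoints ℝ

/-- The charge of the monomial `m = ∏_α p_α ^ ⟨m, (v_α, 1)⟩` when the GLSM field `p_α` has
charge `r α`. -/
def charge (P : Set (Fin 2 → ℝ)) (r : Vertex P → ℝ) (m : dualMonoid P) : ℝ :=
  ∑ᶠ α : Vertex P, r α * (latticeToReal m.1 ⬝ᵥ lift α.1)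

/-- The grading on the generators that is induced by the charges `r` of the GLSM fields. -/
def generatorCharge (P : Set (Fin 2 → ℝ)) (r : Vertex P → ℝ) : Generator P → ℝ :=
  fun h => charge P r h.1

/-- Trial R-charges (Reeb vectors in terms of GLSM fields): all nonconstant monomials have positive
charge, and `∑_α b_α = 2`. -/
def IsTrialCharge (P : Set (Fin 2 → ℝ)) (b : Vertex P → ℝ) : Prop :=
  (∀ m : dualMonoid P, m ≠ 0 → 0 < charge P b m) ∧ ∑ᶠ α : Vertex P, b α = 2

/-- `V` is the volume `V(b; Y) = (8/27) lim_{s → 0} s³ g(t_α = exp(-s b_α))` of the Sasakian base,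
normalized by the volume of the 5-sphere. -/
def HasVolume (P : Set (Fin 2 → ℝ)) (b : Vertex P → ℝ) (V : ℝ) : Prop :=
  ∃ g : ℝ → ℝ, IsHilbertSeries (toricIdeal P) (generatorCharge P b) g ∧
    Tendsto (fun s : ℝ => 8 / 27 * (s ^ 3 * g (Real.exp (-s)))) (𝓝[>] (0 : ℝ)) (𝓝 V)

/-- The charges `r` of the GLSM fields under the `U(1)_R` symmetry `ζ_R`: trial charges at which
the volume function attains its minimum. -/
def IsRCharge (P : Set (Fin 2 → ℝ)) (r : Vertex P → ℝ) : Prop :=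
  IsTrialCharge P r ∧ ∃ V : ℝ, HasVolume P r V ∧
    ∀ b : Vertex P → ℝ, IsTrialCharge P b → ∃ V' : ℝ, HasVolume P b V' ∧ V ≤ V'

/-- `F = F(𝒳; ζ_R, η_h)`, where `r` are the `U(1)_R` charges of the GLSM fields. -/
def IsFutakiR (P : Set (Fin 2 → ℝ)) (r : Vertex P → ℝ) (h : Generator P) (F : ℝ) : Prop :=
  IsFutakiInvariant (toricIdeal P) (generatorCharge P r) (testSymmetry h) F

end FutakiReflexive

end

/-! Let A and B be the nonzero lattice points of Δ and of its dual, and ρ_u(β) = 1 + ⟨u, β⟩, so that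
Δ is cut out by ρ_u ≥ 0 for u in B. Consecutive points of B span unimodular cones, so B is the ray
set of a smooth complete fan, and the dual monoid splits into a copy of ℕ and one copy of ℕ³ for
each cone (`coneMap`). Charges b of total 2 enter only through β = ½ ∑ b_α v_α. Summing geometric
series gives A₀ = w(β)/16 and A₁ = 2 A₀ (`hasExpansion_hilbertFn`), where w(β) = ∑ 1/(ρ_u ρ_{N u})
is twice the area of the polar of Δ - β. Hence V = w/27, and ζ_R minimizes w over the interior of Δ.

Let x be a generator of charge R. Every m in S is uniquely k x + m₀ with m₀ not divisible by x. The
central fibre still has a basis indexed by S, in which m has η-weight k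
(`isNormalIdeal_centralFibreIdeal`), so its Hilbert series is g(t) (1 - t^R) / (1 - t^(R+ε)). This
yields F = A₀ (1/2 - 1/(3R)) (`isFutakiInvariant_iff`).

Two inequalities remain. First, at the minimum of w the polar K of Δ - β has its centroid at the
origin, and a plane convex body with that property satisfies -K ⊆ 2K. Applied to u/ρ_u in K and to a
point v of A with ⟨u, v⟩ ≥ 1, this gives ρ_u ≥ 2/3 (`two_thirds_le_rho`), so R ≥ 4/3 and F ≥ w/64.
Second, χ w ≥ 27, which is Mahler's inequality in the plane because χ is twice the area of Δ. It
comes from a classification: if -a is the self-intersection number of a ray, then 2 - a ≥ 0 is the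
lattice length of the dual edge of Δ. Contracting (-1)-curves leads to ℙ² or a Hirzebruch surface,
so the cyclic sequences of lengths form a finite list (`forall_cyclic`). On that list the identity
C₁ + χ = 12 and Mahler's inequality are checked, the latter by a tangent form of AM-GM
(`le_sum_mul_sum_one_div`). Together, 1/F ≤ 64/w ≤ 64 χ/27. -/

namespace FutakiReflexive

/-! ### Smooth complete fans in the plane -/

/-- The determinant of two vectors of the plane lattice. -/
def cr (u v : Fin 2 → ℤ) : ℤ := u 0 * v 1 - u 1 * v 0

theorem vec_ext {u v : Fin 2 → ℤ} (h0 : u 0 = v 0) (h1 : u 1 = v 1) : u = v := by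
  funext i; fin_cases i <;> assumption

theorem cr_self (u : Fin 2 → ℤ) : cr u u = 0 := by unfold cr; ring

theorem cr_swap (u v : Fin 2 → ℤ) : cr u v = -cr v u := by unfold cr; ring

theorem cr_add_left (u v w : Fin 2 → ℤ) : cr (u + v) w = cr u w + cr v w := by
  simp only [cr, Pi.add_apply]; ring

theorem cr_add_right (u v w : Fin 2 → ℤ) : cr u (v + w) = cr u v + cr u w := by
  simp only [cr, Pi.add_apply]; ring

theorem cr_sub_right (u v w : Fin 2 → ℤ) : cr u (v - w) = cr u v - cr u w := by
  simp only [cr, Pi.sub_apply]; ring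

theorem cr_smul_left (a : ℤ) (u w : Fin 2 → ℤ) : cr (a • u) w = a * cr u w := by
  simp only [cr, Pi.smul_apply, smul_eq_mul]; ring

theorem cr_smul_right (a : ℤ) (u w : Fin 2 → ℤ) : cr u (a • w) = a * cr u w := by
  simp only [cr, Pi.smul_apply, smul_eq_mul]; ring

theorem cr_neg_right (u w : Fin 2 → ℤ) : cr u (-w) = -cr u w := by
  simp only [cr, Pi.neg_apply]; ring

/-- Coordinates with respect to an oriented lattice basis. -/
theorem eq_cr_smul_add {u w : Fin 2 → ℤ} (h : cr u w = 1) (z : Fin 2 → ℤ) :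
    z = cr z w • u + cr u z • w := by
  unfold cr at *
  apply vec_ext <;> simp only [Pi.add_apply, Pi.smul_apply, smul_eq_mul]
  · linear_combination (-z 0) * h
  · linear_combination (-z 1) * h

/-- For consecutive rays this reads u + w = a v, where -a is the self-intersection number of the
divisor of v. All numerical data of the fan are encoded in these a. -/
theorem add_eq_cr_smul {u v w : Fin 2 → ℤ} (h : cr u v = 1) (h' : cr v w = 1) :
    u + w = cr u w • v := by
  unfold cr at *
  apply vec_ext <;> simp only [Pi.add_apply, Pi.smul_apply, smul_eq_mul]
  · linear_combination (-w 0) * h - u 0 * h'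
  · linear_combination (-w 1) * h - u 1 * h'

theorem smul_add_smul_inj {u w : Fin 2 → ℤ} (h : cr u w = 1) {b c b' c' : ℤ}
    (e : b • u + c • w = b' • u + c' • w) : b = b' ∧ c = c' := by
  have h1 := congrArg (fun z => cr z w) e
  have h2 := congrArg (fun z => cr u z) e
  simp only [cr_add_left, cr_add_right, cr_smul_left, cr_smul_right, cr_self, h] at h1 h2
  constructor <;> linarith

/-- `B` is the set of rays of a smooth complete fan in the plane, and `N` sends each ray to the
next one. -/
structure IsSmoothFan (B : Finset (Fin 2 → ℤ)) (N : (Fin 2 → ℤ) → (Fin 2 → ℤ)) : Prop where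
  maps : ∀ u ∈ B, N u ∈ B
  inj : ∀ u ∈ B, ∀ v ∈ B, N u = N v → u = v
  cr_next : ∀ u ∈ B, cr u (N u) = 1
  -- The cones with 0 < b and 0 ≤ c are half-open, so `cover` and `unique` together say that they
  -- partition the nonzero lattice points.
  cover : ∀ x, x ≠ 0 → ∃ u ∈ B, ∃ b c : ℤ, 0 < b ∧ 0 ≤ c ∧ x = b • u + c • N u
  unique : ∀ u ∈ B, ∀ v ∈ B, ∀ b c b' c' : ℤ, 0 < b → 0 ≤ c → 0 < b' → 0 ≤ c' →
    b • u + c • N u = b' • v + c' • N v → u = v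

namespace IsSmoothFan

variable {B : Finset (Fin 2 → ℤ)} {N : (Fin 2 → ℤ) → (Fin 2 → ℤ)}

theorem exists_prev (hF : IsSmoothFan B N) {u : Fin 2 → ℤ} (hu : u ∈ B) : ∃ o ∈ B, N o = u := by
  obtain ⟨o, ho, h⟩ := Finset.surj_on_of_inj_on_of_card_le (s := B) (t := B) (fun a _ => N a)
    (fun a ha => hF.maps a ha) (fun a b ha hb h => hF.inj a ha b hb h) le_rfl u hu
  exact ⟨o, ho, h.symm⟩

theorem bijOn (hF : IsSmoothFan B N) : Set.BijOn N B B :=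
  ⟨fun u hu => hF.maps u hu, fun u hu v hv h => hF.inj u hu v hv h, fun u hu => by
    obtain ⟨o, ho, h⟩ := hF.exists_prev hu
    exact ⟨o, ho, h⟩⟩

theorem sum_next (hF : IsSmoothFan B N) {M : Type*} [AddCommMonoid M] (f : (Fin 2 → ℤ) → M) :
    ∑ u ∈ B, f (N u) = ∑ u ∈ B, f u :=
  Finset.sum_nbij N (fun u hu => hF.maps u hu) hF.bijOn.injOn hF.bijOn.surjOn (fun _ _ => rfl)

theorem iterate_mem (hF : IsSmoothFan B N) {u : Fin 2 → ℤ} (hu : u ∈ B) (i : ℕ) :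
    N^[i] u ∈ B := by
  induction i with
  | zero => exact hu
  | succ i ih => rw [Function.iterate_succ_apply']; exact hF.maps _ ih

theorem nonempty (hF : IsSmoothFan B N) : B.Nonempty := by
  obtain ⟨u, hu, -⟩ := hF.cover (fun _ => 1) (fun h => by simpa using congrFun h 0)
  exact ⟨u, hu⟩

theorem eq_of_eq_cone (hF : IsSmoothFan B N) {u z : Fin 2 → ℤ} (hu : u ∈ B) (hz : z ∈ B)
    {b c : ℤ} (hb : 0 < b) (hc : 0 ≤ c) (h : z = b • u + c • N u) : z = u :=
  hF.unique z hz u hu 1 0 b c one_pos le_rfl hb hc (by simpa using h)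

/-- If the two cones at the ray `u` fill a half plane, no other ray lies in it. -/
theorem cr_next_nonpos (hF : IsSmoothFan B N) {o z : Fin 2 → ℤ} (ho : o ∈ B)
    (ha : cr o (N (N o)) ≤ 0) (hz : z ∈ B) (h1 : z ≠ N o) :
    cr z (N (N o)) ≤ 0 := by
  have hu := hF.maps o ho
  have hw := hF.maps _ hu
  have e := add_eq_cr_smul (hF.cr_next o ho) (hF.cr_next _ hu)
  have ez := eq_cr_smul_add (hF.cr_next _ hu) z
  by_contra! hX
  set a := cr o (N (N o)) with hadef
  set X := cr z (N (N o)) with hXdef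
  set Y := cr (N o) z with hYdef
  rcases le_or_gt 0 Y with hY | hY
  · exact h1 (hF.eq_of_eq_cone hu hz hX hY ez)
  · have : z = (-Y) • o + (X + Y * a) • N o := by
      have e2 : N (N o) = a • N o - o := by rw [← e]; abel
      rw [ez, e2]; module
    have hzo := hF.eq_of_eq_cone ho hz (by omega) (by nlinarith) this
    rw [hzo] at hXdef
    omega

theorem cr_prev_nonpos (hF : IsSmoothFan B N) {o z : Fin 2 → ℤ} (ho : o ∈ B)
    (ha : cr o (N (N o)) ≤ 0) (hz : z ∈ B) (h1 : z ≠ N o) (h2 : z ≠ o) :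
    cr o z ≤ 0 := by
  have hu := hF.maps o ho
  have e := add_eq_cr_smul (hF.cr_next o ho) (hF.cr_next _ hu)
  have ez := eq_cr_smul_add (hF.cr_next o ho) z
  by_contra! hY
  set a := cr o (N (N o)) with hadef
  set X := cr z (N o) with hXdef
  set Y := cr o z with hYdef
  rcases lt_or_ge 0 X with hX | hX
  · exact h2 (hF.eq_of_eq_cone ho hz hX hY.le ez)
  · have : z = (Y + X * a) • N o + (-X) • N (N o) := by
      have e2 : N (N o) = a • N o - o := by rw [← e]; abel
      rw [e2]
      nth_rewrite 1 [ez]; module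
    exact h1 (hF.eq_of_eq_cone hu hz (by nlinarith) (by omega) this)

/-! ### Cyclic order -/

/-- The rays are `x, N x, N² x, …`, in this cyclic order. -/
def IsCyclic (B : Finset (Fin 2 → ℤ)) (N : (Fin 2 → ℤ) → (Fin 2 → ℤ)) (x : Fin 2 → ℤ) : Prop :=
  x ∈ B ∧ N^[B.card] x = x ∧ ∀ y ∈ B, ∃ i < B.card, N^[i] x = y

/-- The numbers `2 - a` at `N x, N² x, …`, where `-a` is the self-intersection number of a ray. -/
def lens (N : (Fin 2 → ℤ) → (Fin 2 → ℤ)) (x : Fin 2 → ℤ) (n : ℕ) : List ℤ :=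
  (List.range n).map fun i => 2 - cr (N^[i] x) (N^[i + 2] x)

theorem IsCyclic.next {x : Fin 2 → ℤ} (hF : IsSmoothFan B N) (h : IsCyclic B N x) :
    IsCyclic B N (N x) := by
  obtain ⟨hx, hp, hc⟩ := h
  refine ⟨hF.maps x hx, ?_, fun y hy => ?_⟩
  · rw [← Function.iterate_succ_apply, Function.iterate_succ_apply', hp]
  · obtain ⟨i, hi, rfl⟩ := hc y hy
    rcases i with _ | i
    · refine ⟨B.card - 1, by omega, ?_⟩
      rw [← Function.iterate_succ_apply, Nat.succ_eq_add_one, Nat.sub_add_cancel (by omega), hp]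
      rfl
    · exact ⟨i, by omega, rfl⟩

theorem lens_next {x : Fin 2 → ℤ} {n : ℕ} (hp : N^[n + 1] x = x) :
    lens N (N x) (n + 1) = (lens N x (n + 1)).rotate 1 := by
  unfold lens
  rw [List.range_succ, List.map_append, ← List.range_succ, List.range_succ_eq_map, List.map_cons,
    List.map_cons, List.rotate_cons_succ, List.rotate_zero, List.map_map]
  congr 1
  simp only [List.map_nil, ← Function.iterate_succ_apply, Nat.succ_eq_add_one]
  have h2 : N^[n + 2 + 1] x = N^[0 + 2] x := by
    rw [show n + 2 + 1 = 2 + (n + 1) by ring, Function.iterate_add_apply, hp]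
  rw [hp, h2]; rfl

/-- The first `B.card` iterates exhaust `B`, so by counting they are distinct. -/
theorem IsCyclic.iterate_injOn {x : Fin 2 → ℤ} (h : IsCyclic B N x) :
    Set.InjOn (fun i => N^[i] x) (Finset.range B.card) := by
  have hsurj : Set.SurjOn (fun i => N^[i] x) (Finset.range B.card) B := by
    intro y hy
    obtain ⟨i, hi, h⟩ := h.2.2 y hy
    exact ⟨i, by simpa using hi, h⟩
  have himg : B ⊆ (Finset.range B.card).image (fun i => N^[i] x) := by
    intro y hy
    obtain ⟨i, hi, h⟩ := hsurj hy
    exact Finset.mem_image.2 ⟨i, by simpa using hi, h⟩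
  apply Finset.card_image_iff.1
  refine le_antisymm Finset.card_image_le ?_
  simpa using Finset.card_le_card himg

theorem IsCyclic.sum_eq {x : Fin 2 → ℤ} (hF : IsSmoothFan B N) (h : IsCyclic B N x)
    {M : Type*} [AddCommMonoid M] (f : (Fin 2 → ℤ) → M) :
    ∑ u ∈ B, f u = ∑ i ∈ Finset.range B.card, f (N^[i] x) := by
  symm
  refine Finset.sum_nbij (fun i => N^[i] x) (fun i _ => hF.iterate_mem h.1 i) h.iterate_injOn
    (fun y hy => ?_) (fun _ _ => rfl)
  obtain ⟨i, hi, e⟩ := h.2.2 y hy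
  exact ⟨i, by simpa using hi, e⟩

/-! ### Blowing down -/

/-- Contraction of a (-1)-curve: with v = N u and t = N v, the value a = 1 means u + t = v, so v
merely subdivides the unimodular cone of u and t. -/
theorem blowDown (hF : IsSmoothFan B N) {u : Fin 2 → ℤ} (hu : u ∈ B) (h1 : cr u (N (N u)) = 1) :
    IsSmoothFan (B.erase (N u)) (Function.update N u (N (N u))) := by
  have hv := hF.maps u hu
  have ht := hF.maps _ hv
  have e : u + N (N u) = N u := by
    have := add_eq_cr_smul (hF.cr_next u hu) (hF.cr_next _ hv)
    rwa [h1, one_smul] at this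
  set v := N u with hvdef
  set t := N v with htdef
  have huv : u ≠ v := fun h => by
    have := hF.cr_next u hu; rw [← hvdef, ← h, cr_self] at this; omega
  have htv : t ≠ v := fun h => by
    have := hF.cr_next v hv; rw [← htdef, h, cr_self] at this; omega
  have hN : ∀ w, w ≠ u → Function.update N u t w = N w := fun w hw => Function.update_of_ne hw _ _
  refine ⟨fun w hw => ?_, fun w hw w' hw' h => ?_, fun w hw => ?_, fun x hx => ?_, ?_⟩
  · obtain ⟨hwv, hwB⟩ := Finset.mem_erase.1 hw
    by_cases hwu : w = u
    · subst hwu; rw [Function.update_self]; exact Finset.mem_erase.2 ⟨htv, ht⟩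
    · rw [hN w hwu]
      exact Finset.mem_erase.2 ⟨fun h => hwu (hF.inj w hwB u hu h), hF.maps w hwB⟩
  · obtain ⟨hwv, hwB⟩ := Finset.mem_erase.1 hw
    obtain ⟨hwv', hwB'⟩ := Finset.mem_erase.1 hw'
    by_cases hwu : w = u <;> by_cases hwu' : w' = u
    · rw [hwu, hwu']
    · rw [hwu, Function.update_self, hN w' hwu'] at h
      exact absurd (hF.inj v hv w' hwB' h).symm hwv'
    · rw [hwu', Function.update_self, hN w hwu] at h
      exact absurd (hF.inj w hwB v hv h) hwv
    · rw [hN w hwu, hN w' hwu'] at h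
      exact hF.inj w hwB w' hwB' h
  · obtain ⟨hwv, hwB⟩ := Finset.mem_erase.1 hw
    by_cases hwu : w = u
    · subst hwu; rwa [Function.update_self]
    · rw [hN w hwu]; exact hF.cr_next w hwB
  · obtain ⟨w, hw, b, c, hb, hc, rfl⟩ := hF.cover x hx
    by_cases hwu : w = u
    · subst hwu
      refine ⟨w, Finset.mem_erase.2 ⟨huv, hw⟩, b + c, c, by omega, hc, ?_⟩
      rw [Function.update_self, ← hvdef, ← e]; module
    · by_cases hwv : w = v
      · subst hwv
        refine ⟨u, Finset.mem_erase.2 ⟨huv, hu⟩, b, b + c, hb, by omega, ?_⟩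
        rw [Function.update_self]
        nth_rewrite 1 [← e]
        module
      · exact ⟨w, Finset.mem_erase.2 ⟨hwv, hw⟩, b, c, hb, hc, by rw [hN w hwu]⟩
  -- A vector b u + c t of the merged cone lies in the old cone at u if c < b and in the one at v
  -- otherwise. All other cones are unchanged, so uniqueness is inherited.
  · have key : ∀ w ∈ B.erase v, ∀ b c : ℤ, 0 < b → 0 ≤ c → ∃ w' ∈ B, ∃ b' c' : ℤ, 0 < b' ∧
        0 ≤ c' ∧ b • w + c • Function.update N u t w = b' • w' + c' • N w' ∧
        (w = u ∧ (w' = u ∨ w' = v) ∨ w ≠ u ∧ w' = w) := by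
      intro w hw b c hb hc
      obtain ⟨hwv, hwB⟩ := Finset.mem_erase.1 hw
      by_cases hwu : w = u
      · subst hwu
        rw [Function.update_self]
        rcases lt_or_ge c b with h | h
        · refine ⟨w, hu, b - c, c, by omega, hc, ?_, Or.inl ⟨rfl, Or.inl rfl⟩⟩
          rw [← hvdef, ← e]; module
        · refine ⟨v, hv, b, c - b, hb, by omega, ?_, Or.inl ⟨rfl, Or.inr rfl⟩⟩
          rw [← htdef]
          nth_rewrite 1 [← e]
          module
      · exact ⟨w, hwB, b, c, hb, hc, by rw [hN w hwu], Or.inr ⟨hwu, rfl⟩⟩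
    intro w hw z hz b c b' c' hb hc hb' hc' h
    obtain ⟨w1, hw1, b1, c1, hb1, hc1, e1, d1⟩ := key w hw b c hb hc
    obtain ⟨z1, hz1, b2, c2, hb2, hc2, e2, d2⟩ := key z hz b' c' hb' hc'
    have hwz := hF.unique w1 hw1 z1 hz1 b1 c1 b2 c2 hb1 hc1 hb2 hc2 (by rw [← e1, h, e2])
    have hwv := (Finset.mem_erase.1 hw).1
    have hzv := (Finset.mem_erase.1 hz).1
    rcases d1 with ⟨r1, r2⟩ | ⟨r1, r2⟩ <;> rcases d2 with ⟨s1, s2⟩ | ⟨s1, s2⟩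
    · rw [r1, s1]
    · rw [hwz, s2] at r2
      exact absurd r2 (not_or.2 ⟨s1, hzv⟩)
    · rw [← hwz, r2] at s2
      exact absurd s2 (not_or.2 ⟨r1, hwv⟩)
    · rw [← r2, hwz, s2]

/-- The contraction raises the self-intersection numbers of the two neighbours by one, so a drops by
one there and is unchanged elsewhere. -/
theorem blowDown_cr_le (hF : IsSmoothFan B N) (h2 : ∀ w ∈ B, cr w (N (N w)) ≤ 2)
    {u : Fin 2 → ℤ} (hu : u ∈ B) (h1 : cr u (N (N u)) = 1) :
    ∀ w ∈ B.erase (N u), cr w (Function.update N u (N (N u)) (Function.update N u (N (N u)) w))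
      ≤ 2 := by
  have hv := hF.maps u hu
  have ht := hF.maps _ hv
  have e : u + N (N u) = N u := by
    have := add_eq_cr_smul (hF.cr_next u hu) (hF.cr_next _ hv)
    rwa [h1, one_smul] at this
  set v := N u with hvdef
  set t := N v with htdef
  have hut : t ≠ u := fun h => by rw [h, cr_self] at h1; omega
  intro w hw
  obtain ⟨hwv, hwB⟩ := Finset.mem_erase.1 hw
  by_cases hwu : w = u
  · subst hwu
    rw [Function.update_self, Function.update_of_ne hut]
    have := h2 v hv
    have h3 := hF.cr_next t ht
    rw [← htdef, ← e, cr_add_left, h3] at this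
    omega
  · rw [Function.update_of_ne hwu]
    by_cases hNw : N w = u
    · rw [hNw, Function.update_self]
      have := h2 w hwB
      have h3 := hF.cr_next w hwB
      rw [hNw] at this h3
      rw [← hvdef, ← e, cr_add_right, h3] at this
      omega
    · rw [Function.update_of_ne hNw]; exact h2 w hwB

/-- Starting the cycle at t = N (N u) puts the contracted ray v at its end. Then only the last two
lengths, those at u and t, change: each drops by 1, and the length 1 of v is inserted between them.
-/
theorem blowDown_isCyclic (hF : IsSmoothFan B N)
    {u : Fin 2 → ℤ} (hu : u ∈ B) (h1 : cr u (N (N u)) = 1)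
    (hc : IsCyclic (B.erase (N u)) (Function.update N u (N (N u))) (N (N u))) :
    ∃ k, ∃ m : List ℤ, ∃ p q : ℤ, B.card = k + 3 ∧ (B.erase (N u)).card = k + 2 ∧
      IsCyclic B N (N (N u)) ∧
      lens (Function.update N u (N (N u))) (N (N u)) (k + 2) = m ++ [p, q] ∧
      lens N (N (N u)) (k + 3) = m ++ [p - 1, 1, q - 1] := by
  have hv := hF.maps u hu
  have ht := hF.maps _ hv
  have e : u + N (N u) = N u := by
    have := add_eq_cr_smul (hF.cr_next u hu) (hF.cr_next _ hv)
    rwa [h1, one_smul] at this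
  set v := N u with hvdef
  set t := N v with htdef
  have hut : t ≠ u := fun h => by rw [h, cr_self] at h1; omega
  have huv : u ≠ v := fun h => by
    have := hF.cr_next u hu; rw [← hvdef, ← h, cr_self] at this; omega
  set N' := Function.update N u t with hN'
  have hcard : (B.erase v).card + 1 = B.card := Finset.card_erase_add_one hv
  have hu' : u ∈ B.erase v := Finset.mem_erase.2 ⟨huv, hu⟩
  have hinj := hc.iterate_injOn
  obtain ⟨i, hi, hiu⟩ := hc.2.2 u hu'
  -- The new successor of u is the starting ray t, so u is the last ray of the short cycle.
  have hi1 : i + 1 = (B.erase v).card := by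
    by_contra hne
    have h0 : N'^[i + 1] t = N'^[0] t := by
      rw [Function.iterate_succ_apply', hiu, hN', Function.update_self]; rfl
    have := hinj (x₁ := i + 1) (x₂ := 0) (Finset.mem_coe.2 (Finset.mem_range.2 (by omega)))
        (Finset.mem_coe.2 (Finset.mem_range.2 (by omega))) h0
    omega
  have hi0 : i ≠ 0 := by
    rintro rfl; exact hut hiu
  obtain ⟨k, rfl⟩ : ∃ k, i = k + 1 := ⟨i - 1, by omega⟩
  -- The two successor maps differ only at u, which is not reached before step k + 1.
  have hit : ∀ j ≤ k + 1, N^[j] t = N'^[j] t := by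
    intro j
    induction j with
    | zero => intro _; rfl
    | succ j ih =>
      intro hj
      rw [Function.iterate_succ_apply', Function.iterate_succ_apply', ih (by omega), hN',
        Function.update_of_ne]
      intro hj2
      have := hinj (x₁ := j) (x₂ := k + 1) (Finset.mem_coe.2 (Finset.mem_range.2 (by omega)))
        (Finset.mem_coe.2 (Finset.mem_range.2 (by omega)))
        (by rw [← hN'] at hj2; simpa [hiu] using hj2)
      omega
  have hNu : N^[k + 1] t = u := by rw [hit _ le_rfl, hiu]
  have hNv : N^[k + 2] t = v := by rw [Function.iterate_succ_apply', hNu]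
  have hNt : N^[k + 3] t = t := by rw [Function.iterate_succ_apply', hNv]
  have hNt' : N'^[k + 2] t = t := by
    rw [Function.iterate_succ_apply', hiu, hN', Function.update_self]
  refine ⟨k, (List.range k).map (fun i => 2 - cr (N^[i] t) (N^[i + 2] t)),
    2 - cr (N^[k] t) t, 2 - cr u (N t), by omega, by omega,
    ⟨ht, by rw [← hcard, ← hi1]; exact hNt, fun y hy => ?_⟩, ?_, ?_⟩
  · by_cases hyv : y = v
    · exact ⟨k + 2, by omega, by rw [hNv, hyv]⟩
    · obtain ⟨j, hj, hjy⟩ := hc.2.2 y (Finset.mem_erase.2 ⟨hyv, hy⟩)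
      exact ⟨j, by omega, by rw [hit j (by omega), hjy]⟩
  · unfold lens
    rw [List.range_succ, List.range_succ, List.map_append, List.map_append, List.append_assoc]
    congr 1
    · apply List.map_congr_left
      intro j hj
      have := List.mem_range.1 hj
      rw [hit j (by omega), hit (j + 2) (by omega)]
    · simp only [List.map_cons, List.map_nil, List.cons_append, List.nil_append]
      rw [hNt', ← hit k (by omega), hiu, show k + 1 + 2 = (k + 2) + 1 by ring,
        Function.iterate_succ_apply' N' (k + 2), hNt', hN', Function.update_of_ne hut]
  · unfold lens
    rw [List.range_succ, List.range_succ, List.range_succ, List.map_append, List.map_append,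
      List.map_append, List.append_assoc, List.append_assoc]
    congr 1
    simp only [List.map_cons, List.map_nil, List.cons_append, List.nil_append]
    have e1 : N^[k + 2 + 2] t = N t := by
      rw [Function.iterate_succ_apply', hNt]
    have ho : cr (N^[k] t) u = 1 := by
      have := hF.cr_next _ (hF.iterate_mem ht k)
      rwa [← Function.iterate_succ_apply' N, hNu] at this
    have h4 : cr (N^[k] t) v = 1 + cr (N^[k] t) t := by
      rw [← e, cr_add_right, ho]
    have h5 : cr v (N t) = cr u (N t) + 1 := by
      rw [← e, cr_add_left, hF.cr_next t ht]
    rw [e1, hNv, hNu, show k + 1 + 2 = k + 3 by ring, hNt, h4, h5, h1]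
    congr 1
    · ring
    · congr 1; congr 1; ring

end IsSmoothFan

namespace IsSmoothFan

variable {B : Finset (Fin 2 → ℤ)} {N : (Fin 2 → ℤ) → (Fin 2 → ℤ)}

/-! ### The minimal fans -/

/-- Rays are primitive: q = c • p together with `cr q (N q) = 1` makes c a unit. -/
theorem eq_or_eq_neg (hF : IsSmoothFan B N) {p q : Fin 2 → ℤ} (hp : p ∈ B) (hq : q ∈ B)
    (h : cr p q = 0) : q = p ∨ q = -p := by
  have e := eq_cr_smul_add (hF.cr_next p hp) q
  rw [h, zero_smul, add_zero] at e
  have h1 := hF.cr_next q hq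
  nth_rewrite 1 [e] at h1
  rw [cr_smul_left] at h1
  rcases Int.isUnit_iff.1 (IsUnit.of_mul_eq_one _ h1) with h2 | h2
  · left; rw [e, h2, one_smul]
  · right; rw [e, h2, neg_one_smul]

theorem ne_next_next (hF : IsSmoothFan B N) {u : Fin 2 → ℤ} (hu : u ∈ B) : N (N u) ≠ u := by
  intro h
  have h1 := hF.cr_next u hu
  have h2 := hF.cr_next _ (hF.maps u hu)
  rw [h, cr_swap] at h2
  omega

theorem ne_next (hF : IsSmoothFan B N) {u : Fin 2 → ℤ} (hu : u ∈ B) : N u ≠ u := by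
  intro h
  have h1 := hF.cr_next u hu
  rw [h, cr_self] at h1
  omega

theorem ne_zero (hF : IsSmoothFan B N) {u : Fin 2 → ℤ} (hu : u ∈ B) : u ≠ 0 := by
  rintro rfl
  have h1 := hF.cr_next 0 hu
  simp [cr] at h1

theorem cr_prev_nonpos' (hF : IsSmoothFan B N) {o z : Fin 2 → ℤ} (ho : o ∈ B)
    (ha : cr o (N (N o)) ≤ 0) (hz : z ∈ B) (h1 : z ≠ N o) : cr o z ≤ 0 := by
  by_cases h : z = o
  · rw [h, cr_self]
  · exact hF.cr_prev_nonpos ho ha hz h1 h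

/-- If a ≤ 0 at a ray, its two adjacent cones fill a half plane or more, and the other rays are
confined to the opposite side. Two such rays that are not neighbours confine each other so strictly
that the two bounding lines coincide. -/
theorem four_cycle (hF : IsSmoothFan B N) {o o' : Fin 2 → ℤ} (ho : o ∈ B) (ho' : o' ∈ B)
    (ha : cr o (N (N o)) ≤ 0) (ha' : cr o' (N (N o')) ≤ 0) (h1 : N o' ≠ N o)
    (h2 : N o' ≠ N (N o)) (h3 : N o' ≠ o) :
    N (N o) = -o ∧ N (N (N (N o))) = o ∧
      ∀ z ∈ B, z = o ∨ z = N o ∨ z = N (N o) ∨ z = N (N (N o)) := by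
  have hx := hF.maps o ho
  have hx' := hF.maps o' ho'
  have hw := hF.maps _ hx
  have hw' := hF.maps _ hx'
  have e' := add_eq_cr_smul (hF.cr_next o' ho') (hF.cr_next _ hx')
  have n1 : o' ≠ N o := fun h => h2 (by rw [h])
  have n2 : N (N o') ≠ N o := fun h => h3 (hF.inj _ hx' _ ho h)
  have c1 := hF.cr_next_nonpos ho ha hx' h1
  have c2 := hF.cr_next_nonpos ho ha ho' n1
  have c3 := hF.cr_next_nonpos ho ha hw' n2
  have c4 := hF.cr_prev_nonpos' ho ha hx' h1
  have c5 := hF.cr_prev_nonpos' ho ha ho' n1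
  have c6 := hF.cr_prev_nonpos' ho ha hw' n2
  -- Pair o' + N (N o') = a' N o' with N (N o) and with o. The left sides have nonpositive terms
  -- and, as a' ≤ 0, the right sides are nonnegative, so the terms on the left vanish.
  have s1 := congrArg (fun z => cr z (N (N o))) e'
  have s2 := congrArg (fun z => cr o z) e'
  simp only [cr_add_left, cr_add_right, cr_smul_left, cr_smul_right] at s1 s2
  have d2 : cr o' (N (N o)) = 0 := by nlinarith
  have d3 : cr (N (N o')) (N (N o)) = 0 := by nlinarith
  have d6 : cr o (N (N o')) = 0 := by nlinarith
  have f3 : N (N o') = -N (N o) := by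
    rcases hF.eq_or_eq_neg hw hw' (by rw [cr_swap, d3, neg_zero]) with h | h
    · exact absurd (hF.inj _ hx' _ hx h) h1
    · exact h
  have f2 : o' = N (N o) := by
    rcases hF.eq_or_eq_neg hw ho' (by rw [cr_swap, d2, neg_zero]) with h | h
    · exact h
    · exact absurd (f3.trans h.symm) (hF.ne_next_next ho')
  have f6 : N (N o) = -o := by
    have : cr o (N (N o)) = 0 := by
      rw [f3, cr_neg_right] at d6; omega
    exact (hF.eq_or_eq_neg ho hw this).resolve_left (hF.ne_next_next ho)
  rw [f2] at f3 ha'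
  have f7 : N (N (N (N o))) = o := by rw [f3, f6, neg_neg]
  refine ⟨f6, f7, fun z hz => ?_⟩
  by_cases z1 : z = N o
  · exact Or.inr (Or.inl z1)
  by_cases z2 : z = N (N (N o))
  · exact Or.inr (Or.inr (Or.inr z2))
  have g1 := hF.cr_next_nonpos ho ha hz z1
  have g2 := hF.cr_next_nonpos hw ha' hz z2
  rw [f3, cr_neg_right] at g2
  have g3 : cr (N (N o)) z = 0 := by rw [cr_swap]; omega
  rcases hF.eq_or_eq_neg hw hz g3 with h | h
  · exact Or.inr (Or.inr (Or.inl h))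
  · left; rw [h, f6, neg_neg]

/-- If a = 2 everywhere, the rays form an arithmetic progression, and `cr u (N^[k] u) = k` takes
infinitely many values on a finite set. -/
theorem exists_cr_ne_two (hF : IsSmoothFan B N) : ∃ u ∈ B, cr u (N (N u)) ≠ 2 := by
  by_contra! h
  obtain ⟨u, hu⟩ := hF.nonempty
  have key : ∀ k : ℕ, cr u (N^[k] u) = k ∧ cr u (N^[k + 1] u) = k + 1 := by
    intro k
    induction k with
    | zero => exact ⟨by simp [cr_self], by simpa using hF.cr_next u hu⟩
    | succ k ih =>
      refine ⟨by rw [ih.2]; push_cast; ring, ?_⟩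
      have hk := hF.iterate_mem hu k
      have e := add_eq_cr_smul (hF.cr_next _ hk) (hF.cr_next _ (hF.maps _ hk))
      rw [h _ hk] at e
      have s := congrArg (fun z => cr u z) e
      simp only [cr_add_right, cr_smul_right, ← Function.iterate_succ_apply' N] at s
      simp only [Nat.succ_eq_add_one] at s
      rw [ih.1, ih.2] at s
      push_cast
      linarith
  obtain ⟨i, hi, j, hj, hij, e⟩ := Finset.exists_ne_map_eq_of_card_lt_of_maps_to
    (s := Finset.range (B.card + 1)) (t := B) (by simp) (f := fun i => N^[i] u)
    (fun i _ => hF.iterate_mem hu i)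
  have := congrArg (fun z => cr u z) e
  simp only [(key i).1, (key j).1] at this
  exact hij (by exact_mod_cast this)

/-- The balancing relation ∑ (2 - a_v) v = 0, tested against z: each summand is the second
difference 2v - u - w, which telescopes around the cycle. -/
theorem sum_two_sub_cr_mul (hF : IsSmoothFan B N) (z : Fin 2 → ℤ) :
    ∑ u ∈ B, (2 - cr u (N (N u))) * cr (N u) z = 0 := by
  have h : ∀ u ∈ B, (2 - cr u (N (N u))) * cr (N u) z =
      2 * cr (N u) z - cr u z - cr (N (N u)) z := by
    intro u hu
    have e := congrArg (fun x => cr x z)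
      (add_eq_cr_smul (hF.cr_next u hu) (hF.cr_next _ (hF.maps u hu)))
    simp only [cr_add_left, cr_smul_left] at e
    linarith
  rw [Finset.sum_congr rfl h, Finset.sum_sub_distrib, Finset.sum_sub_distrib, ← Finset.mul_sum,
    hF.sum_next (fun u => cr (N u) z), hF.sum_next (fun u => cr u z)]
  ring

/-- Without (-1)-curves each a is 2 or at most 0. Either two non-neighbouring rays have a ≤ 0 and
`four_cycle` applies, or the rays with a ≠ 2 lie among o, N o, N (N o). In the latter case balancing
forces a ≤ 0 at all three. -/
theorem three_or_four_cycle (hF : IsSmoothFan B N) (h2 : ∀ u ∈ B, cr u (N (N u)) ≤ 2)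
    (h1 : ∀ u ∈ B, cr u (N (N u)) ≠ 1) :
    ∃ o ∈ B, (N (N (N o)) = o ∧ ∀ z ∈ B, z = o ∨ z = N o ∨ z = N (N o)) ∨
      (N (N o) = -o ∧ N (N (N (N o))) = o ∧
      ∀ z ∈ B, z = o ∨ z = N o ∨ z = N (N o) ∨ z = N (N (N o))) := by
  have hZ : ∀ u ∈ B, cr u (N (N u)) ≠ 2 → cr u (N (N u)) ≤ 0 := fun u hu h => by
    have := h2 u hu
    have := h1 u hu
    omega
  obtain ⟨o, ho, hne⟩ := hF.exists_cr_ne_two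
  have ha := hZ o ho hne
  have hu := hF.maps o ho
  have hw := hF.maps _ hu
  obtain ⟨q, hq, hqo⟩ := hF.exists_prev ho
  by_cases hex : ∃ o' ∈ B, cr o' (N (N o')) ≠ 2 ∧ N o' ≠ N o ∧ N o' ≠ N (N o) ∧ N o' ≠ o
  · obtain ⟨o', ho', hne', n1, n2, n3⟩ := hex
    exact ⟨o, ho, Or.inr (hF.four_cycle ho ho' ha (hZ o' ho' hne') n1 n2 n3)⟩
  push Not at hex
  have nuo : N o ≠ o := hF.ne_next ho
  have nqo : o ≠ q := by
    intro h; exact hF.ne_next hq (hqo.trans h)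
  have nqu : N o ≠ q := by
    intro h; rw [← h] at hqo; exact hF.ne_next_next ho hqo
  have hsum : ∀ z, (2 - cr o (N (N o))) * cr (N o) z + ((2 - cr (N o) (N (N (N o)))) *
      cr (N (N o)) z + (2 - cr q (N (N q))) * cr o z) = 0 := by
    intro z
    rw [← hF.sum_two_sub_cr_mul z]
    rw [← Finset.sum_subset (s₁ := {o, N o, q})]
    · rw [Finset.sum_insert (by simp [nuo.symm, nqo]), Finset.sum_pair nqu, hqo]
    · intro x hx
      simp only [Finset.mem_insert, Finset.mem_singleton] at hx
      rcases hx with rfl | rfl | rfl <;> assumption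
    · intro x hx hx'
      simp only [Finset.mem_insert, Finset.mem_singleton, not_or] at hx'
      by_cases hx2 : cr x (N (N x)) = 2
      · rw [hx2]; ring
      · exfalso
        refine hx'.2.2 (hF.inj _ hx _ hq ?_)
        rw [hqo]
        refine hex x hx hx2 (fun h => hx'.1 (hF.inj _ hx _ ho h))
          (fun h => hx'.2.1 (hF.inj _ hx _ hu h))
  -- Testing against N o shows that the weights 2 - a at o and at N (N o) agree. Testing against N
  -- (N o) shows that the weight at o cannot vanish, since the one at N o does not.
  have s1 := hsum (N o)
  have s2 := hsum (N (N o))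
  rw [cr_self, hF.cr_next o ho, cr_swap (N (N o)), hF.cr_next _ hu] at s1
  rw [cr_self, hF.cr_next _ hu] at s2
  have hq2 : cr q (N (N q)) ≠ 2 := by
    intro h; rw [h] at s2; linarith
  have haq := hZ q hq hq2
  have hau : cr (N o) (N (N (N o))) ≤ 0 := by linarith
  by_cases h3 : o = N (N (N o))
  · refine ⟨o, ho, Or.inl ⟨h3.symm, fun z hz => ?_⟩⟩
    by_contra! hc
    have hqw : q = N (N o) := hF.inj _ hq _ hw (by rw [hqo, ← h3])
    have c1 := hF.cr_next_nonpos ho ha hz hc.2.1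
    have c2 := hF.cr_next_nonpos hu hau hz hc.2.2
    have c3 := hF.cr_next_nonpos hq haq hz (by rw [hqo]; exact hc.1)
    rw [← h3] at c2
    rw [hqo] at c3
    -- Here o + N o + N (N o) = 0, so the three nonpositive determinants of z with these rays add up
    -- to 0. They all vanish and z = 0.
    have e := congrArg (fun x => cr z x) (add_eq_cr_smul (hF.cr_next o ho) (hF.cr_next _ hu))
    have hm : cr o (N (N o)) = -1 := by
      have := hF.cr_next _ hw
      rw [← h3, cr_swap] at this
      omega
    simp only [hm, cr_add_right, cr_smul_right] at e
    have ez := eq_cr_smul_add (hF.cr_next o ho) z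
    rw [show cr z (N o) = 0 by linarith, show cr o z = 0 by rw [cr_swap]; linarith] at ez
    exact hF.ne_zero hz (by simpa using ez)
  · refine ⟨N o, hu, Or.inr (hF.four_cycle hu hq hau haq ?_ ?_ ?_)⟩
    · rw [hqo]; exact (hF.ne_next_next ho).symm
    · rw [hqo]; exact h3
    · rw [hqo]; exact nuo.symm

end IsSmoothFan

/-! ### Classification -/

/-- The edge lengths of the reflexive polygons, in cyclic order. -/
def edgeLengthReps : List (List ℤ) :=
  [[3, 3, 3], [0, 2, 4, 2], [1, 2, 3, 2], [2, 2, 2, 2], [0, 1, 1, 3, 2], [0, 2, 3, 1, 1],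
    [1, 1, 1, 2, 2], [0, 0, 1, 0, 3, 2], [0, 0, 2, 3, 0, 1], [0, 1, 0, 1, 2, 2],
    [0, 1, 0, 2, 2, 1], [0, 1, 1, 2, 1, 1], [1, 1, 1, 1, 1, 1], [0, 0, 1, 0, 2, 1, 1],
    [0, 0, 1, 1, 2, 0, 1], [0, 1, 0, 1, 1, 1, 1], [0, 0, 0, 1, 0, 2, 0, 1],
    [0, 0, 1, 0, 1, 1, 0, 1], [0, 1, 0, 1, 0, 1, 0, 1], [0, 0, 1, 0, 0, 1, 0, 0, 1]]

/-- Rotations account for the choice of the first ray. The representatives are not taken up to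
reflection, so the 16 polygons give 20 of them. -/
def edgeLengths : List (List ℤ) :=
  edgeLengthReps.flatMap fun l => (List.range l.length).map fun k => l.rotate k

/-- The edge lengths after the blow-up at the intersection of the last two divisors. -/
def blowUpLengths (l : List ℤ) : List ℤ :=
  match l.reverse with
  | q :: p :: m => m.reverse ++ [p - 1, 1, q - 1]
  | _ => []

theorem blowUpLengths_append (m : List ℤ) (p q : ℤ) :
    blowUpLengths (m ++ [p, q]) = m ++ [p - 1, 1, q - 1] := by
  simp [blowUpLengths]

theorem rotate_mem_edgeLengths : ∀ l ∈ edgeLengths, l.rotate 1 ∈ edgeLengths := by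
  decide +kernel

/-- The inductive step of the classification. Blowing up at the end of the list is enough because
the list is closed under rotation; nonnegativity is the condition a ≤ 2. -/
theorem blowUpLengths_mem_edgeLengths :
    ∀ l ∈ edgeLengths, (∀ a ∈ blowUpLengths l, 0 ≤ a) → blowUpLengths l ∈ edgeLengths := by
  decide +kernel

theorem sum_add_length_edgeLengths : ∀ l ∈ edgeLengths, l.sum + l.length = 12 := by
  decide +kernel

namespace IsSmoothFan

variable {B : Finset (Fin 2 → ℤ)} {N : (Fin 2 → ℤ) → (Fin 2 → ℤ)}

theorem lens_nonneg (hF : IsSmoothFan B N) (h2 : ∀ u ∈ B, cr u (N (N u)) ≤ 2)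
    {x : Fin 2 → ℤ} (hx : x ∈ B) (n : ℕ) : ∀ a ∈ lens N x n, 0 ≤ a := by
  intro a ha
  obtain ⟨i, -, rfl⟩ := List.mem_map.1 ha
  have := h2 _ (hF.iterate_mem hx i)
  rw [Function.iterate_succ_apply', Function.iterate_succ_apply']
  omega

theorem forall_cyclic_of_cyclic (hF : IsSmoothFan B N) {x : Fin 2 → ℤ}
    (hx : IsCyclic B N x) (hl : lens N x B.card ∈ edgeLengths) :
    ∀ y ∈ B, IsCyclic B N y ∧ lens N y B.card ∈ edgeLengths := by
  intro y hy
  obtain ⟨i, -, rfl⟩ := hx.2.2 y hy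
  clear hy
  induction i with
  | zero => exact ⟨hx, hl⟩
  | succ i ih =>
    rw [Function.iterate_succ_apply']
    refine ⟨ih.1.next hF, ?_⟩
    obtain ⟨n, hn⟩ : ∃ n, B.card = n + 1 :=
      ⟨B.card - 1, by have := Finset.card_pos.2 hF.nonempty; omega⟩
    have hp := ih.1.2.1
    rw [hn] at ih hp ⊢
    rw [lens_next hp]
    exact rotate_mem_edgeLengths _ ih.2

theorem three_cycle_lens (hF : IsSmoothFan B N) {o : Fin 2 → ℤ} (ho : o ∈ B)
    (h : N (N (N o)) = o) (hB : ∀ z ∈ B, z = o ∨ z = N o ∨ z = N (N o)) :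
    IsCyclic B N o ∧ lens N o B.card ∈ edgeLengths := by
  have hu := hF.maps o ho
  have hw := hF.maps _ hu
  have hBe : B = {o, N o, N (N o)} := by
    ext z
    simp only [Finset.mem_insert, Finset.mem_singleton]
    refine ⟨hB z, ?_⟩
    rintro (rfl | rfl | rfl) <;> assumption
  have hcard : B.card = 3 := by
    rw [hBe, Finset.card_eq_three]
    exact ⟨_, _, _, (hF.ne_next ho).symm, (hF.ne_next_next ho).symm, (hF.ne_next hu).symm, rfl⟩
  have a1 := hF.cr_next o ho
  have a2 := hF.cr_next _ hu
  have a3 := hF.cr_next _ hw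
  rw [h] at a3
  refine ⟨⟨ho, by rw [hcard]; exact h, fun y hy => ?_⟩, ?_⟩
  · rcases hB y hy with rfl | rfl | rfl
    · exact ⟨0, by omega, rfl⟩
    · exact ⟨1, by omega, rfl⟩
    · exact ⟨2, by omega, rfl⟩
  · have : lens N o 3 = [3, 3, 3] := by
      simp only [lens, List.range_succ_eq_map, List.range_zero, List.map_cons, List.map_nil,
        Function.iterate_succ_apply, Function.iterate_zero, id, Nat.succ_eq_add_one, zero_add, h]
      rw [cr_swap o, a3, cr_swap (N o) o, a1, cr_swap _ (N o), a2]
      norm_num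
    rw [hcard, this]
    decide +kernel

/-- These are Hirzebruch surfaces, with lengths 2, 2 - a, 2, 2 + a. The bound |a| ≤ 2 and the
absence of (-1)-curves leave a = -2, 0, 2. -/
theorem four_cycle_lens (hF : IsSmoothFan B N) (h2 : ∀ u ∈ B, cr u (N (N u)) ≤ 2)
    (h1 : ∀ u ∈ B, cr u (N (N u)) ≠ 1) {o : Fin 2 → ℤ} (ho : o ∈ B)
    (hn : N (N o) = -o) (h : N (N (N (N o))) = o)
    (hB : ∀ z ∈ B, z = o ∨ z = N o ∨ z = N (N o) ∨ z = N (N (N o))) :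
    IsCyclic B N o ∧ lens N o B.card ∈ edgeLengths := by
  have hu := hF.maps o ho
  have hw := hF.maps _ hu
  have hx := hF.maps _ hw
  have hBe : B = {o, N o, N (N o), N (N (N o))} := by
    ext z
    simp only [Finset.mem_insert, Finset.mem_singleton]
    refine ⟨hB z, ?_⟩
    rintro (rfl | rfl | rfl | rfl) <;> assumption
  have n1 : o ≠ N (N (N o)) := fun e => hF.ne_next hx (by rw [h]; exact e)
  have hcard : B.card = 4 := by
    rw [hBe, Finset.card_insert_of_notMem, Finset.card_eq_three.2
      ⟨_, _, _, (hF.ne_next hu).symm, (hF.ne_next_next hu).symm, (hF.ne_next hw).symm, rfl⟩]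
    simp only [Finset.mem_insert, Finset.mem_singleton, not_or]
    exact ⟨(hF.ne_next ho).symm, (hF.ne_next_next ho).symm, n1⟩
  refine ⟨⟨ho, by rw [hcard]; exact h, fun y hy => ?_⟩, ?_⟩
  · rcases hB y hy with rfl | rfl | rfl | rfl
    · exact ⟨0, by omega, rfl⟩
    · exact ⟨1, by omega, rfl⟩
    · exact ⟨2, by omega, rfl⟩
    · exact ⟨3, by omega, rfl⟩
  · set a := cr (N o) (N (N (N o))) with ha
    have b1 := h2 _ hu
    have b2 := h2 _ hx
    have b3 := h1 _ hu
    have b4 := h1 _ hx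
    rw [h, cr_swap, ← ha] at b2 b4
    rw [← ha] at b1 b3
    have : lens N o 4 = [2, 2 - a, 2, 2 + a] := by
      simp only [lens, List.range_succ_eq_map, List.range_zero, List.map_cons, List.map_nil,
        Function.iterate_succ_apply, Function.iterate_zero, id, Nat.succ_eq_add_one, zero_add, h]
      rw [← ha, cr_swap _ (N o), ← ha, hn, cr_swap (-o), cr_neg_right, cr_self]
      norm_num
    rw [hcard, this]
    have hlo : -2 ≤ a := by omega
    clear_value a
    interval_cases a
    · decide +kernel
    · omega
    · decide +kernel
    · omega
    · decide +kernel

/-- The classification of the smooth complete toric surfaces with nef anticanonical divisor. -/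
theorem forall_cyclic (hF : IsSmoothFan B N) (h2 : ∀ u ∈ B, cr u (N (N u)) ≤ 2) :
    ∀ x ∈ B, IsCyclic B N x ∧ lens N x B.card ∈ edgeLengths := by
  induction hk : B.card generalizing B N with
  | zero => exact absurd hF.nonempty (by simpa using hk)
  | succ n ih =>
    rw [← hk]
    by_cases h1 : ∃ u ∈ B, cr u (N (N u)) = 1
    · obtain ⟨u, hu, h1⟩ := h1
      have hv := hF.maps u hu
      have ht := hF.maps _ hv
      have hcard : (B.erase (N u)).card = n := by
        rw [Finset.card_erase_of_mem hv, hk]; rfl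
      obtain ⟨i1, i2⟩ := ih (hF.blowDown hu h1) (hF.blowDown_cr_le h2 hu h1) hcard (N (N u))
        (Finset.mem_erase.2 ⟨hF.ne_next hv, ht⟩)
      obtain ⟨k, m, p, q, k1, k2, k3, k4, k5⟩ := hF.blowDown_isCyclic hu h1 i1
      refine hF.forall_cyclic_of_cyclic k3 ?_
      have hnn := hF.lens_nonneg h2 ht B.card
      rw [← hcard, k2, k4] at i2
      rw [k1, k5, ← blowUpLengths_append] at hnn ⊢
      exact blowUpLengths_mem_edgeLengths _ i2 hnn
    · push Not at h1
      obtain ⟨o, ho, ⟨e, hB⟩ | ⟨e, e', hB⟩⟩ := hF.three_or_four_cycle h2 h1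
      · have := hF.three_cycle_lens ho e hB
        exact hF.forall_cyclic_of_cyclic this.1 this.2
      · have := hF.four_cycle_lens h2 h1 ho e e' hB
        exact hF.forall_cyclic_of_cyclic this.1 this.2

/-- Noether's formula K² + e = 12 for the toric surface, read off from the classification. -/
theorem sum_two_sub_cr_add_card (hF : IsSmoothFan B N) (h2 : ∀ u ∈ B, cr u (N (N u)) ≤ 2) :
    ∑ u ∈ B, (2 - cr u (N (N u))) + B.card = 12 := by
  obtain ⟨x, hx⟩ := hF.nonempty
  obtain ⟨hc, hl⟩ := hF.forall_cyclic h2 x hx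
  have hs : ∑ i ∈ Finset.range B.card, (2 - cr (N^[i] x) (N (N (N^[i] x)))) =
      (lens N x B.card).sum := by
    simp only [← Function.iterate_succ_apply']
    rfl
  rw [← sum_add_length_edgeLengths _ hl, hc.sum_eq hF, hs]
  simp [lens]

end IsSmoothFan

/-! ### The volume product of the reflexive polygons -/

/-- With X = z x and Y = z' y this is X Y (3 - X - Y) ≤ 1, which is AM-GM for three numbers of sum
3. The left side is affine in (x, y): it is the tangent plane of 1/(x y) at (1/z, 1/z'). -/
theorem mul_sub_le_one_div {x y z z' : ℝ} (hx : 0 < x) (hy : 0 < y) (hz : 0 ≤ z) (hz' : 0 ≤ z') :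
    z * z' * (3 - z * x - z' * y) ≤ 1 / (x * y) := by
  rw [le_div_iff₀ (mul_pos hx hy)]
  have hX : 0 ≤ z * x := by positivity
  have hY : 0 ≤ z' * y := by positivity
  have e : z * z' * (3 - z * x - z' * y) * (x * y) = (z * x) * (z' * y) * (3 - z * x - z' * y) := by
    ring
  rw [e]
  generalize z * x = X at *
  generalize z' * y = Y at *
  rcases le_or_gt (3 - X - Y) 0 with h | h
  · nlinarith [mul_nonneg hX hY]
  · have h1 : X * Y * (3 - X - Y) ≤ ((X + Y) ^ 2 / 4) * (3 - X - Y) :=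
      mul_le_mul_of_nonneg_right (by nlinarith [sq_nonneg (X - Y)]) h.le
    nlinarith [mul_nonneg (add_nonneg (add_nonneg hX hY) zero_le_one) (sq_nonneg (X + Y - 2))]

/-- In the applications `z` has n + 1 entries, so the default value 1 is never read there. -/
theorem sum_le_sum_one_div (r : ℕ → ℝ) (hr : ∀ i, 0 < r i) (n : ℕ) (z : List ℝ)
    (hz : ∀ a ∈ z, 0 ≤ a) :
    ∑ i ∈ Finset.range n, z.getD i 1 * z.getD (i + 1) 1 *
      (3 - z.getD i 1 * r i - z.getD (i + 1) 1 * r (i + 1)) ≤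
    ∑ i ∈ Finset.range n, 1 / (r i * r (i + 1)) := by
  have h : ∀ i, 0 ≤ z.getD i 1 := by
    intro i
    by_cases hi : i < z.length
    · rw [List.getD_eq_getElem _ _ hi]; exact hz _ (List.getElem_mem hi)
    · rw [List.getD_eq_default _ _ (not_lt.1 hi)]; exact zero_le_one
  exact Finset.sum_le_sum fun i _ => mul_sub_le_one_div (hr i) (hr _) (h i) (h _)

/-- The numbers `r i` are the values at consecutive rays of an affine function with value `1` at
the origin. -/
def IsAffineValues (l : List ℤ) (r : ℕ → ℝ) : Prop :=
  (∀ i, 0 < r i) ∧ (∀ i, r (i + l.length) = r i) ∧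
    ∀ i < l.length, r i + r (i + 2) = (2 - (l.getD i 0 : ℤ)) * r (i + 1) + (l.getD i 0 : ℤ)

set_option maxHeartbeats 1000000 in
/-- Mahler's inequality for the volume product of the reflexive polygons. -/
theorem le_sum_mul_sum_one_div {l : List ℤ} (hl : l ∈ edgeLengthReps) {r : ℕ → ℝ}
    (h : IsAffineValues l r) :
    27 ≤ (l.sum : ℝ) * ∑ i ∈ Finset.range l.length, 1 / (r i * r (i + 1)) := by
  obtain ⟨hr, hp, hs⟩ := h
  have p0 := hp 0
  have p1 := hp 1
  have k0 := hr 0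
  have k1 := hr 1
  have k2 := hr 2
  simp only [edgeLengthReps, List.mem_cons, List.not_mem_nil, or_false] at hl
  rcases hl with rfl | rfl | rfl | rfl | rfl | rfl | rfl | rfl | rfl | rfl | rfl | rfl | rfl |
    rfl | rfl | rfl | rfl | rfl | rfl | rfl
  -- In every case `z` lists the reciprocals of the values at the rays of one affine function equal
  -- to 1 at the origin, with the first entry repeated because r is periodic. The tangent bound is
  -- then affine in r, and the recurrences and the positivity of r reduce the claim to linear
  -- arithmetic.
  · have c := sum_le_sum_one_div r hr 3 [1, 1, 1, 1] (by
      intro a ha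
      fin_cases ha <;> norm_num)
    have s0 := hs 0 (by simp)
    have s1 := hs 1 (by simp)
    have s2 := hs 2 (by simp)
    simp [Finset.sum_range_succ] at c p0 p1 s0 s1 s2 ⊢
    linarith [hr 0, hr 1, hr 2]
  · have c := sum_le_sum_one_div r hr 4 [3/4, 3/4, 3/4, 3/2, 3/4] (by
      intro a ha
      fin_cases ha <;> norm_num)
    have s0 := hs 0 (by simp)
    have s1 := hs 1 (by simp)
    have s2 := hs 2 (by simp)
    have s3 := hs 3 (by simp)
    simp [Finset.sum_range_succ] at c p0 p1 s0 s1 s2 s3 ⊢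
    linarith [hr 0, hr 1, hr 2, hr 3]
  · have c := sum_le_sum_one_div r hr 4 [9/10, 9/11, 9/10, 9/7, 9/10] (by
      intro a ha
      fin_cases ha <;> norm_num)
    have s0 := hs 0 (by simp)
    have s1 := hs 1 (by simp)
    have s2 := hs 2 (by simp)
    have s3 := hs 3 (by simp)
    simp [Finset.sum_range_succ] at c p0 p1 s0 s1 s2 s3 ⊢
    linarith [hr 0, hr 1, hr 2, hr 3]
  · have c := sum_le_sum_one_div r hr 4 [1, 1, 1, 1, 1] (by
      intro a ha
      fin_cases ha <;> norm_num)
    have s0 := hs 0 (by simp)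
    have s1 := hs 1 (by simp)
    have s2 := hs 2 (by simp)
    have s3 := hs 3 (by simp)
    simp [Finset.sum_range_succ] at c p0 p1 s0 s1 s2 s3 ⊢
    linarith [hr 0, hr 1, hr 2, hr 3]
  · have c := sum_le_sum_one_div r hr 5 [13/14, 13/17, 13/20, 13/16, 13/9, 13/14] (by
      intro a ha
      fin_cases ha <;> norm_num)
    have s0 := hs 0 (by simp)
    have s1 := hs 1 (by simp)
    have s2 := hs 2 (by simp)
    have s3 := hs 3 (by simp)
    have s4 := hs 4 (by simp)
    simp [Finset.sum_range_succ] at c p0 p1 s0 s1 s2 s3 s4 ⊢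
    linarith [hr 0, hr 1, hr 2, hr 3, hr 4]
  · have c := sum_le_sum_one_div r hr 5 [13/20, 13/17, 13/14, 13/9, 13/16, 13/20] (by
      intro a ha
      fin_cases ha <;> norm_num)
    have s0 := hs 0 (by simp)
    have s1 := hs 1 (by simp)
    have s2 := hs 2 (by simp)
    have s3 := hs 3 (by simp)
    have s4 := hs 4 (by simp)
    simp [Finset.sum_range_succ] at c p0 p1 s0 s1 s2 s3 s4 ⊢
    linarith [hr 0, hr 1, hr 2, hr 3, hr 4]
  · have c := sum_le_sum_one_div r hr 5 [6/5, 6/7, 3/4, 6/7, 6/5, 6/5] (by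
      intro a ha
      fin_cases ha <;> norm_num)
    have s0 := hs 0 (by simp)
    have s1 := hs 1 (by simp)
    have s2 := hs 2 (by simp)
    have s3 := hs 3 (by simp)
    have s4 := hs 4 (by simp)
    simp [Finset.sum_range_succ] at c p0 p1 s0 s1 s2 s3 s4 ⊢
    linarith [hr 0, hr 1, hr 2, hr 3, hr 4]
  · have c := sum_le_sum_one_div r hr 6 [1, 3/4, 3/5, 1/2, 3/4, 3/2, 1] (by
      intro a ha
      fin_cases ha <;> norm_num)
    have s0 := hs 0 (by simp)
    have s1 := hs 1 (by simp)
    have s2 := hs 2 (by simp)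
    have s3 := hs 3 (by simp)
    have s4 := hs 4 (by simp)
    have s5 := hs 5 (by simp)
    simp [Finset.sum_range_succ] at c p0 p1 s0 s1 s2 s3 s4 s5 ⊢
    linarith [hr 0, hr 1, hr 2, hr 3, hr 4, hr 5]
  · have c := sum_le_sum_one_div r hr 6 [1/2, 3/5, 3/4, 1, 3/2, 3/4, 1/2] (by
      intro a ha
      fin_cases ha <;> norm_num)
    have s0 := hs 0 (by simp)
    have s1 := hs 1 (by simp)
    have s2 := hs 2 (by simp)
    have s3 := hs 3 (by simp)
    have s4 := hs 4 (by simp)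
    have s5 := hs 5 (by simp)
    simp [Finset.sum_range_succ] at c p0 p1 s0 s1 s2 s3 s4 s5 ⊢
    linarith [hr 0, hr 1, hr 2, hr 3, hr 4, hr 5]
  · have c := sum_le_sum_one_div r hr 6 [5/4, 5/6, 5/8, 5/7, 5/6, 5/4, 5/4] (by
      intro a ha
      fin_cases ha <;> norm_num)
    have s0 := hs 0 (by simp)
    have s1 := hs 1 (by simp)
    have s2 := hs 2 (by simp)
    have s3 := hs 3 (by simp)
    have s4 := hs 4 (by simp)
    have s5 := hs 5 (by simp)
    simp [Finset.sum_range_succ] at c p0 p1 s0 s1 s2 s3 s4 s5 ⊢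
    linarith [hr 0, hr 1, hr 2, hr 3, hr 4, hr 5]
  · have c := sum_le_sum_one_div r hr 6 [5/6, 5/7, 5/8, 5/6, 5/4, 5/4, 5/6] (by
      intro a ha
      fin_cases ha <;> norm_num)
    have s0 := hs 0 (by simp)
    have s1 := hs 1 (by simp)
    have s2 := hs 2 (by simp)
    have s3 := hs 3 (by simp)
    have s4 := hs 4 (by simp)
    have s5 := hs 5 (by simp)
    simp [Finset.sum_range_succ] at c p0 p1 s0 s1 s2 s3 s4 s5 ⊢
    linarith [hr 0, hr 1, hr 2, hr 3, hr 4, hr 5]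
  · have c := sum_le_sum_one_div r hr 6 [4/5, 4/5, 4/5, 1, 4/3, 1, 4/5] (by
      intro a ha
      fin_cases ha <;> norm_num)
    have s0 := hs 0 (by simp)
    have s1 := hs 1 (by simp)
    have s2 := hs 2 (by simp)
    have s3 := hs 3 (by simp)
    have s4 := hs 4 (by simp)
    have s5 := hs 5 (by simp)
    simp [Finset.sum_range_succ] at c p0 p1 s0 s1 s2 s3 s4 s5 ⊢
    linarith [hr 0, hr 1, hr 2, hr 3, hr 4, hr 5]
  · have c := sum_le_sum_one_div r hr 6 [1, 1, 1, 1, 1, 1, 1] (by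
      intro a ha
      fin_cases ha <;> norm_num)
    have s0 := hs 0 (by simp)
    have s1 := hs 1 (by simp)
    have s2 := hs 2 (by simp)
    have s3 := hs 3 (by simp)
    have s4 := hs 4 (by simp)
    have s5 := hs 5 (by simp)
    simp [Finset.sum_range_succ] at c p0 p1 s0 s1 s2 s3 s4 s5 ⊢
    linarith [hr 0, hr 1, hr 2, hr 3, hr 4, hr 5]
  · have c := sum_le_sum_one_div r hr 7 [5/6, 10/13, 5/7, 2/3, 10/11, 10/7, 10/9, 5/6] (by
      intro a ha
      fin_cases ha <;> norm_num)
    have s0 := hs 0 (by simp)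
    have s1 := hs 1 (by simp)
    have s2 := hs 2 (by simp)
    have s3 := hs 3 (by simp)
    have s4 := hs 4 (by simp)
    have s5 := hs 5 (by simp)
    have s6 := hs 6 (by simp)
    simp [Finset.sum_range_succ] at c p0 p1 s0 s1 s2 s3 s4 s5 s6 ⊢
    linarith [hr 0, hr 1, hr 2, hr 3, hr 4, hr 5, hr 6]
  · have c := sum_le_sum_one_div r hr 7 [2/3, 5/7, 10/13, 5/6, 10/9, 10/7, 10/11, 2/3] (by
      intro a ha
      fin_cases ha <;> norm_num)
    have s0 := hs 0 (by simp)
    have s1 := hs 1 (by simp)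
    have s2 := hs 2 (by simp)
    have s3 := hs 3 (by simp)
    have s4 := hs 4 (by simp)
    have s5 := hs 5 (by simp)
    have s6 := hs 6 (by simp)
    simp [Finset.sum_range_succ] at c p0 p1 s0 s1 s2 s3 s4 s5 s6 ⊢
    linarith [hr 0, hr 1, hr 2, hr 3, hr 4, hr 5, hr 6]
  · have c := sum_le_sum_one_div r hr 7 [1, 6/7, 3/4, 6/7, 1, 6/5, 6/5, 1] (by
      intro a ha
      fin_cases ha <;> norm_num)
    have s0 := hs 0 (by simp)
    have s1 := hs 1 (by simp)
    have s2 := hs 2 (by simp)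
    have s3 := hs 3 (by simp)
    have s4 := hs 4 (by simp)
    have s5 := hs 5 (by simp)
    have s6 := hs 6 (by simp)
    simp [Finset.sum_range_succ] at c p0 p1 s0 s1 s2 s3 s4 s5 s6 ⊢
    linarith [hr 0, hr 1, hr 2, hr 3, hr 4, hr 5, hr 6]
  · have c := sum_le_sum_one_div r hr 8 [3/4, 3/4, 3/4, 3/4, 3/4, 1, 3/2, 1, 3/4] (by
      intro a ha
      fin_cases ha <;> norm_num)
    have s0 := hs 0 (by simp)
    have s1 := hs 1 (by simp)
    have s2 := hs 2 (by simp)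
    have s3 := hs 3 (by simp)
    have s4 := hs 4 (by simp)
    have s5 := hs 5 (by simp)
    have s6 := hs 6 (by simp)
    have s7 := hs 7 (by simp)
    simp [Finset.sum_range_succ] at c p0 p1 s0 s1 s2 s3 s4 s5 s6 s7 ⊢
    linarith [hr 0, hr 1, hr 2, hr 3, hr 4, hr 5, hr 6, hr 7]
  · have c := sum_le_sum_one_div r hr 8 [7/8, 7/8, 7/8, 7/8, 1, 7/6, 7/6, 1, 7/8] (by
      intro a ha
      fin_cases ha <;> norm_num)
    have s0 := hs 0 (by simp)
    have s1 := hs 1 (by simp)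
    have s2 := hs 2 (by simp)
    have s3 := hs 3 (by simp)
    have s4 := hs 4 (by simp)
    have s5 := hs 5 (by simp)
    have s6 := hs 6 (by simp)
    have s7 := hs 7 (by simp)
    simp [Finset.sum_range_succ] at c p0 p1 s0 s1 s2 s3 s4 s5 s6 s7 ⊢
    linarith [hr 0, hr 1, hr 2, hr 3, hr 4, hr 5, hr 6, hr 7]
  · have c := sum_le_sum_one_div r hr 8 [1, 1, 1, 1, 1, 1, 1, 1, 1] (by
      intro a ha
      fin_cases ha <;> norm_num)
    have s0 := hs 0 (by simp)
    have s1 := hs 1 (by simp)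
    have s2 := hs 2 (by simp)
    have s3 := hs 3 (by simp)
    have s4 := hs 4 (by simp)
    have s5 := hs 5 (by simp)
    have s6 := hs 6 (by simp)
    have s7 := hs 7 (by simp)
    simp [Finset.sum_range_succ] at c p0 p1 s0 s1 s2 s3 s4 s5 s6 s7 ⊢
    linarith [hr 0, hr 1, hr 2, hr 3, hr 4, hr 5, hr 6, hr 7]
  · have c := sum_le_sum_one_div r hr 9 [1, 1, 1, 1, 1, 1, 1, 1, 1, 1] (by
      intro a ha
      fin_cases ha <;> norm_num)
    have s0 := hs 0 (by simp)
    have s1 := hs 1 (by simp)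
    have s2 := hs 2 (by simp)
    have s3 := hs 3 (by simp)
    have s4 := hs 4 (by simp)
    have s5 := hs 5 (by simp)
    have s6 := hs 6 (by simp)
    have s7 := hs 7 (by simp)
    have s8 := hs 8 (by simp)
    simp [Finset.sum_range_succ] at c p0 p1 s0 s1 s2 s3 s4 s5 s6 s7 s8 ⊢
    linarith [hr 0, hr 1, hr 2, hr 3, hr 4, hr 5, hr 6, hr 7, hr 8]

/-! ### The volume of the dual of a fan polygon -/

/-- The value at `u` of the affine function `1 + ⟨·, β⟩`. -/
noncomputable def rho (β : Fin 2 → ℝ) (u : Fin 2 → ℤ) : ℝ := 1 + (u 0 * β 0 + u 1 * β 1)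

/-- Twice the area of the polar of `P - β`, where `B` are the boundary lattice points of the dual
of `P`. -/
noncomputable def dualArea (B : Finset (Fin 2 → ℤ)) (N : (Fin 2 → ℤ) → (Fin 2 → ℤ))
    (β : Fin 2 → ℝ) : ℝ :=
  ∑ u ∈ B, 1 / (rho β u * rho β (N u))

namespace IsSmoothFan

variable {B : Finset (Fin 2 → ℤ)} {N : (Fin 2 → ℤ) → (Fin 2 → ℤ)}

theorem IsCyclic.lens_iterate {x : Fin 2 → ℤ} (hF : IsSmoothFan B N) (h : IsCyclic B N x) (i : ℕ) :
    IsCyclic B N (N^[i] x) ∧ lens N (N^[i] x) B.card = (lens N x B.card).rotate i := by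
  induction i with
  | zero => exact ⟨h, by simp⟩
  | succ i ih =>
    rw [Function.iterate_succ_apply']
    refine ⟨ih.1.next hF, ?_⟩
    obtain ⟨n, hn⟩ : ∃ n, B.card = n + 1 :=
      ⟨B.card - 1, by have := Finset.card_pos.2 hF.nonempty; omega⟩
    have hp := ih.1.2.1
    rw [hn] at ih hp ⊢
    rw [lens_next hp, ih.2, List.rotate_rotate]

theorem exists_cyclic_reps (hF : IsSmoothFan B N) (h2 : ∀ u ∈ B, cr u (N (N u)) ≤ 2) :
    ∃ x, IsCyclic B N x ∧ lens N x B.card ∈ edgeLengthReps := by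
  obtain ⟨x, hx⟩ := hF.nonempty
  obtain ⟨hc, hl⟩ := hF.forall_cyclic h2 x hx
  obtain ⟨l, hl1, hl2⟩ := List.mem_flatMap.1 hl
  obtain ⟨k, hk, e⟩ := List.mem_map.1 hl2
  have hk := List.mem_range.1 hk
  obtain ⟨h1, h3⟩ := hc.lens_iterate hF (l.length - k)
  refine ⟨_, h1, ?_⟩
  rw [h3, ← e, List.rotate_rotate, Nat.add_sub_cancel' hk.le, List.rotate_length]
  exact hl1

/-- The relation u + N (N u) = a N u makes the values of `rho` along the cycle satisfy
`IsAffineValues`, and the lengths add up to 12 - |B|. -/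
theorem le_dualArea (hF : IsSmoothFan B N) (h2 : ∀ u ∈ B, cr u (N (N u)) ≤ 2) {β : Fin 2 → ℝ}
    (hβ : ∀ u ∈ B, 0 < rho β u) : 27 ≤ (12 - (B.card : ℝ)) * dualArea B N β := by
  obtain ⟨x, hc, hl⟩ := hF.exists_cyclic_reps h2
  have hlen : (lens N x B.card).length = B.card := by simp [lens]
  have hx := hc.1
  have hr : IsAffineValues (lens N x B.card) fun i => rho β (N^[i] x) := by
    refine ⟨fun i => hβ _ (hF.iterate_mem hx i), fun i => ?_, fun i hi => ?_⟩
    · simp only [hlen]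
      rw [Function.iterate_add_apply, hc.2.1]
    · rw [hlen] at hi
      have hu := hF.iterate_mem hx i
      have e := add_eq_cr_smul (hF.cr_next _ hu) (hF.cr_next _ (hF.maps _ hu))
      have e0 : ((N^[i] x 0 + N (N (N^[i] x)) 0 : ℤ) : ℝ) = _ := congrArg _ (congrFun e 0)
      have e1 : ((N^[i] x 1 + N (N (N^[i] x)) 1 : ℤ) : ℝ) = _ := congrArg _ (congrFun e 1)
      simp only [Pi.smul_apply, smul_eq_mul, Int.cast_add, Int.cast_mul] at e0 e1
      have hg : (lens N x B.card).getD i 0 = 2 - cr (N^[i] x) (N (N (N^[i] x))) := by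
        rw [List.getD_eq_getElem _ _ (by rw [hlen]; exact hi)]
        simp [lens, ← Function.iterate_succ_apply' N]
      rw [hg]
      simp only [Function.iterate_succ_apply', rho, Int.cast_sub, Int.cast_ofNat]
      linear_combination β 0 * e0 + β 1 * e1
  have := le_sum_mul_sum_one_div hl hr
  have hs : ((lens N x B.card).sum : ℝ) = 12 - B.card := by
    have h12 := hF.sum_two_sub_cr_add_card h2
    rw [hc.sum_eq hF] at h12
    have hs : ∑ i ∈ Finset.range B.card, (2 - cr (N^[i] x) (N (N (N^[i] x)))) =
        (lens N x B.card).sum := by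
      simp only [← Function.iterate_succ_apply']
      rfl
    rw [hs] at h12
    rw [eq_sub_iff_add_eq]
    exact_mod_cast h12
  rw [hlen, hs] at this
  rw [dualArea, hc.sum_eq hF]
  simpa only [Function.iterate_succ_apply'] using this

end IsSmoothFan

/-! ### Dual pairs of reflexive polygons -/

/-- The dot product on the lattice. -/
def dt (u v : Fin 2 → ℤ) : ℤ := u 0 * v 0 + u 1 * v 1

theorem dt_comm (u v : Fin 2 → ℤ) : dt u v = dt v u := by unfold dt; ring

/-- Rotation by a quarter turn. -/
def rot (v : Fin 2 → ℤ) : Fin 2 → ℤ := ![-v 1, v 0]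

theorem dt_add_left (u v w : Fin 2 → ℤ) : dt (u + v) w = dt u w + dt v w := by
  simp only [dt, Pi.add_apply]; ring

theorem dt_sub_left (u v w : Fin 2 → ℤ) : dt (u - v) w = dt u w - dt v w := by
  simp only [dt, Pi.sub_apply]; ring

theorem dt_sub_right (u v w : Fin 2 → ℤ) : dt u (v - w) = dt u v - dt u w := by
  simp only [dt, Pi.sub_apply]; ring

theorem dt_smul_left (a : ℤ) (u w : Fin 2 → ℤ) : dt (a • u) w = a * dt u w := by
  simp only [dt, Pi.smul_apply, smul_eq_mul]; ring

theorem dt_rot_left (u v : Fin 2 → ℤ) : dt (rot u) v = cr u v := by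
  simp [dt, rot, cr]; ring

theorem cr_rot_right (u v : Fin 2 → ℤ) : cr u (rot v) = dt u v := by
  simp [dt, rot, cr]

theorem cr_sub_left (u v w : Fin 2 → ℤ) : cr (u - v) w = cr u w - cr v w := by
  simp only [cr, Pi.sub_apply]; ring

theorem eq_neg_cr_smul_rot {q y p : Fin 2 → ℤ} (h : dt q p = -1) (hy : dt y p = 0) :
    y = -(cr q y) • rot p := by
  unfold dt at h hy
  apply vec_ext <;> simp [rot, cr]
  · linear_combination y 0 * h - q 0 * hy
  · linear_combination y 1 * h - q 1 * hy

/-- `A` and `B` are the sets of nonzero lattice points of two dual reflexive polygons. -/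
structure IsDualPair (A B : Finset (Fin 2 → ℤ)) : Prop where
  mem_left : ∀ v, v ∈ A ↔ v ≠ 0 ∧ ∀ u ∈ B, -1 ≤ dt u v
  mem_right : ∀ u, u ∈ B ↔ u ≠ 0 ∧ ∀ v ∈ A, -1 ≤ dt u v
  flag_left : ∀ x, x ≠ 0 → ∃ p ∈ A, ∃ q ∈ B, ∃ q' ∈ B, (∀ v ∈ A, dt x p ≤ dt x v) ∧ dt x p < 0 ∧
    dt q p = -1 ∧ dt q' p = -1 ∧ 0 < cr x q ∧ cr x q' ≤ 0
  flag_right : ∀ x, x ≠ 0 → ∃ p ∈ B, ∃ q ∈ A, ∃ q' ∈ A, (∀ v ∈ B, dt x p ≤ dt x v) ∧ dt x p < 0 ∧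
    dt q p = -1 ∧ dt q' p = -1 ∧ 0 < cr x q ∧ cr x q' ≤ 0

namespace IsDualPair

variable {A B : Finset (Fin 2 → ℤ)}

theorem symm (h : IsDualPair A B) : IsDualPair B A :=
  ⟨fun v => by simp only [h.mem_right, dt_comm], fun v => by simp only [h.mem_left, dt_comm],
    h.flag_right, h.flag_left⟩

theorem neg_one_le (h : IsDualPair A B) {u v : Fin 2 → ℤ} (hu : u ∈ B) (hv : v ∈ A) :
    -1 ≤ dt u v := ((h.mem_right u).1 hu).2 v hv

/-- The lattice points of an edge. -/
theorem sub_smul_rot_mem (h : IsDualPair A B) {p q q' : Fin 2 → ℤ} (hq : q ∈ B)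
    (hq' : q' ∈ B) (hqp : dt q p = -1) (hqp' : dt q' p = -1) {i : ℤ} (hi : 0 ≤ i)
    (hi' : i ≤ cr q' q) : q' - i • rot p ∈ B := by
  have e : q - q' = -(cr q' q) • rot p := by
    have := eq_neg_cr_smul_rot (y := q - q') hqp' (by rw [dt_sub_left, hqp, hqp']; ring)
    rwa [cr_sub_right, cr_self, sub_zero] at this
  rw [h.mem_right]
  constructor
  · intro h0
    have := congrArg (fun x => dt x p) h0
    simp only [dt_sub_left, dt_smul_left, dt_rot_left, cr_self, hqp'] at this
    simp [dt] at this
  · intro v hv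
    rcases hi.eq_or_lt with rfl | hi0
    · simpa using h.neg_one_le hq' hv
    · have h1 := h.neg_one_le hq hv
      have h2 := h.neg_one_le hq' hv
      have h3 := congrArg (fun x => dt x v) e
      simp only [dt_sub_left, dt_smul_left, dt_rot_left] at h3 ⊢
      by_contra! hlt
      have h4 : cr q' q * (dt q' v - i * cr p v + 1) =
          (cr q' q - i) * (dt q' v + 1) + i * (dt q v + 1) := by
        linear_combination (-i) * h3
      nlinarith [mul_nonneg (sub_nonneg.2 hi') (by linarith : 0 ≤ dt q' v + 1),
        mul_nonneg hi (by linarith : 0 ≤ dt q v + 1)]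

/-- The flag of x consists of a point p of A minimal on x and points q, q' of B on the edge dual to
p, on either side of x. This edge has lattice height 1, so it is cut by lattice points into segments
that span unimodular cones; one of them contains x. -/
theorem exists_cone (h : IsDualPair A B) {x : Fin 2 → ℤ} (hx : x ≠ 0) :
    ∃ u ∈ B, ∃ p ∈ A, dt u p = -1 ∧ u - rot p ∈ B ∧
      ∃ b c : ℤ, 0 < b ∧ 0 ≤ c ∧ x = b • u + c • (u - rot p) := by
  obtain ⟨p, hp, q, hq, q', hq', -, hneg, hqp, hqp', hxq, hxq'⟩ := h.flag_left x hx
  set k := -dt x p with hk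
  have hk0 : 0 < k := by omega
  have e := eq_neg_cr_smul_rot (y := x - k • q') hqp'
    (by rw [dt_sub_left, dt_smul_left, hqp', hk]; ring)
  rw [cr_sub_right, cr_smul_right, cr_self, mul_zero, sub_zero] at e
  set c := cr q' x with hc
  have hc0 : 0 ≤ c := by rw [hc, cr_swap]; omega
  have ex : x = k • q' - c • rot p := by
    rw [sub_eq_iff_eq_add] at e; rw [e]; module
  have e2 := eq_neg_cr_smul_rot (y := q - q') hqp' (by rw [dt_sub_left, hqp, hqp']; ring)
  rw [cr_sub_right, cr_self, sub_zero] at e2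
  have hd : cr x q = k * cr q' q - c := by
    have e3 : q = q' - cr q' q • rot p := by
      rw [sub_eq_iff_eq_add] at e2; nth_rewrite 1 [e2]; module
    rw [ex]
    nth_rewrite 1 [e3]
    simp only [cr_sub_left, cr_sub_right, cr_smul_left, cr_smul_right, cr_rot_right, cr_self,
      cr_swap (rot p), hqp']
    rw [dt_sub_left, dt_smul_left, hqp', dt_smul_left, dt_rot_left, cr_self]
    ring
  -- At height k, x has position c along the edge. Division with remainder selects the unit segment
  -- number c / k, and c % k is the coefficient of its second end point.
  have hj0 : 0 ≤ c / k := Int.ediv_nonneg hc0 hk0.le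
  have hr0 := Int.emod_nonneg c hk0.ne'
  have hrk := Int.emod_lt_of_pos c hk0
  have hck := Int.emod_add_mul_ediv c k
  have hjd : c / k + 1 ≤ cr q' q := by
    by_contra! hlt
    have : cr q' q ≤ c / k := by omega
    nlinarith
  refine ⟨q' - (c / k) • rot p, h.sub_smul_rot_mem hq hq' hqp hqp' hj0 (by omega), p, hp, ?_, ?_,
    k - c % k, c % k, by omega, hr0, ?_⟩
  · rw [dt_sub_left, dt_smul_left, dt_rot_left, cr_self, hqp']; ring
  · have := h.sub_smul_rot_mem hq hq' hqp hqp' (by omega : 0 ≤ c / k + 1) hjd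
    rwa [add_smul, one_smul, ← sub_sub] at this
  · nth_rewrite 1 [ex]
    nth_rewrite 1 [← hck]
    module

/-- Apply `exists_cone` to u itself. Its height b + c is at most 1, so u is the first ray of the
cone. -/
theorem exists_facet (h : IsDualPair A B) {u : Fin 2 → ℤ} (hu : u ∈ B) :
    ∃ p ∈ A, dt u p = -1 ∧ u - rot p ∈ B := by
  obtain ⟨v, hv, p, hp, hvp, hvp', b, c, hb, hc, e⟩ := h.exists_cone ((h.mem_right u).1 hu).1
  have h1 := h.neg_one_le hu hp
  rw [e] at h1
  simp only [dt_add_left, dt_smul_left, dt_sub_left, dt_rot_left, cr_self, hvp] at h1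
  have hb1 : b = 1 := by linarith
  have hc0 : c = 0 := by linarith
  rw [hb1, hc0, one_smul, zero_smul, add_zero] at e
  exact ⟨p, hp, e ▸ hvp, e ▸ hvp'⟩

open Classical in
/-- The vertex of the first polygon dual to the edge of the second one that starts at `u`. -/
noncomputable def facet (A B : Finset (Fin 2 → ℤ)) (u : Fin 2 → ℤ) : Fin 2 → ℤ :=
  if h : ∃ p ∈ A, dt u p = -1 ∧ u - rot p ∈ B then h.choose else 0

/-- The boundary lattice point of the second polygon that follows `u`. -/
noncomputable def next (A B : Finset (Fin 2 → ℤ)) (u : Fin 2 → ℤ) : Fin 2 → ℤ :=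
  u - rot (facet A B u)

theorem facet_spec (h : IsDualPair A B) {u : Fin 2 → ℤ} (hu : u ∈ B) :
    facet A B u ∈ A ∧ dt u (facet A B u) = -1 ∧ next A B u ∈ B := by
  have := h.exists_facet hu
  unfold next facet
  rw [dif_pos this]
  exact this.choose_spec

theorem eq_of_cr_eq_zero {u p p' : Fin 2 → ℤ} (h1 : dt u p = -1) (h2 : dt u p' = -1)
    (h3 : cr p p' = 0) : p = p' := by
  have e := eq_neg_cr_smul_rot (q := p) (y := p' - p) (p := u) (by rw [dt_comm, h1])
    (by rw [dt_comm, dt_sub_right, h1, h2]; ring)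
  rw [cr_sub_right, cr_self, h3] at e
  simpa [sub_eq_zero, eq_comm] using e

/-- Each of the two successors satisfies the inequality of the other facet, which gives `cr p p'`
both signs. -/
theorem facet_unique (h : IsDualPair A B) {u p p' : Fin 2 → ℤ} (hp : p ∈ A) (hp' : p' ∈ A)
    (h1 : dt u p = -1) (h2 : u - rot p ∈ B) (h1' : dt u p' = -1) (h2' : u - rot p' ∈ B) :
    p = p' := by
  have c1 := h.neg_one_le h2 hp'
  have c2 := h.neg_one_le h2' hp
  rw [dt_sub_left, dt_rot_left] at c1 c2
  rw [cr_swap] at c2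
  exact eq_of_cr_eq_zero h1 h1' (by omega)

theorem dt_next_facet (h : IsDualPair A B) {u : Fin 2 → ℤ} (hu : u ∈ B) :
    dt (next A B u) (facet A B u) = -1 := by
  rw [next, dt_sub_left, dt_rot_left, cr_self, (h.facet_spec hu).2.1]; ring

/-- Existence of cones is `exists_cone`. Uniqueness uses that each point of A bounds the height b +
c of a vector from below, with equality exactly for the facets over which the vector lies. -/
theorem isSmoothFan (h : IsDualPair A B) : IsSmoothFan B (next A B) := by
  refine ⟨fun u hu => (h.facet_spec hu).2.2, fun u hu v hv e => ?_, fun u hu => ?_,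
    fun x hx => ?_, ?_⟩
  · obtain ⟨a1, a2, a3⟩ := h.facet_spec hu
    obtain ⟨b1, b2, b3⟩ := h.facet_spec hv
    have d1 := h.dt_next_facet hu
    have d2 := h.dt_next_facet hv
    rw [← e] at d2
    have c1 := h.neg_one_le hu b1
    have c2 := h.neg_one_le hv a1
    have eu : u = next A B u + rot (facet A B u) := by simp [next]
    have ev : v = next A B u + rot (facet A B v) := by rw [e]; simp [next]
    rw [eu, dt_add_left, dt_rot_left, d2] at c1
    rw [ev, dt_add_left, dt_rot_left, d1, cr_swap] at c2
    have : facet A B u = facet A B v := by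
      refine eq_of_cr_eq_zero d1 d2 ?_
      omega
    rw [eu, ev, this]
  · rw [next, cr_sub_right, cr_self, cr_rot_right, (h.facet_spec hu).2.1]; ring
  · obtain ⟨u, hu, p, hp, hup, hup', b, c, hb, hc, e⟩ := h.exists_cone hx
    obtain ⟨a1, a2, a3⟩ := h.facet_spec hu
    refine ⟨u, hu, b, c, hb, hc, ?_⟩
    rw [next, ← h.facet_unique hp a1 hup hup' a2 a3]
    exact e
  · intro u hu v hv b c b' c' hb hc hb' hc' e
    obtain ⟨a1, a2, a3⟩ := h.facet_spec hu
    obtain ⟨b1, b2, b3⟩ := h.facet_spec hv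
    have d1 := h.dt_next_facet hu
    have d2 := h.dt_next_facet hv
    have c1 := h.neg_one_le hu b1
    have c2 := h.neg_one_le hv a1
    have c3 := h.neg_one_le a3 b1
    have c4 := h.neg_one_le b3 a1
    set p := facet A B u with hp
    set p' := facet A B v with hp'
    have e1 := congrArg (fun x => dt x p) e
    have e2 := congrArg (fun x => dt x p') e
    simp only [dt_add_left, dt_smul_left] at e1 e2
    rw [a2, d1] at e1
    rw [b2, d2] at e2
    have m1 := mul_le_mul_of_nonneg_left c1 hb.le
    have m2 := mul_le_mul_of_nonneg_left c2 hb'.le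
    have m3 := mul_le_mul_of_nonneg_left c3 hc
    have m4 := mul_le_mul_of_nonneg_left c4 hc'
    have hk : b + c = b' + c' := by linarith
    have f1 : dt u p' = -1 := by
      have : b * (dt u p' + 1) = 0 := by linarith
      rcases mul_eq_zero.1 this with h | h <;> omega
    have f2 : dt v p = -1 := by
      have : b' * (dt v p + 1) = 0 := by linarith
      rcases mul_eq_zero.1 this with h | h <;> omega
    -- On a common facet the positions along the edge are compared, with remainders c and c' below
    -- the common height. On different facets both vectors must lie on the shared ray, so c = c' =
    -- 0.
    by_cases hpp : p = p'
    · have j1 := congrArg (fun x => cr u x) e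
      simp only [next, ← hp, ← hp', ← hpp, cr_add_right, cr_smul_right, cr_sub_right, cr_self,
        cr_rot_right, a2] at j1
      have j2 : c = (b + c) * cr u v + c' := by rw [hk]; linarith
      have j3 : cr u v = 0 := by
        by_contra hne
        rcases lt_or_gt_of_ne hne with h | h <;> nlinarith
      exact eq_of_cr_eq_zero (by rw [dt_comm, a2]) (by rw [dt_comm, f2]) j3
    · have hc0 : c = 0 := by
        by_contra hne
        have : c * (dt (next A B u) p' + 1) = 0 := by linarith
        have := (mul_eq_zero.1 this).resolve_left hne
        rw [next, dt_sub_left, dt_rot_left, ← hp, f1] at this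
        exact hpp (eq_of_cr_eq_zero a2 f1 (by linarith))
      have hc0' : c' = 0 := by
        by_contra hne
        have : c' * (dt (next A B v) p + 1) = 0 := by linarith
        have := (mul_eq_zero.1 this).resolve_left hne
        rw [next, dt_sub_left, dt_rot_left, ← hp', f2] at this
        exact hpp (eq_of_cr_eq_zero b2 f2 (by linarith)).symm
      have hbb : b = b' := by omega
      rw [hc0, hc0', hbb, zero_smul, zero_smul, add_zero, add_zero] at e
      exact smul_right_injective _ hb'.ne' e

/-- Evaluate u + N (N u) = a N u on the facet p of u: it gives ⟨N (N u), p⟩ = 1 - a, which is at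
least -1. -/
theorem cr_next_next_le (h : IsDualPair A B) :
    ∀ u ∈ B, cr u (next A B (next A B u)) ≤ 2 := by
  intro u hu
  have hF := h.isSmoothFan
  obtain ⟨a1, a2, a3⟩ := h.facet_spec hu
  have e := congrArg (fun x => dt x (facet A B u))
    (add_eq_cr_smul (hF.cr_next u hu) (hF.cr_next _ a3))
  simp only [dt_add_left, dt_smul_left, a2, h.dt_next_facet hu] at e
  have := h.neg_one_le (hF.maps _ a3) a1
  linarith

theorem dt_cone_le (h : IsDualPair A B) {u v : Fin 2 → ℤ} (hu : u ∈ B) (hv : v ∈ A) {b c : ℤ}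
    (hb : 0 < b) (hc : 0 ≤ c) : -(b + c) ≤ dt (b • u + c • next A B u) v := by
  have h1 := h.neg_one_le hu hv
  have h2 := h.neg_one_le (h.isSmoothFan.maps u hu) hv
  rw [dt_add_left, dt_smul_left, dt_smul_left]
  nlinarith

/-- Count A edge by edge. The points p with `facet B A p = w` are those of the half-open edge from
p0 to p1 dual to w = N u, and its lattice length `cr p0 p1` equals 2 - a. -/
theorem card_left (h : IsDualPair A B) :
    (A.card : ℤ) = ∑ u ∈ B, (2 - cr u (next A B (next A B u))) := by
  have hF := h.isSmoothFan
  rw [Finset.card_eq_sum_card_fiberwise (f := facet B A) (t := B)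
    (fun p hp => (h.symm.facet_spec hp).1), ← hF.sum_next, Nat.cast_sum]
  refine Finset.sum_congr rfl fun u hu => ?_
  set w := next A B u with hw
  have hwB : w ∈ B := hF.maps u hu
  obtain ⟨a1, a2, a3⟩ := h.facet_spec hu
  obtain ⟨b1, b2, b3⟩ := h.facet_spec hwB
  have d1 := h.dt_next_facet hu
  have eu : u = w + rot (facet A B u) := by simp [hw, next]
  have ew : next A B w = w - rot (facet A B w) := rfl
  rw [← hw] at d1
  set p0 := facet A B u with hp0
  set p1 := facet A B w with hp1
  have key : cr u (next A B w) = 2 - cr p0 p1 := by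
    rw [eu, ew]
    simp only [cr_add_left, cr_sub_right, cr_self, cr_rot_right, cr_swap (rot p0) w, d1, b2,
      dt_add_left, dt_rot_left]
    ring
  have hfib : A.filter (fun p => facet B A p = w) =
      (Finset.Ico 0 (cr p0 p1)).image (fun i : ℤ => p0 - i • rot w) := by
    ext p
    simp only [Finset.mem_filter, Finset.mem_image, Finset.mem_Ico]
    constructor
    · rintro ⟨hp, hpw⟩
      obtain ⟨c1, c2, c3⟩ := h.symm.facet_spec hp
      rw [next, hpw] at c3
      rw [hpw, dt_comm] at c2
      have e := eq_neg_cr_smul_rot (q := p0) (y := p - p0) (p := w) (by rw [dt_comm, d1])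
        (by rw [dt_comm, dt_sub_right, c2, d1]; ring)
      rw [cr_sub_right, cr_self, sub_zero] at e
      refine ⟨cr p0 p, ⟨?_, ?_⟩, ?_⟩
      · have := h.neg_one_le hu hp
        rw [eu, dt_add_left, dt_rot_left, c2] at this
        omega
      · have := h.neg_one_le (hF.maps _ hwB) c3
        rw [ew, dt_sub_right, dt_sub_left, dt_sub_left, dt_rot_left, dt_rot_left, c2,
          cr_rot_right, dt_comm p1, b2, dt_comm w, dt_rot_left, cr_self] at this
        have e4 := congrArg (fun x => cr p1 x) e
        simp only [cr_sub_right, cr_smul_right, cr_rot_right, dt_comm p1, b2] at e4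
        rw [cr_swap p1 p0] at e4
        linarith
      · rw [sub_eq_iff_eq_add] at e; nth_rewrite 2 [e]; module
    · rintro ⟨i, ⟨hi, hi'⟩, rfl⟩
      have m1 := h.symm.sub_smul_rot_mem (p := w) (q := p1) (q' := p0) b1 a1 (by rw [dt_comm, b2])
        (by rw [dt_comm, d1]) hi hi'.le
      have m2 := h.symm.sub_smul_rot_mem (p := w) (q := p1) (q' := p0) b1 a1 (by rw [dt_comm, b2])
        (by rw [dt_comm, d1]) (by omega : 0 ≤ i + 1) (by omega)
      refine ⟨m1, ?_⟩
      obtain ⟨c1, c2, c3⟩ := h.symm.facet_spec m1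
      refine h.symm.facet_unique c1 hwB c2 c3 ?_ ?_
      · rw [dt_sub_left, dt_smul_left, dt_rot_left, cr_self, dt_comm, d1]; ring
      · rwa [add_smul, one_smul, ← sub_sub] at m2
  rw [hfib, Finset.card_image_of_injective, Int.card_Ico, key]
  · have : 0 ≤ cr p0 p1 := by
      have := h.neg_one_le hu b1
      rw [eu, dt_add_left, dt_rot_left, b2] at this
      omega
    omega
  · intro i j e
    have := congrArg (fun x => cr p0 x) e
    simp only [cr_sub_right, cr_smul_right, cr_rot_right, dt_comm p0, d1] at this
    omega

theorem card_add_card (h : IsDualPair A B) : B.card + A.card = 12 := by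
  have h1 := h.isSmoothFan.sum_two_sub_cr_add_card h.cr_next_next_le
  rw [← h.card_left] at h1
  omega

end IsDualPair

/-! ### From polygons to dual pairs -/

/-- The value of the lattice vector `s` on a real vector. -/
noncomputable def pair (s : Fin 2 → ℤ) (x : Fin 2 → ℝ) : ℝ := s 0 * x 0 + s 1 * x 1

theorem rho_eq (β : Fin 2 → ℝ) (u : Fin 2 → ℤ) : rho β u = 1 + pair u β := rfl

theorem pair_latticeToReal (s v : Fin 2 → ℤ) : pair s (latticeToReal v) = dt s v := by
  simp [pair, latticeToReal, dt]

theorem le_of_mem_convexHull {S : Finset (Fin 2 → ℤ)} {a b c : ℝ}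
    (h : ∀ s ∈ S, c ≤ a * s 0 + b * s 1) {x : Fin 2 → ℝ}
    (hx : x ∈ convexHull ℝ (latticeToReal '' (S : Set (Fin 2 → ℤ)))) : c ≤ a * x 0 + b * x 1 := by
  have hconv : Convex ℝ {x : Fin 2 → ℝ | c ≤ a * x 0 + b * x 1} := by
    refine convex_halfSpace_ge (f := fun x : Fin 2 → ℝ => a * x 0 + b * x 1) ⟨?_, ?_⟩ c
    · intro x y; simp; ring
    · intro t x; simp; ring
  refine convexHull_min ?_ hconv hx
  rintro _ ⟨s, hs, rfl⟩
  exact h s hs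

/-- Take p in A minimal for x, with ties broken by `cr x`. If the points of B tight at p all lay on
one side of x, a point of one polygon could be separated from the lattice points spanning it, on
either the primal or the dual side. -/
theorem isDualPair_flag {SA SB A B : Finset (Fin 2 → ℤ)}
    (hPA : ∀ x : Fin 2 → ℝ, (∀ s ∈ SB, -1 ≤ pair s x) →
      x ∈ convexHull ℝ (latticeToReal '' (SA : Set (Fin 2 → ℤ))))
    (hPB : ∀ x : Fin 2 → ℝ, (∀ s ∈ SA, -1 ≤ pair s x) →
      x ∈ convexHull ℝ (latticeToReal '' (SB : Set (Fin 2 → ℤ))))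
    (hSA : ∀ s ∈ SA, s = 0 ∨ s ∈ A) (hSB : ∀ s ∈ SB, s = 0 ∨ s ∈ B)
    (hAB : ∀ u ∈ B, ∀ v ∈ A, -1 ≤ dt u v) {x : Fin 2 → ℤ} (hx : x ≠ 0)
    (hneg : ∃ p ∈ A, dt x p < 0) :
    ∃ p ∈ A, ∃ q ∈ B, ∃ q' ∈ B, (∀ v ∈ A, dt x p ≤ dt x v) ∧ dt x p < 0 ∧
      dt q p = -1 ∧ dt q' p = -1 ∧ 0 < cr x q ∧ cr x q' ≤ 0 := by
  obtain ⟨p0, hp0, hlt⟩ := hneg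
  obtain ⟨p1, hp1, hmin1⟩ := A.exists_min_image (dt x) ⟨p0, hp0⟩
  obtain ⟨p, hpE, hmin2⟩ := (A.filter (fun p => dt x p = dt x p1)).exists_min_image (cr x)
    ⟨p1, by simp [hp1]⟩
  obtain ⟨hp, hpp1⟩ := Finset.mem_filter.1 hpE
  have hmin : ∀ v ∈ A, dt x p ≤ dt x v := fun v hv => hpp1 ▸ hmin1 v hv
  have hxp : dt x p < 0 := (hmin p0 hp0).trans_lt hlt
  have hmin2' : ∀ v ∈ A, dt x v = dt x p → cr x p ≤ cr x v := fun v hv h =>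
    hmin2 v (Finset.mem_filter.2 ⟨hv, h.trans hpp1⟩)
  have hq : ∃ q ∈ B, dt q p = -1 ∧ 0 < cr x q := by
    by_contra! hc
    obtain ⟨K, hK1, hK⟩ : ∃ K : ℤ, 1 ≤ K ∧ ∀ s ∈ SB, cr x s ≤ K := by
      refine ⟨1 + ∑ s ∈ SB, |cr x s|, ?_, fun s hs => ?_⟩
      · have := Finset.sum_nonneg (s := SB) (fun s _ => abs_nonneg (cr x s))
        omega
      · have := Finset.single_le_sum (f := fun s => |cr x s|) (fun s _ => abs_nonneg (cr x s)) hs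
        have := le_abs_self (cr x s)
        omega
    obtain ⟨C, hC0, hC⟩ : ∃ C : ℤ, cr x p ≤ C ∧ ∀ s ∈ A, cr x p - cr x s ≤ C := by
      refine ⟨|cr x p| + ∑ s ∈ A, |cr x p - cr x s|, ?_, fun s hs => ?_⟩
      · have := Finset.sum_nonneg (s := A) (fun s _ => abs_nonneg (cr x p - cr x s))
        have := le_abs_self (cr x p)
        omega
      · have := Finset.single_le_sum (f := fun s => |cr x p - cr x s|)
          (fun s _ => abs_nonneg _) hs
        have := le_abs_self (cr x p - cr x s)
        have := abs_nonneg (cr x p)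
        omega
    have hKr : (1 : ℝ) ≤ K := by exact_mod_cast hK1
    -- Moving p by ε (x 1, -x 0) keeps all constraints: the tight ones by assumption, the others
    -- because they have slack at least 1 by integrality and change by at most ε K = 1.
    set ε : ℝ := 1 / K with hε
    have hε0 : 0 < ε := by positivity
    have hv' := hPA ![p 0 + ε * x 1, p 1 - ε * x 0] (by
      intro s hs
      have hval : pair s ![p 0 + ε * x 1, p 1 - ε * x 0] = (dt s p : ℤ) - ε * (cr x s : ℤ) := by
        simp [pair, dt, cr]; ring
      rw [hval]
      rcases hSB s hs with rfl | hsB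
      · simp [dt, cr]
      · have h1 := hAB s hsB p hp
        rcases h1.eq_or_lt with h2 | h2
        · have h3 := hc s hsB h2.symm
          have h4 : ((cr x s : ℤ) : ℝ) ≤ 0 := by exact_mod_cast h3
          rw [← h2]
          push_cast
          nlinarith
        · have h3 : (0 : ℝ) ≤ (dt s p : ℤ) := by exact_mod_cast (by omega : 0 ≤ dt s p)
          have h4 : ((cr x s : ℤ) : ℝ) ≤ K := by exact_mod_cast hK s hs
          have h5 : ε * (cr x s : ℤ) ≤ 1 := by
            rw [hε, one_div, inv_mul_le_iff₀ (by linarith)]; linarith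
          linarith)
    -- For this C the functional C ⟨x, ·⟩ + `cr x` attains its minimum over the spanning points at
    -- p, while the moved point lowers it by ε |x|².
    have hlow := le_of_mem_convexHull (a := C * x 0 - x 1) (b := C * x 1 + x 0)
      (c := C * (dt x p : ℤ) + (cr x p : ℤ)) (by
      intro s hs
      have hval : (C * x 0 - x 1 : ℝ) * s 0 + (C * x 1 + x 0) * s 1 =
          ((C * dt x s + cr x s : ℤ) : ℝ) := by
        simp only [dt, cr]; push_cast; ring
      rw [hval]
      have : C * dt x p + cr x p ≤ C * dt x s + cr x s := by
        have hC0' : 0 ≤ C := by have := hC p hp; omega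
        rcases hSA s hs with rfl | hsA
        · have e1 : dt x 0 = 0 := by simp [dt]
          have e2 : cr x 0 = 0 := by simp [cr]
          rw [e1, e2]; nlinarith
        · rcases (hmin s hsA).eq_or_lt with h | h
          · have := hmin2' s hsA h.symm
            rw [h]; omega
          · have := hC s hsA
            nlinarith
      exact_mod_cast this) hv'
    have hsq : 0 < (x 0 : ℝ) ^ 2 + (x 1 : ℝ) ^ 2 := by
      have : x 0 ≠ 0 ∨ x 1 ≠ 0 := by
        by_contra! h; exact hx (vec_ext h.1 h.2)
      rcases this with h | h
      · have : (x 0 : ℝ) ≠ 0 := by exact_mod_cast h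
        positivity
      · have : (x 1 : ℝ) ≠ 0 := by exact_mod_cast h
        positivity
    simp [dt, cr] at hlow
    nlinarith [mul_pos hε0 hsq]
  have hq' : ∃ q ∈ B, dt q p = -1 ∧ cr x q ≤ 0 := by
    by_contra! hc
    obtain ⟨C, hC⟩ : ∃ C : ℤ, 1 ≤ C ∧ ∀ s ∈ SB, 1 - cr x s ≤ C := by
      refine ⟨1 + ∑ s ∈ SB, |cr x s|, ?_, fun s hs => ?_⟩
      · have := Finset.sum_nonneg (s := SB) (fun s _ => abs_nonneg (cr x s))
        omega
      · have := Finset.single_le_sum (f := fun s => |cr x s|) (fun s _ => abs_nonneg (cr x s)) hs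
        have := neg_abs_le (cr x s)
        omega
    have hk : (0 : ℝ) < -(dt x p : ℤ) := by
      have : ((dt x p : ℤ) : ℝ) < 0 := by exact_mod_cast hxp
      linarith
    set k : ℝ := -(dt x p : ℤ) with hkdef
    have hy := hPB ![x 0 / k, x 1 / k] (by
      intro s hs
      have hval : pair s ![x 0 / k, x 1 / k] = (dt x s : ℤ) / k := by
        simp [pair, dt]; ring
      rw [hval, le_div_iff₀ hk]
      have : dt x p ≤ dt x s := by
        rcases hSA s hs with rfl | hsA
        · have e1 : dt x 0 = 0 := by simp [dt]
          rw [e1]; exact hxp.le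
        · exact hmin s hsA
      have : ((dt x p : ℤ) : ℝ) ≤ (dt x s : ℤ) := by exact_mod_cast this
      linarith)
    -- The functional C ⟨·, p⟩ + `cr x` is at least 1 - C on the spanning points of the dual, but
    -- equals -C at x / k.
    have hlow := le_of_mem_convexHull (a := C * p 0 - x 1) (b := C * p 1 + x 0)
      (c := 1 - C) (by
      intro s hs
      have hval : (C * p 0 - x 1 : ℝ) * s 0 + (C * p 1 + x 0) * s 1 =
          ((C * dt s p + cr x s : ℤ) : ℝ) := by
        simp only [dt, cr]; push_cast; ring
      rw [hval]
      have : 1 - C ≤ C * dt s p + cr x s := by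
        rcases hSB s hs with rfl | hsB
        · have e1 : dt 0 p = 0 := by simp [dt]
          have e2 : cr x 0 = 0 := by simp [cr]
          rw [e1, e2]; omega
        · rcases (hAB s hsB p hp).eq_or_lt with h | h
          · have := hc s hsB h.symm
            rw [← h]; omega
          · have := hC.2 s hs
            nlinarith
      exact_mod_cast this) hy
    have e : (C * p 0 - x 1 : ℝ) * (![x 0 / k, x 1 / k] : Fin 2 → ℝ) 0 +
        (C * p 1 + x 0) * (![x 0 / k, x 1 / k] : Fin 2 → ℝ) 1 = -C := by
      have : k = -(x 0 * p 0 + x 1 * p 1) := by rw [hkdef]; simp [dt]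
      simp
      field_simp
      rw [this]; ring
    rw [e] at hlow
    linarith
  obtain ⟨q, hq1, hq2, hq3⟩ := hq
  obtain ⟨q', hq1', hq2', hq3'⟩ := hq'
  exact ⟨p, hp, q, hq1, q', hq1', hmin, hxp, hq2, hq2', hq3, hq3'⟩

/-! ### Polarity and lattice points of a reflexive polygon. -/

theorem dotProduct_fin_two (u v : Fin 2 → ℝ) : u ⬝ᵥ v = u 0 * v 0 + u 1 * v 1 := by
  simp [dotProduct, Fin.sum_univ_two]

theorem exists_lt_of_not_mem {P : Set (Fin 2 → ℝ)} (hc : Convex ℝ P) (hcl : IsClosed P)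
    (h0 : (0 : Fin 2 → ℝ) ∈ P) {v : Fin 2 → ℝ} (hv : v ∉ P) :
    ∃ u ∈ polarDual P, u ⬝ᵥ v < -1 := by
  obtain ⟨f, c, hfv, hfP⟩ := geometric_hahn_banach_point_closed hc hcl hv
  have hc0 : c < 0 := by simpa using hfP 0 h0
  have hf : ∀ x : Fin 2 → ℝ, f x = f (Pi.single 0 1) * x 0 + f (Pi.single 1 1) * x 1 := by
    intro x
    have : x = x 0 • (Pi.single 0 1 : Fin 2 → ℝ) + x 1 • (Pi.single 1 1 : Fin 2 → ℝ) := by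
      funext i; fin_cases i <;> simp
    nth_rewrite 1 [this]
    rw [map_add, map_smul, map_smul]
    simp only [smul_eq_mul]; ring
  refine ⟨![f (Pi.single 0 1) / (-c), f (Pi.single 1 1) / (-c)], fun x hx => ?_, ?_⟩
  · have h := hfP x hx
    rw [hf] at h
    rw [dotProduct_fin_two]
    simp only [Matrix.cons_val_zero, Matrix.cons_val_one]
    rw [div_mul_eq_mul_div, div_mul_eq_mul_div, ← add_div, le_div_iff₀ (by linarith)]
    linarith
  · rw [hf] at hfv
    rw [dotProduct_fin_two]
    simp only [Matrix.cons_val_zero, Matrix.cons_val_one]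
    rw [div_mul_eq_mul_div, div_mul_eq_mul_div, ← add_div, div_lt_iff₀ (by linarith)]
    linarith

theorem isCompact_of_isLatticePolytope {P : Set (Fin 2 → ℝ)} (h : IsLatticePolytope P) :
    IsCompact P := by
  obtain ⟨S, rfl⟩ := h
  exact (S.finite_toSet.image _).isCompact_convexHull (𝕜 := ℝ)

theorem finite_lattice_points {P : Set (Fin 2 → ℝ)} (h : IsLatticePolytope P) :
    {v : Fin 2 → ℤ | latticeToReal v ∈ P}.Finite := by
  obtain ⟨C, hC⟩ := (isCompact_of_isLatticePolytope h).isBounded.exists_norm_le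
  refine (Set.finite_Icc (fun _ => -⌈C⌉) (fun _ => ⌈C⌉)).subset fun v hv => ?_
  have h1 : ∀ i, |(v i : ℝ)| ≤ C := fun i => (norm_le_pi_norm (latticeToReal v) i).trans (hC _ hv)
  refine ⟨fun i => ?_, fun i => ?_⟩
  · have := (abs_le.1 (h1 i)).1
    have h2 := Int.le_ceil C
    have : -((⌈C⌉ : ℤ) : ℝ) ≤ (v i : ℝ) := by linarith
    exact_mod_cast this
  · have := (abs_le.1 (h1 i)).2
    have h2 := Int.le_ceil C
    exact_mod_cast this.trans h2

/-- By integrality a functional negative at v is at most -1 there, so a dual constraint is tight and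
v cannot be pushed outward. Hence the origin is the only interior lattice point. -/
theorem mem_frontier_iff_of_forall {Q : Set (Fin 2 → ℝ)} (hcl : IsClosed Q)
    (h0 : (0 : Fin 2 → ℝ) ∈ interior Q) {v : Fin 2 → ℤ}
    (h : v ≠ 0 → ∃ s : Fin 2 → ℤ, dt s v < 0 ∧ ∀ x ∈ Q, -1 ≤ pair s x) :
    latticeToReal v ∈ frontier Q ↔ v ≠ 0 ∧ latticeToReal v ∈ Q := by
  rw [hcl.frontier_eq]
  have hz : latticeToReal (0 : Fin 2 → ℤ) = 0 := by funext i; simp [latticeToReal]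
  constructor
  · rintro ⟨h1, h2⟩
    exact ⟨fun e => h2 (by rw [e, hz]; exact h0), h1⟩
  · rintro ⟨hv, h1⟩
    refine ⟨h1, fun hint => ?_⟩
    obtain ⟨s, hs, hQ⟩ := h hv
    have ht : Tendsto (fun t : ℝ => t • latticeToReal v) (𝓝[>] 1) (𝓝 (latticeToReal v)) := by
      have : Continuous fun t : ℝ => t • latticeToReal v := by fun_prop
      simpa using (this.tendsto 1).mono_left nhdsWithin_le_nhds
    obtain ⟨t, ht1, ht2⟩ := ((ht.eventually (mem_interior_iff_mem_nhds.1 hint)).and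
      self_mem_nhdsWithin).exists
    have h3 := hQ _ ht1
    have h4 : pair s (t • latticeToReal v) = t * (dt s v : ℤ) := by
      simp [pair, latticeToReal, dt]; ring
    have h5 : ((dt s v : ℤ) : ℝ) ≤ -1 := by exact_mod_cast (by omega : dt s v ≤ -1)
    have ht2 : 1 < t := ht2
    rw [h4] at h3
    nlinarith

/-- The combinatorial data of a reflexive polygon: the nonzero lattice points of the polygon and
of its dual. -/
structure IsPolygonData (P : Set (Fin 2 → ℝ)) (A B : Finset (Fin 2 → ℤ)) : Prop where
  isDualPair : IsDualPair A B
  mem_polygon : ∀ x, x ∈ P ↔ ∀ u ∈ B, 0 ≤ rho x u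
  euler : eulerNumber P = A.card
  chern : chernNumber P = B.card
  forall_lattice : ∀ a b c : ℝ, (∀ x ∈ P, 0 ≤ a * x 0 + b * x 1 + c) ↔
    0 ≤ c ∧ ∀ v ∈ A, 0 ≤ a * v 0 + b * v 1 + c

theorem IsReflexivePolygon.exists_data {P : Set (Fin 2 → ℝ)} (hP : IsReflexivePolygon P) :
    ∃ A B, IsPolygonData P A B := by
  obtain ⟨SA, hSA⟩ := hP.lattice
  obtain ⟨SB, hSB⟩ := hP.dual_lattice
  have hcp := isCompact_of_isLatticePolytope hP.lattice
  have hcq := isCompact_of_isLatticePolytope hP.dual_lattice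
  have h0P : (0 : Fin 2 → ℝ) ∈ P := interior_subset hP.zero_mem_interior
  have hconv : Convex ℝ P := by rw [hSA]; exact convex_convexHull _ _
  have hbip : ∀ v, (∀ u ∈ polarDual P, -1 ≤ u ⬝ᵥ v) → v ∈ P := by
    intro v hv
    by_contra hvP
    obtain ⟨u, hu, hlt⟩ := exists_lt_of_not_mem hconv hcp.isClosed h0P hvP
    exact absurd (hv u hu) (not_le.2 hlt)
  have hSAP : ∀ s ∈ SA, latticeToReal s ∈ P := fun s hs => by
    rw [hSA]; exact subset_convexHull _ _ ⟨s, hs, rfl⟩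
  have hSBQ : ∀ s ∈ SB, latticeToReal s ∈ polarDual P := fun s hs => by
    rw [hSB]; exact subset_convexHull _ _ ⟨s, hs, rfl⟩
  have hPmem : ∀ x, x ∈ P ↔ ∀ s ∈ SB, -1 ≤ pair s x := by
    intro x
    constructor
    · intro hx s hs
      have := hSBQ s hs x hx
      rwa [dotProduct_fin_two] at this
    · intro h
      refine hbip x fun u hu => ?_
      rw [hSB] at hu
      rw [dotProduct_fin_two]
      have := le_of_mem_convexHull (a := x 0) (b := x 1) (c := -1) (fun s hs => by
        have := h s hs; unfold pair at this; linarith) hu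
      linarith
  have hQmem : ∀ x, x ∈ polarDual P ↔ ∀ s ∈ SA, -1 ≤ pair s x := by
    intro x
    constructor
    · intro hx s hs
      have := hx _ (hSAP s hs)
      rw [dotProduct_fin_two] at this
      simp only [latticeToReal] at this
      unfold pair
      linarith
    · intro h v hv
      rw [hSA] at hv
      rw [dotProduct_fin_two]
      exact le_of_mem_convexHull (a := x 0) (b := x 1) (c := -1) (fun s hs => by
        have := h s hs; unfold pair at this; linarith) hv
  have hnegA : ∀ x : Fin 2 → ℤ, x ≠ 0 → ∃ s ∈ SA, dt x s < 0 := by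
    intro x hx
    by_contra! h
    have hnn : ∀ v ∈ P, 0 ≤ (x 0 : ℝ) * v 0 + x 1 * v 1 := by
      intro v hv
      rw [hSA] at hv
      refine le_of_mem_convexHull (fun s hs => ?_) hv
      have := h s hs
      unfold dt at this
      exact_mod_cast this
    have ht : Tendsto (fun t : ℝ => t • latticeToReal x) (𝓝[<] 0) (𝓝 0) := by
      have : Continuous fun t : ℝ => t • latticeToReal x := by fun_prop
      simpa using (this.tendsto 0).mono_left nhdsWithin_le_nhds
    obtain ⟨t, ht1, ht2⟩ := ((ht.eventually (mem_interior_iff_mem_nhds.1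
      hP.zero_mem_interior)).and self_mem_nhdsWithin).exists
    have h1 := hnn _ ht1
    have ht2 : t < 0 := ht2
    simp [latticeToReal] at h1
    have hsq : 0 < (x 0 : ℝ) ^ 2 + (x 1 : ℝ) ^ 2 := by
      have : x 0 ≠ 0 ∨ x 1 ≠ 0 := by
        by_contra! h; exact hx (vec_ext h.1 h.2)
      rcases this with h | h
      · have : (x 0 : ℝ) ≠ 0 := by exact_mod_cast h
        positivity
      · have : (x 1 : ℝ) ≠ 0 := by exact_mod_cast h
        positivity
    nlinarith
  -- Otherwise P would contain the whole ray through x, against compactness.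
  have hnegB : ∀ x : Fin 2 → ℤ, x ≠ 0 → ∃ s ∈ SB, dt s x < 0 := by
    intro x hx
    by_contra! h
    obtain ⟨C, hC⟩ := hcp.isBounded.exists_norm_le
    have hmem : ∀ t : ℝ, 0 ≤ t → t • latticeToReal x ∈ P := by
      intro t ht
      rw [hPmem]
      intro s hs
      have h4 : pair s (t • latticeToReal x) = t * (dt s x : ℤ) := by
        simp [pair, latticeToReal, dt]; ring
      have h5 : (0 : ℝ) ≤ (dt s x : ℤ) := by exact_mod_cast h s hs
      rw [h4]
      nlinarith [mul_nonneg ht h5]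
    have hn : latticeToReal x ≠ 0 := by
      intro h0
      apply hx
      apply vec_ext
      · have := congrFun h0 0; simpa [latticeToReal] using this
      · have := congrFun h0 1; simpa [latticeToReal] using this
    have hpos := norm_pos_iff.2 hn
    have hC0 : 0 ≤ C := (norm_nonneg _).trans (hC _ (hmem 0 le_rfl))
    have h1 := hC _ (hmem ((C + 1) / ‖latticeToReal x‖) (by positivity))
    rw [norm_smul, Real.norm_of_nonneg (by positivity), div_mul_cancel₀ _ hpos.ne'] at h1
    linarith
  have h0Q : (0 : Fin 2 → ℝ) ∈ interior (polarDual P) := by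
    rw [mem_interior]
    refine ⟨⋂ s ∈ SA, {x | -1 < pair s x}, fun x hx => ?_, isOpen_biInter_finset fun s _ => ?_, ?_⟩
    · rw [hQmem]
      intro s hs
      exact (Set.mem_iInter₂.1 hx s hs).le
    · exact isOpen_lt continuous_const (by unfold pair; fun_prop)
    · simp [pair]
  have hfinA := finite_lattice_points hP.lattice
  have hfinB := finite_lattice_points hP.dual_lattice
  have hA : ∀ v, v ∈ hfinA.toFinset.erase 0 ↔ v ≠ 0 ∧ latticeToReal v ∈ P := by
    intro v; simp
  have hB : ∀ v, v ∈ hfinB.toFinset.erase 0 ↔ v ≠ 0 ∧ latticeToReal v ∈ polarDual P := by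
    intro v; simp
  set A := hfinA.toFinset.erase 0
  set B := hfinB.toFinset.erase 0
  have hSAA : ∀ s ∈ SA, s = 0 ∨ s ∈ A := fun s hs => by
    by_cases h : s = 0
    · exact Or.inl h
    · exact Or.inr ((hA s).2 ⟨h, hSAP s hs⟩)
  have hSBB : ∀ s ∈ SB, s = 0 ∨ s ∈ B := fun s hs => by
    by_cases h : s = 0
    · exact Or.inl h
    · exact Or.inr ((hB s).2 ⟨h, hSBQ s hs⟩)
  have hAB : ∀ u ∈ B, ∀ v ∈ A, -1 ≤ dt u v := by
    intro u hu v hv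
    have := ((hB u).1 hu).2 _ ((hA v).1 hv).2
    rw [dotProduct_fin_two] at this
    simp only [latticeToReal] at this
    unfold dt
    exact_mod_cast this
  have memA : ∀ v, v ∈ A ↔ v ≠ 0 ∧ ∀ u ∈ B, -1 ≤ dt u v := by
    refine fun v => ⟨fun hv => ⟨((hA v).1 hv).1, fun u hu => hAB u hu v hv⟩, fun ⟨h1, h2⟩ => ?_⟩
    refine (hA v).2 ⟨h1, (hPmem _).2 fun s hs => ?_⟩
    rw [pair_latticeToReal]
    rcases hSBB s hs with rfl | hs
    · simp [dt]
    · exact_mod_cast h2 s hs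
  have memB : ∀ u, u ∈ B ↔ u ≠ 0 ∧ ∀ v ∈ A, -1 ≤ dt u v := by
    refine fun v => ⟨fun hv => ⟨((hB v).1 hv).1, fun u hu => hAB v hv u hu⟩, fun ⟨h1, h2⟩ => ?_⟩
    refine (hB v).2 ⟨h1, (hQmem _).2 fun s hs => ?_⟩
    rw [pair_latticeToReal, dt_comm]
    rcases hSAA s hs with rfl | hs
    · simp [dt]
    · exact_mod_cast h2 s hs
  have negA : ∀ x : Fin 2 → ℤ, x ≠ 0 → ∃ p ∈ A, dt x p < 0 := by
    intro x hx
    obtain ⟨s, hs, h⟩ := hnegA x hx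
    rcases hSAA s hs with rfl | hs
    · simp [dt] at h
    · exact ⟨s, hs, h⟩
  have negB : ∀ x : Fin 2 → ℤ, x ≠ 0 → ∃ p ∈ B, dt x p < 0 := by
    intro x hx
    obtain ⟨s, hs, h⟩ := hnegB x hx
    rcases hSBB s hs with rfl | hs
    · simp [dt] at h
    · exact ⟨s, hs, by rwa [dt_comm]⟩
  have hpa : ∀ x : Fin 2 → ℝ, (∀ s ∈ SB, -1 ≤ pair s x) →
      x ∈ convexHull ℝ (latticeToReal '' (SA : Set (Fin 2 → ℤ))) := fun x hx => by
    rw [← hSA]; exact (hPmem x).2 hx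
  have hpb : ∀ x : Fin 2 → ℝ, (∀ s ∈ SA, -1 ≤ pair s x) →
      x ∈ convexHull ℝ (latticeToReal '' (SB : Set (Fin 2 → ℤ))) := fun x hx => by
    rw [← hSB]; exact (hQmem x).2 hx
  refine ⟨A, B, ⟨memA, memB, fun x hx => ?_, fun x hx => ?_⟩, fun x => ?_, ?_, ?_, fun a b c => ?_⟩
  · exact isDualPair_flag hpa hpb hSAA hSBB hAB hx (negA x hx)
  · exact isDualPair_flag hpb hpa hSBB hSAA (fun u hu v hv => by rw [dt_comm]; exact hAB v hv u hu)
      hx (negB x hx)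
  · rw [hPmem]
    constructor
    · intro h u hu
      rw [rho_eq]
      have h1 := ((hB u).1 hu).2 x ((hPmem x).2 h)
      rw [dotProduct_fin_two] at h1
      simp only [latticeToReal] at h1
      unfold pair
      linarith
    · intro h s hs
      rcases hSBB s hs with rfl | hs
      · simp [pair]
      · have := h s hs
        rw [rho_eq] at this
        linarith
  · rw [eulerNumber, perimeterPoints, ← Set.ncard_coe_finset]
    congr 1
    ext v
    rw [Set.mem_ofPred_eq, Finset.mem_coe, hA, mem_frontier_iff_of_forall hcp.isClosed
      hP.zero_mem_interior]
    intro hv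
    obtain ⟨s, hs, h⟩ := hnegB v hv
    exact ⟨s, h, fun x hx => (hPmem x).1 hx s hs⟩
  · rw [chernNumber, perimeterPoints, ← Set.ncard_coe_finset]
    congr 1
    ext v
    rw [Set.mem_ofPred_eq, Finset.mem_coe, hB, mem_frontier_iff_of_forall hcq.isClosed h0Q]
    intro hv
    obtain ⟨s, hs, h⟩ := hnegA v hv
    exact ⟨s, by rwa [dt_comm], fun x hx => (hQmem x).1 hx s hs⟩
  · constructor
    · intro h
      refine ⟨by simpa using h 0 h0P, fun v hv => ?_⟩
      exact h _ ((hA v).1 hv).2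
    · rintro ⟨h0, h⟩ x hx
      rw [hSA] at hx
      have := le_of_mem_convexHull (a := a) (b := b) (c := -c) (fun s hs => by
        rcases hSAA s hs with rfl | hs
        · simpa using h0
        · linarith [h s hs]) hx
      linarith

/-! ### Monomial bases of degenerations of monoid algebras -/

section Degeneration

open MvPolynomial Finsupp

variable {M ι : Type} [AddCommMonoid M]

/-- The homomorphism from the polynomial ring to the monoid algebra with generators `γ`. -/
noncomputable def monoidPresentation (γ : ι → M) : MvPolynomial ι ℂ →ₐ[ℂ] AddMonoidAlgebra ℂ M :=
  aeval fun i => AddMonoidAlgebra.single (γ i) (1 : ℂ)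

theorem monoidPresentation_monomial (γ : ι → M) (a : ι →₀ ℕ) (c : ℂ) :
    monoidPresentation γ (monomial a c) = AddMonoidAlgebra.single (weight γ a) c := by
  have h : (a.prod fun i k => AddMonoidAlgebra.single (γ i) (1 : ℂ) ^ k) =
      AddMonoidAlgebra.single (weight γ a) 1 := by
    induction a using Finsupp.induction_linear with
    | zero => rw [Finsupp.prod_zero_index, map_zero]; rfl
    | add f g hf hg =>
      rw [Finsupp.prod_add_index' (fun _ => pow_zero _) (fun _ _ _ => pow_add _ _ _), hf, hg,
        AddMonoidAlgebra.single_mul_single, map_add, one_mul]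
    | single i n =>
      rw [Finsupp.prod_single_index (h := fun i k => AddMonoidAlgebra.single (γ i) (1 : ℂ) ^ k)
        (pow_zero _), AddMonoidAlgebra.single_pow, one_pow, weight_single]
  rw [monoidPresentation, aeval_monomial, h, AddMonoidAlgebra.coe_algebraMap, Function.comp_apply,
    AddMonoidAlgebra.single_mul_single, zero_add, mul_one]
  rfl

/-- The weights `η` of a test symmetry on the generators `γ` of `M` have a largest value `mx m` on
the monomials of each degree `m`. -/
structure IsMaxWeight (γ : ι → M) (η : ι → ℕ) (mx : M → ℕ) : Prop where
  le : ∀ a : ι →₀ ℕ, weight η a ≤ mx (weight γ a)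
  exists_eq : ∀ m, ∃ a : ι →₀ ℕ, weight γ a = m ∧ weight η a = mx m

open Classical in
/-- Sends the monomials of maximal weight to their degree, and the other monomials to zero. -/
noncomputable def normalMap (γ : ι → M) (η : ι → ℕ) (mx : M → ℕ) :
    MvPolynomial ι ℂ →ₗ[ℂ] (M →₀ ℂ) :=
  (basisMonomials ι ℂ).constr ℂ fun a =>
    if weight η a = mx (weight γ a) then Finsupp.single (weight γ a) 1 else 0

open Classical in
theorem normalMap_monomial (γ : ι → M) (η : ι → ℕ) (mx : M → ℕ) (a : ι →₀ ℕ) (c : ℂ) :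
    normalMap γ η mx (monomial a c) =
      if weight η a = mx (weight γ a) then Finsupp.single (weight γ a) c else 0 := by
  have h1 : monomial a c = c • basisMonomials ι ℂ a := by simp [smul_monomial]
  rw [h1, map_smul, normalMap, Module.Basis.constr_basis]
  split_ifs <;> simp

open Classical in
theorem normalMap_apply (γ : ι → M) (η : ι → ℕ) (mx : M → ℕ) (f : MvPolynomial ι ℂ) (m : M) :
    normalMap γ η mx f m = ∑ a ∈ f.support,
      if weight η a = mx m ∧ weight γ a = m then coeff a f else 0 := by
  nth_rewrite 1 [f.as_sum]
  rw [map_sum, Finsupp.finsetSum_apply]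
  refine Finset.sum_congr rfl fun a _ => ?_
  rw [normalMap_monomial]
  by_cases h1 : weight γ a = m
  · subst h1
    by_cases h2 : weight η a = mx (weight γ a) <;> simp [h2]
  · split_ifs with h2 h3 h3
    · exact absurd h3.2 h1
    · rw [Finsupp.single_apply, if_neg h1]
    · exact absurd h3.2 h1
    · rfl

open Classical in
theorem coeff_monoidPresentation (γ : ι → M) (f : MvPolynomial ι ℂ) (m : M) :
    (monoidPresentation γ f).coeff m =
      ∑ a ∈ f.support, if weight γ a = m then coeff a f else 0 := by
  have key : ∀ s : Finset (ι →₀ ℕ), (monoidPresentation γ (∑ a ∈ s, monomial a (coeff a f))).coeff m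
      = ∑ a ∈ s, if weight γ a = m then coeff a f else 0 := by
    intro s
    induction s using Finset.induction_on with
    | empty => simp
    | insert a s ha ih =>
      rw [Finset.sum_insert ha, Finset.sum_insert ha, map_add, monoidPresentation_monomial,
        AddMonoidAlgebra.coeff_add, Finsupp.add_apply, ih, AddMonoidAlgebra.coeff_single,
        Finsupp.single_apply]
  nth_rewrite 1 [f.as_sum]
  exact key _

/-- Let n be the lowest weight in f. In a degree m with mx m = n every monomial of f has weight
exactly n, so the initial form contains the whole degree-m part, whose coefficients sum to 0. In
other degrees the initial form has no monomial of maximal weight. -/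
theorem initialForm_mem_ker {γ : ι → M} {η : ι → ℕ} {mx : M → ℕ} (h : IsMaxWeight γ η mx)
    {f : MvPolynomial ι ℂ} (hf : monoidPresentation γ f = 0) :
    normalMap γ η mx (initialForm η f) = 0 := by
  classical
  ext m
  unfold initialForm
  set n := sInf {n : ℕ | weightedHomogeneousComponent η n f ≠ 0} with hn
  have hmin : ∀ a ∈ f.support, n ≤ weight η a := by
    intro a ha
    refine Nat.sInf_le fun h0 => MvPolynomial.mem_support_iff.1 ha ?_
    have := congrArg (coeff a) h0
    rwa [coeff_weightedHomogeneousComponent, if_pos rfl, coeff_zero] at this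
  rw [normalMap_apply]
  by_cases hm : mx m = n
  · have h0 : ∑ a ∈ f.support, (if weight γ a = m then coeff a f else 0) = 0 := by
      rw [← coeff_monoidPresentation, hf]; rfl
    refine Eq.trans ?_ h0
    rw [support_weightedHomogeneousComponent]
    rw [Finset.sum_filter]
    refine Finset.sum_congr rfl fun a ha => ?_
    rw [coeff_weightedHomogeneousComponent]
    by_cases h1 : weight γ a = m
    · have h2 := h.le a
      have h3 := hmin a ha
      rw [h1] at h2
      have h4 : weight η a = n := by omega
      rw [if_pos h4, if_pos h4, if_pos ⟨h4.trans hm.symm, h1⟩, if_pos h1]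
    · simp [h1]
  · refine Finset.sum_eq_zero fun a ha => ?_
    rw [support_weightedHomogeneousComponent, Finset.mem_filter] at ha
    rw [if_neg]
    rintro ⟨h1, -⟩
    exact hm (h1.symm.trans ha.2)

/-- A monomial of non-maximal weight stays non-maximal after multiplication, since a heavier one of
the same degree can replace it. So multiplication by a monomial descends to a map T on normal forms.
-/
theorem normalMap_mul_eq_zero {γ : ι → M} {η : ι → ℕ} {mx : M → ℕ} (h : IsMaxWeight γ η mx)
    (g f : MvPolynomial ι ℂ) (hf : normalMap γ η mx f = 0) : normalMap γ η mx (g * f) = 0 := by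
  classical
  induction g using MvPolynomial.induction_on' with
  | add p q hp hq => rw [add_mul, map_add, hp, hq, add_zero]
  | monomial b c =>
    set T : (M →₀ ℂ) →ₗ[ℂ] (M →₀ ℂ) := Finsupp.linearCombination ℂ fun m =>
      if mx m + weight η b = mx (m + weight γ b) then Finsupp.single (m + weight γ b) c else 0
      with hT
    have key : normalMap γ η mx ∘ₗ LinearMap.mulLeft ℂ (monomial b c) = T ∘ₗ normalMap γ η mx := by
      refine (basisMonomials ι ℂ).ext fun a => ?_
      rw [coe_basisMonomials]
      simp only [LinearMap.comp_apply, LinearMap.mulLeft_apply, monomial_mul, mul_one]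
      rw [normalMap_monomial, normalMap_monomial, map_add, map_add]
      by_cases h1 : weight η a = mx (weight γ a)
      · rw [if_pos h1, hT, Finsupp.linearCombination_single, one_smul, ← h1,
          add_comm (weight η b), add_comm (weight γ b)]
      · rw [if_neg h1, map_zero, if_neg]
        obtain ⟨a', e1, e2⟩ := h.exists_eq (weight γ a)
        have h2 := h.le a
        have h3 := h.le (b + a')
        rw [map_add, map_add, e1, e2] at h3
        omega
    have := LinearMap.congr_fun key f
    rw [LinearMap.comp_apply, LinearMap.comp_apply, hf, map_zero] at this
    exact this

theorem normalMap_eq_zero_of_mem {γ : ι → M} {η : ι → ℕ} {mx : M → ℕ} (h : IsMaxWeight γ η mx)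
    {f : MvPolynomial ι ℂ}
    (hf : f ∈ centralFibreIdeal (RingHom.ker (monoidPresentation γ)) η) :
    normalMap γ η mx f = 0 := by
  unfold centralFibreIdeal at hf
  induction hf using Submodule.span_induction with
  | mem x hx =>
    obtain ⟨g, hg, rfl⟩ := hx
    exact initialForm_mem_ker h hg
  | zero => exact map_zero _
  | add x y _ _ hx hy => rw [map_add, hx, hy, add_zero]
  | smul a x _ hx => exact normalMap_mul_eq_zero h a x hx

theorem initialForm_eq {η : ι → ℕ} {n : ℕ} {f : MvPolynomial ι ℂ}
    (h1 : ∀ a ∈ f.support, n ≤ weight η a) (h2 : weightedHomogeneousComponent η n f ≠ 0) :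
    initialForm η f = weightedHomogeneousComponent η n f := by
  classical
  have : sInf {n : ℕ | weightedHomogeneousComponent η n f ≠ 0} = n := by
    refine le_antisymm (Nat.sInf_le h2) (le_csInf ⟨n, h2⟩ fun k hk => ?_)
    obtain ⟨d, hd⟩ := MvPolynomial.ne_zero_iff.1 hk
    rw [coeff_weightedHomogeneousComponent] at hd
    split_ifs at hd with h
    · rw [← h]; exact h1 d (MvPolynomial.mem_support_iff.2 hd)
    · exact absurd rfl hd
  rw [initialForm, this]

theorem monomial_sub_mem_centralFibreIdeal {γ : ι → M} {η : ι → ℕ} {a a' : ι →₀ ℕ}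
    (h : weight γ a = weight γ a') (hw : weight η a = weight η a') :
    monomial a (1 : ℂ) - monomial a' 1 ∈
      centralFibreIdeal (RingHom.ker (monoidPresentation γ)) η := by
  by_cases haa : a = a'
  · rw [haa, sub_self]; exact zero_mem _
  refine Ideal.subset_span ⟨monomial a 1 - monomial a' 1, ?_, ?_⟩
  · rw [SetLike.mem_coe, RingHom.mem_ker]
    rw [map_sub, monoidPresentation_monomial, monoidPresentation_monomial, h, sub_self]
  · have hom : IsWeightedHomogeneous η (monomial a (1 : ℂ) - monomial a' 1) (weight η a) :=
      (isWeightedHomogeneous_monomial _ _ _ rfl).sub (isWeightedHomogeneous_monomial _ _ _ hw.symm)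
    have e := hom.weightedHomogeneousComponent_same
    rw [initialForm_eq (n := weight η a), e]
    · intro d hd
      exact (hom (MvPolynomial.mem_support_iff.1 hd)).ge
    · rw [e, sub_ne_zero]
      intro h0
      exact haa (monomial_left_injective one_ne_zero h0)

/-- The monomial is the lowest-weight part of the relation x^a - x^a'. -/
theorem monomial_mem_centralFibreIdeal {γ : ι → M} {η : ι → ℕ} {a a' : ι →₀ ℕ}
    (h : weight γ a = weight γ a') (hw : weight η a < weight η a') :
    monomial a (1 : ℂ) ∈ centralFibreIdeal (RingHom.ker (monoidPresentation γ)) η := by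
  classical
  refine Ideal.subset_span ⟨monomial a 1 - monomial a' 1, ?_, ?_⟩
  · rw [SetLike.mem_coe, RingHom.mem_ker]
    rw [map_sub, monoidPresentation_monomial, monoidPresentation_monomial, h, sub_self]
  · have e : weightedHomogeneousComponent η (weight η a) (monomial a (1 : ℂ) - monomial a' 1) =
        monomial a 1 := by
      rw [map_sub, (isWeightedHomogeneous_monomial η a (1 : ℂ) rfl).weightedHomogeneousComponent_same,
        (isWeightedHomogeneous_monomial η a' (1 : ℂ) rfl).weightedHomogeneousComponent_ne _ hw.ne,
        sub_zero]
    rw [initialForm_eq (n := weight η a), e]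
    · intro d hd
      have hd := MvPolynomial.mem_support_iff.1 hd
      rw [coeff_sub, coeff_monomial, coeff_monomial] at hd
      by_cases h1 : a = d
      · rw [h1]
      · by_cases h2 : a' = d
        · rw [← h2]; exact hw.le
        · simp [h1, h2] at hd
    · rw [e, Ne, monomial_eq_zero]; exact one_ne_zero

/-- `J` is the kernel of the normal form map of the weights `η`. -/
structure IsNormalIdeal (γ : ι → M) (η : ι → ℕ) (mx : M → ℕ) (J : Ideal (MvPolynomial ι ℂ)) :
    Prop where
  isMaxWeight : IsMaxWeight γ η mx
  eq_zero : ∀ f ∈ J, normalMap γ η mx f = 0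
  sub_mem : ∀ a a' : ι →₀ ℕ, weight γ a = weight γ a' → weight η a = mx (weight γ a) →
    weight η a' = mx (weight γ a') → monomial a (1 : ℂ) - monomial a' 1 ∈ J
  mem : ∀ a : ι →₀ ℕ, weight η a ≠ mx (weight γ a) → monomial a (1 : ℂ) ∈ J

theorem isNormalIdeal_centralFibreIdeal {γ : ι → M} {η : ι → ℕ} {mx : M → ℕ}
    (h : IsMaxWeight γ η mx) :
    IsNormalIdeal γ η mx (centralFibreIdeal (RingHom.ker (monoidPresentation γ)) η) := by
  refine ⟨h, fun f hf => normalMap_eq_zero_of_mem h hf, fun a a' h1 h2 h3 =>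
    monomial_sub_mem_centralFibreIdeal h1 (by rw [h2, h3, h1]), fun a ha => ?_⟩
  obtain ⟨a', e1, e2⟩ := h.exists_eq (weight γ a)
  exact monomial_mem_centralFibreIdeal e1.symm (by rw [e2]; exact lt_of_le_of_ne (h.le a) ha)

/-- The coordinate ring itself is the case η = 0, so one computation of Hilbert series serves both
it and the central fibres. -/
theorem isNormalIdeal_ker {γ : ι → M} (hγ : ∀ m, ∃ a : ι →₀ ℕ, weight γ a = m) :
    IsNormalIdeal γ 0 0 (RingHom.ker (monoidPresentation γ)) := by
  classical
  have h0 : ∀ a : ι →₀ ℕ, weight (0 : ι → ℕ) a = 0 := fun a => by simp [weight_apply]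
  refine ⟨⟨fun a => by simp [h0], fun m => ?_⟩, fun f hf => ?_, fun a a' h1 _ _ => ?_,
    fun a ha => absurd (h0 a) ha⟩
  · obtain ⟨a, ha⟩ := hγ m
    exact ⟨a, ha, h0 a⟩
  · have hf : monoidPresentation γ f = 0 := hf
    ext m
    have := coeff_monoidPresentation γ f m
    rw [hf] at this
    rw [normalMap_apply]
    simp only [h0, Pi.zero_apply, true_and]
    rw [← this]; rfl
  · rw [RingHom.mem_ker]
    rw [map_sub, monoidPresentation_monomial, monoidPresentation_monomial, h1, sub_self]

/-- The normal form map is a surjection with kernel J, so the quotient has a basis of maximal-weight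
monomials, one for each m in M. -/
theorem IsNormalIdeal.exists_gradedPiece_eq {γ : ι → M} {η : ι → ℕ} {mx : M → ℕ}
    {J : Ideal (MvPolynomial ι ℂ)} (h : IsNormalIdeal γ η mx J) {w : ι → ℝ} {wt : M → ℝ}
    (hw : ∀ a : ι →₀ ℕ, weight η a = mx (weight γ a) → weight w a = wt (weight γ a)) :
    ∃ ψ : (M →₀ ℂ) →ₗ[ℂ] (MvPolynomial ι ℂ ⧸ J), Function.Injective ψ ∧
      ∀ d : ℝ, gradedPiece J w d = (Finsupp.supported ℂ ℂ {m | wt m = d}).map ψ := by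
  classical
  choose s hs1 hs2 using h.isMaxWeight.exists_eq
  set φ := normalMap γ η mx
  set mk := (Ideal.Quotient.mkₐ ℂ J).toLinearMap
  set ψ : (M →₀ ℂ) →ₗ[ℂ] (MvPolynomial ι ℂ ⧸ J) :=
    Finsupp.linearCombination ℂ fun m => mk (monomial (s m) 1) with hψ
  have hmk : ∀ f, mk f = 0 ↔ f ∈ J := fun f => Ideal.Quotient.eq_zero_iff_mem
  have hφs : ∀ m, φ (monomial (s m) 1) = Finsupp.single m 1 := fun m => by
    rw [normalMap_monomial, hs1, hs2, if_pos rfl]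
  have hcomp : ψ ∘ₗ φ = mk := by
    refine (basisMonomials ι ℂ).ext fun a => ?_
    rw [coe_basisMonomials, LinearMap.comp_apply]
    change ψ (normalMap γ η mx (monomial a 1)) = mk (monomial a 1)
    rw [normalMap_monomial]
    by_cases ha : weight η a = mx (weight γ a)
    · rw [if_pos ha, hψ, Finsupp.linearCombination_single, one_smul, ← sub_eq_zero, ← map_sub, hmk]
      exact h.sub_mem _ _ (hs1 _) (by rw [hs2, hs1]) ha
    · rw [if_neg ha, map_zero, eq_comm, hmk]
      exact h.mem a ha
  have hsurj : Function.Surjective φ := by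
    intro x
    induction x using Finsupp.induction_linear with
    | zero => exact ⟨0, map_zero _⟩
    | add f g hf hg =>
      obtain ⟨x, rfl⟩ := hf
      obtain ⟨y, rfl⟩ := hg
      exact ⟨x + y, map_add _ _ _⟩
    | single m c =>
      refine ⟨c • monomial (s m) 1, ?_⟩
      rw [map_smul, hφs, Finsupp.smul_single, smul_eq_mul, mul_one]
  refine ⟨ψ, ?_, fun d => ?_⟩
  · rw [injective_iff_map_eq_zero]
    intro x hx
    obtain ⟨f, rfl⟩ := hsurj x
    have : mk f = 0 := by rw [← hcomp]; exact hx
    exact h.eq_zero f ((hmk f).1 this)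
  · have himg : (weightedHomogeneousSubmodule ℂ w d).map φ =
        Finsupp.supported ℂ ℂ {m | wt m = d} := by
      apply le_antisymm
      · rintro _ ⟨f, hf, rfl⟩
        rw [Finsupp.mem_supported]
        intro m hm
        rw [Finset.mem_coe, Finsupp.mem_support_iff, normalMap_apply] at hm
        obtain ⟨a, ha, hne⟩ := Finset.exists_ne_zero_of_sum_ne_zero hm
        split_ifs at hne with hc
        · obtain ⟨c1, c2⟩ := hc
          have := hf (MvPolynomial.mem_support_iff.1 ha)
          rw [hw a (by rw [c1, c2]), c2] at this
          exact this
        · exact absurd rfl hne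
      · rw [Finsupp.supported_eq_span_single, Submodule.span_le]
        rintro _ ⟨m, hm, rfl⟩
        refine ⟨monomial (s m) 1, ?_, hφs m⟩
        refine isWeightedHomogeneous_monomial w (s m) 1 ?_
        rw [hw _ (by rw [hs2, hs1]), hs1]
        exact hm
    rw [gradedPiece, ← himg, ← Submodule.map_comp, hcomp]

theorem IsNormalIdeal.isHilbertSeries {γ : ι → M} {η : ι → ℕ} {mx : M → ℕ}
    {J : Ideal (MvPolynomial ι ℂ)} (h : IsNormalIdeal γ η mx J) {w : ι → ℝ} {wt : M → ℝ}
    (hw : ∀ a : ι →₀ ℕ, weight η a = mx (weight γ a) → weight w a = wt (weight γ a))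
    {g : ℝ → ℝ} (hg : ∀ t ∈ Set.Ioo (0 : ℝ) 1, HasSum (fun m => t ^ wt m) (g t)) :
    IsHilbertSeries J w g := by
  classical
  obtain ⟨ψ, hψ, hgr⟩ := h.exists_gradedPiece_eq hw
  -- Infinitely many elements of one weight d would contribute equal terms (1/2)^d to a convergent
  -- series.
  have hfin : ∀ d : ℝ, {m | wt m = d}.Finite := by
    intro d
    have h1 := (hg (1 / 2) ⟨by norm_num, by norm_num⟩).summable.tendsto_cofinite_zero
    have h2 : ∀ᶠ m in cofinite, (1 / 2 : ℝ) ^ wt m < (1 / 2 : ℝ) ^ d :=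
      h1.eventually_lt_const (by positivity)
    refine (Filter.eventually_cofinite.1 h2).subset fun m hm => ?_
    have hm : wt m = d := hm
    simp [hm]
  have hdim : ∀ d : ℝ, FiniteDimensional ℂ (gradedPiece J w d) ∧
      Module.finrank ℂ (gradedPiece J w d) = Nat.card {m | wt m = d} := by
    intro d
    have : Finite {m | wt m = d} := hfin d
    have := Fintype.ofFinite {m | wt m = d}
    have e : (Finsupp.supported ℂ ℂ {m | wt m = d}) ≃ₗ[ℂ] gradedPiece J w d :=
      (Submodule.equivMapOfInjective ψ hψ _).trans (LinearEquiv.ofEq _ _ (hgr d).symm)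
    have e2 := (Finsupp.supportedEquivFinsupp (M := ℂ) (R := ℂ) {m | wt m = d}).symm.trans e
    refine ⟨Module.Finite.equiv e2, ?_⟩
    rw [← e2.finrank_eq, Module.finrank_finsupp_self, Nat.card_eq_fintype_card]
  refine ⟨fun d => (hdim d).1, fun t ht => ?_⟩
  have h1 : HasSum ((fun m => t ^ wt m) ∘ (Equiv.sigmaFiberEquiv wt)) (g t) :=
    (Equiv.hasSum_iff _).2 (hg t ht)
  refine h1.sigma fun d => ?_
  have : Finite {m | wt m = d} := hfin d
  have : Fintype {m // wt m = d} := Fintype.ofFinite {m | wt m = d}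
  rw [(hdim d).2]
  have h2 : ∀ c : {m // wt m = d}, ((fun m => t ^ wt m) ∘ (Equiv.sigmaFiberEquiv wt)) ⟨d, c⟩ =
      t ^ d := fun c => by
    simp [Equiv.sigmaFiberEquiv, c.2]
  simp only [h2]
  have h3 := hasSum_fintype (fun _ : {m // wt m = d} => t ^ d)
  simp only [Finset.sum_const, Finset.card_univ, nsmul_eq_mul] at h3
  rw [← Nat.card_eq_fintype_card] at h3
  exact h3

end Degeneration

/-! ### Sums over the dual monoid -/

/-- The horizontal part of a lattice point of the dual cone. -/
def base (m : Fin 3 → ℤ) : Fin 2 → ℤ := ![m 0, m 1]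

theorem vec3_ext {m m' : Fin 3 → ℤ} (h : base m = base m') (h2 : m 2 = m' 2) : m = m' := by
  have h0 := congrFun h 0
  have h1 := congrFun h 1
  simp only [base, Matrix.cons_val_zero, Matrix.cons_val_one] at h0 h1
  funext i; fin_cases i <;> assumption

theorem dotProduct_fin_three (u v : Fin 3 → ℝ) : u ⬝ᵥ v = u 0 * v 0 + u 1 * v 1 + u 2 * v 2 := by
  simp [dotProduct, Fin.sum_univ_three]

theorem dotProduct_lift (m : Fin 3 → ℤ) (x : Fin 2 → ℝ) :
    latticeToReal m ⬝ᵥ lift x = pair (base m) x + m 2 := by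
  rw [dotProduct_fin_three]
  simp [lift, latticeToReal, pair, base]

theorem mem_dualMonoid_iff_forall {P : Set (Fin 2 → ℝ)} {m : Fin 3 → ℤ} :
    m ∈ dualMonoid P ↔ ∀ x ∈ P, 0 ≤ pair (base m) x + m 2 := by
  constructor
  · intro h x hx
    rw [← dotProduct_lift]
    exact h _ (Submodule.subset_span ⟨x, hx, rfl⟩)
  · intro h y hy
    refine Submodule.span_induction (p := fun y _ => 0 ≤ latticeToReal m ⬝ᵥ y) ?_ ?_ ?_ ?_
      (show y ∈ Submodule.span _ (lift '' P) from hy)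
    · rintro _ ⟨x, hx, rfl⟩
      rw [dotProduct_lift]
      exact h x hx
    · simp
    · intro a b _ _ ha hb
      rw [dotProduct_add]
      exact add_nonneg ha hb
    · intro c a _ ha
      have : (c • a : Fin 3 → ℝ) = (c : ℝ) • a := rfl
      rw [this, dotProduct_smul, smul_eq_mul]
      exact mul_nonneg c.2 ha

namespace IsPolygonData

variable {P : Set (Fin 2 → ℝ)} {A B : Finset (Fin 2 → ℤ)}

theorem mem_dualMonoid (h : IsPolygonData P A B) {m : Fin 3 → ℤ} :
    m ∈ dualMonoid P ↔ 0 ≤ m 2 ∧ ∀ v ∈ A, -(m 2) ≤ dt (base m) v := by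
  have := h.forall_lattice (m 0) (m 1) (m 2)
  rw [mem_dualMonoid_iff_forall]
  have e : ∀ x, pair (base m) x + m 2 = m 0 * x 0 + m 1 * x 1 + m 2 := fun x => by
    simp [pair, base]
  simp only [e, this]
  have e2 : ∀ v : Fin 2 → ℤ, (0 : ℝ) ≤ m 0 * v 0 + m 1 * v 1 + m 2 ↔ -(m 2) ≤ dt (base m) v := by
    intro v
    simp only [dt, base, Matrix.cons_val_zero, Matrix.cons_val_one]
    constructor
    · intro h
      have : 0 ≤ m 0 * v 0 + m 1 * v 1 + m 2 := by exact_mod_cast h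
      omega
    · intro h
      have : 0 ≤ m 0 * v 0 + m 1 * v 1 + m 2 := by omega
      exact_mod_cast this
  simp only [e2, Int.cast_nonneg_iff]

theorem height_nonneg (h : IsPolygonData P A B) (m : dualMonoid P) : 0 ≤ m.1 2 :=
  (h.mem_dualMonoid.1 m.2).1

theorem height_pos (h : IsPolygonData P A B) {m : dualMonoid P} (hm : m ≠ 0) : 0 < m.1 2 := by
  obtain ⟨h1, h2⟩ := h.mem_dualMonoid.1 m.2
  refine lt_of_le_of_ne h1 fun h0 => hm ?_
  have hb : base m.1 = 0 := by
    by_contra hb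
    obtain ⟨p, hp, -, -, -, -, -, hlt, -⟩ := h.isDualPair.flag_left _ hb
    have := h2 p hp
    omega
  refine Subtype.ext (vec3_ext ?_ h0.symm)
  rw [hb]
  funext i; fin_cases i <;> simp [base]

/-- The lattice point of height `n` over `u`. -/
def liftInt (u : Fin 2 → ℤ) (n : ℤ) : Fin 3 → ℤ := ![u 0, u 1, n]

theorem base_liftInt (u : Fin 2 → ℤ) (n : ℤ) : base (liftInt u n) = u := by
  funext i; fin_cases i <;> simp [base, liftInt]

theorem liftInt_two (u : Fin 2 → ℤ) (n : ℤ) : liftInt u n 2 = n := by simp [liftInt]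

theorem liftInt_zero_mem (h : IsPolygonData P A B) (n : ℕ) : liftInt 0 n ∈ dualMonoid P := by
  rw [h.mem_dualMonoid, base_liftInt, liftInt_two]
  refine ⟨by positivity, fun v hv => ?_⟩
  simp [dt]

theorem liftInt_cone_mem (h : IsPolygonData P A B) {u : Fin 2 → ℤ} (hu : u ∈ B) (n b c : ℕ) :
    liftInt (((b : ℤ) + 1) • u + (c : ℤ) • IsDualPair.next A B u) (n + (b + 1) + c) ∈
      dualMonoid P := by
  rw [h.mem_dualMonoid, base_liftInt, liftInt_two]
  refine ⟨by positivity, fun v hv => ?_⟩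
  have := h.isDualPair.dt_cone_le hu hv (b := b + 1) (c := c) (by positivity) (by positivity)
  linarith [Int.natCast_nonneg n]

/-- The decomposition of the dual monoid into translates of free monoids. -/
noncomputable def coneMap (h : IsPolygonData P A B) :
    ℕ ⊕ ({u // u ∈ B} × (ℕ × (ℕ × ℕ))) → dualMonoid P
  | Sum.inl n => ⟨liftInt 0 n, h.liftInt_zero_mem n⟩
  | Sum.inr (u, n, b, c) => ⟨_, h.liftInt_cone_mem u.2 n b c⟩

/-- The horizontal part of m is 0 or lies in exactly one half-open cone. The free parameter n is the
excess of the height of m over the minimum b + c, which the facet of that cone bounds from below. -/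
theorem coneMap_bijective (h : IsPolygonData P A B) : Function.Bijective h.coneMap := by
  have hF := h.isDualPair.isSmoothFan
  have hne : ∀ u ∈ B, ∀ b c : ℕ, (0 : Fin 2 → ℤ) ≠
      ((b : ℤ) + 1) • u + (c : ℤ) • IsDualPair.next A B u := by
    intro u hu b c e
    have := congrArg (fun x => cr x (IsDualPair.next A B u)) e
    simp only [cr_add_left, cr_smul_left, cr_self, hF.cr_next u hu] at this
    simp [cr] at this
    omega
  constructor
  · rintro (n | ⟨⟨u, hu⟩, n, b, c⟩) (n' | ⟨⟨u', hu'⟩, n', b', c'⟩) e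
    · have := congrFun (congrArg Subtype.val e) 2
      simp only [coneMap, liftInt_two] at this
      rw [Nat.cast_inj.1 this]
    · have := congrArg (fun m => base m.1) e
      simp only [coneMap, base_liftInt] at this
      exact absurd this (hne u' hu' b' c')
    · have := congrArg (fun m => base m.1) e
      simp only [coneMap, base_liftInt] at this
      exact absurd this.symm (hne u hu b c)
    · have h1 := congrArg (fun m => base m.1) e
      have h2 := congrFun (congrArg Subtype.val e) 2
      simp only [coneMap, base_liftInt, liftInt_two] at h1 h2
      have huu := hF.unique u hu u' hu' _ _ _ _ (by positivity) (by positivity) (by positivity)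
        (by positivity) h1
      subst huu
      obtain ⟨e1, e2⟩ := smul_add_smul_inj (hF.cr_next u hu) h1
      have hb : b = b' := by omega
      have hc : c = c' := by omega
      have hn : n = n' := by omega
      rw [hb, hc, hn]
  · intro m
    obtain ⟨h1, h2⟩ := h.mem_dualMonoid.1 m.2
    by_cases hb : base m.1 = 0
    · refine ⟨Sum.inl (m.1 2).toNat, Subtype.ext (vec3_ext ?_ ?_)⟩
      · simp only [coneMap]; rw [base_liftInt, hb]
      · simp only [coneMap, liftInt_two]; omega
    · obtain ⟨u, hu, b, c, hb0, hc0, e⟩ := hF.cover _ hb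
      obtain ⟨a1, a2, a3⟩ := h.isDualPair.facet_spec hu
      have h3 := h2 _ a1
      rw [e, dt_add_left, dt_smul_left, dt_smul_left, a2, h.isDualPair.dt_next_facet hu] at h3
      refine ⟨Sum.inr (⟨u, hu⟩, (m.1 2 - (b + c)).toNat, (b - 1).toNat, c.toNat),
        Subtype.ext (vec3_ext ?_ ?_)⟩
      · simp only [coneMap]
        rw [base_liftInt, e, Int.toNat_of_nonneg (by omega), Int.toNat_of_nonneg hc0,
          sub_add_cancel]
      · simp only [coneMap, liftInt_two]; omega

/-- The degree on the dual monoid for the Reeb vector `2 (β, 1)`. -/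
noncomputable def reeb (P : Set (Fin 2 → ℝ)) (β : Fin 2 → ℝ) : dualMonoid P →+ ℝ where
  toFun m := 2 * (m.1 2 + pair (base m.1) β)
  map_zero' := by simp [pair, base]
  map_add' m m' := by
    simp [pair, base]; ring

theorem reeb_apply (β : Fin 2 → ℝ) (m : dualMonoid P) :
    reeb P β m = 2 * (m.1 2 + pair (base m.1) β) := rfl

theorem reeb_coneMap_inl (h : IsPolygonData P A B) (β : Fin 2 → ℝ) (n : ℕ) :
    reeb P β (h.coneMap (Sum.inl n)) = 2 * n := by
  rw [reeb_apply]
  simp only [coneMap]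
  rw [base_liftInt, liftInt_two]
  simp [pair]

theorem reeb_coneMap_inr (h : IsPolygonData P A B) (β : Fin 2 → ℝ) (u : {u // u ∈ B})
    (n b c : ℕ) : reeb P β (h.coneMap (Sum.inr (u, n, b, c))) =
      2 * n + ((2 * rho β u) * ((b + 1 : ℕ) : ℝ) + 2 * rho β (IsDualPair.next A B u) * c) := by
  rw [reeb_apply]
  simp only [coneMap]
  rw [base_liftInt, liftInt_two]
  simp only [pair, rho, Pi.add_apply, Pi.smul_apply, smul_eq_mul]
  push_cast
  ring

/-- The Hilbert series of the toric Calabi-Yau 3-fold. -/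
noncomputable def hilbertFn (A B : Finset (Fin 2 → ℤ)) (β : Fin 2 → ℝ) (t : ℝ) : ℝ :=
  (1 - t ^ (2 : ℝ))⁻¹ * (1 + ∑ u ∈ B, t ^ (2 * rho β u) * ((1 - t ^ (2 * rho β u))⁻¹ *
    (1 - t ^ (2 * rho β (IsDualPair.next A B u)))⁻¹))

theorem hasSum_rpow {t R : ℝ} (ht : t ∈ Set.Ioo (0 : ℝ) 1) (hR : 0 < R) :
    HasSum (fun n : ℕ => (t ^ R) ^ n) (1 - t ^ R)⁻¹ :=
  hasSum_geometric_of_lt_one (Real.rpow_nonneg ht.1.le _) (Real.rpow_lt_one ht.1.le ht.2 hR)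

theorem hasSum_reeb (h : IsPolygonData P A B) {β : Fin 2 → ℝ} (hβ : ∀ u ∈ B, 0 < rho β u) {t : ℝ}
    (ht : t ∈ Set.Ioo (0 : ℝ) 1) :
    HasSum (fun m : dualMonoid P => t ^ reeb P β m) (hilbertFn A B β t) := by
  have hF := h.isDualPair.isSmoothFan
  rw [← (Equiv.ofBijective _ h.coneMap_bijective).hasSum_iff]
  have hg := fun R (hR : 0 < R) => hasSum_rpow ht hR
  have hnn : ∀ R : ℝ, ∀ n : ℕ, 0 ≤ (t ^ R) ^ n := fun R n =>
    pow_nonneg (Real.rpow_nonneg ht.1.le _) _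
  have e : hilbertFn A B β t = (1 - t ^ (2 : ℝ))⁻¹ + ∑ u : {u // u ∈ B}, (1 - t ^ (2 : ℝ))⁻¹ *
      (t ^ (2 * rho β u) * ((1 - t ^ (2 * rho β u))⁻¹ *
      (1 - t ^ (2 * rho β (IsDualPair.next A B u)))⁻¹)) := by
    rw [hilbertFn, mul_add, mul_one, Finset.mul_sum, ← Finset.sum_attach B]
    rfl
  rw [e]
  refine HasSum.sum ?_ ?_
  · refine (hg 2 two_pos).congr_fun fun n => ?_
    simp only [Function.comp_apply, Equiv.ofBijective_apply]
    rw [reeb_coneMap_inl, Real.rpow_mul ht.1.le, Real.rpow_natCast]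
  · have hfib : ∀ u : {u // u ∈ B}, HasSum (fun x : ℕ × (ℕ × ℕ) => (t ^ (2 : ℝ)) ^ x.1 *
        (t ^ (2 * rho β u) * ((t ^ (2 * rho β u)) ^ x.2.1 *
          (t ^ (2 * rho β (IsDualPair.next A B u))) ^ x.2.2)))
        ((1 - t ^ (2 : ℝ))⁻¹ * (t ^ (2 * rho β u) * ((1 - t ^ (2 * rho β u))⁻¹ *
          (1 - t ^ (2 * rho β (IsDualPair.next A B u)))⁻¹))) := by
      intro u
      have g1 := hg (2 * rho β u) (by linarith [hβ _ u.2])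
      have g2 := hg (2 * rho β (IsDualPair.next A B u)) (by linarith [hβ _ (hF.maps _ u.2)])
      have g3 := (g1.mul g2 (g1.summable.mul_of_nonneg g2.summable (hnn _) (hnn _))).mul_left
        (t ^ (2 * rho β u))
      refine (hg 2 two_pos).mul g3 ((hg 2 two_pos).summable.mul_of_nonneg g3.summable (hnn _) ?_)
      intro x
      exact mul_nonneg (Real.rpow_nonneg ht.1.le _) (mul_nonneg (hnn _ _) (hnn _ _))
    have hval : ∀ (u : {u // u ∈ B}) (x : ℕ × (ℕ × ℕ)),
        t ^ reeb P β (h.coneMap (Sum.inr (u, x))) = (t ^ (2 : ℝ)) ^ x.1 *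
        (t ^ (2 * rho β u) * ((t ^ (2 * rho β u)) ^ x.2.1 *
          (t ^ (2 * rho β (IsDualPair.next A B u))) ^ x.2.2)) := by
      rintro u ⟨n, b, c⟩
      rw [reeb_coneMap_inr, Real.rpow_add ht.1, Real.rpow_add ht.1, Real.rpow_mul ht.1.le,
        Real.rpow_mul ht.1.le (2 * rho β u), Real.rpow_mul ht.1.le (2 * rho β _), Real.rpow_natCast,
        Real.rpow_natCast, Real.rpow_natCast, pow_succ']
      ring
    have hfun : ((fun m : dualMonoid P => t ^ reeb P β m) ∘
        ⇑(Equiv.ofBijective _ h.coneMap_bijective)) ∘ Sum.inr = fun p : {u // u ∈ B} × (ℕ × (ℕ × ℕ))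
        => t ^ reeb P β (h.coneMap (Sum.inr (p.1, p.2))) := rfl
    rw [hfun]
    simp only [hval]
    have hs : Summable fun p : {u // u ∈ B} × (ℕ × (ℕ × ℕ)) => (t ^ (2 : ℝ)) ^ p.2.1 *
        (t ^ (2 * rho β p.1) * ((t ^ (2 * rho β p.1)) ^ p.2.2.1 *
          (t ^ (2 * rho β (IsDualPair.next A B p.1))) ^ p.2.2.2)) := by
      refine (summable_prod_of_nonneg ?_).2 ⟨fun u => (hfib u).summable, Summable.of_finite⟩
      intro p
      exact mul_nonneg (hnn _ _) (mul_nonneg (Real.rpow_nonneg ht.1.le _)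
        (mul_nonneg (hnn _ _) (hnn _ _)))
    have h1 := hs.hasSum.prod_fiberwise hfib
    rw [← h1.unique (hasSum_fintype _)]
    exact hs.hasSum

/-! ### The weights of the test symmetries -/

theorem exists_weight_eq (h : IsPolygonData P A B) (m : dualMonoid P) :
    ∃ a : Generator P →₀ ℕ, Finsupp.weight (fun h : Generator P => h.1) a = m := by
  induction hk : (m.1 2).toNat using Nat.strong_induction_on generalizing m with
  | _ k ih =>
    by_cases h0 : m = 0
    · exact ⟨0, by rw [map_zero, h0]⟩
    by_cases hg : IsGenerator P m
    · exact ⟨Finsupp.single ⟨m, hg⟩ 1, by rw [Finsupp.weight_single, one_smul]⟩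
    · have : ∃ a b : dualMonoid P, m = a + b ∧ a ≠ 0 ∧ b ≠ 0 := by
        by_contra! hc
        refine hg ⟨h0, fun a b e => ?_⟩
        by_cases ha : a = 0
        · exact Or.inl ha
        · exact Or.inr (hc a b e ha)
      obtain ⟨a, b, e, ha, hb⟩ := this
      have h1 := h.height_pos ha
      have h2 := h.height_pos hb
      have h3 : m.1 2 = a.1 2 + b.1 2 := by rw [e]; rfl
      obtain ⟨x, hx⟩ := ih (a.1 2).toNat (by omega) a rfl
      obtain ⟨y, hy⟩ := ih (b.1 2).toNat (by omega) b rfl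
      exact ⟨x + y, by rw [map_add, hx, hy, e]⟩

open Classical in
/-- The largest multiple of `x` that can be subtracted from `m`. -/
noncomputable def maxMultiple (x m : dualMonoid P) : ℕ :=
  Nat.findGreatest (fun k => ∃ m' : dualMonoid P, m = m' + k • x) (m.1 2).toNat

/-- Heights are nonnegative and x has positive height, so k cannot exceed the search bound;
subtractability passes to smaller k. -/
theorem le_maxMultiple_iff (h : IsPolygonData P A B) {x : dualMonoid P} (hx : x ≠ 0)
    (m : dualMonoid P) (k : ℕ) :
    k ≤ maxMultiple x m ↔ ∃ m' : dualMonoid P, m = m' + k • x := by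
  classical
  constructor
  · intro hk
    have h0 : ∃ m' : dualMonoid P, m = m' + 0 • x := ⟨m, by simp⟩
    obtain ⟨m', hm'⟩ := Nat.findGreatest_spec (P := fun k => ∃ m' : dualMonoid P, m = m' + k • x)
      (Nat.zero_le (m.1 2).toNat) h0
    refine ⟨m' + (maxMultiple x m - k) • x, ?_⟩
    rw [add_assoc, ← add_smul, Nat.sub_add_cancel hk]
    exact hm'
  · rintro ⟨m', hm'⟩
    refine Nat.le_findGreatest ?_ ⟨m', hm'⟩
    have h1 := h.height_nonneg m'
    have h2 := h.height_pos hx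
    have h3 : m.1 2 = m'.1 2 + k * x.1 2 := by rw [hm']; simp
    have : (k : ℤ) ≤ m.1 2 := by nlinarith
    omega

theorem maxMultiple_add (h : IsPolygonData P A B) {x : dualMonoid P} (hx : x ≠ 0)
    (m : dualMonoid P) (k : ℕ) : maxMultiple x (m + k • x) = maxMultiple x m + k := by
  apply le_antisymm
  · obtain ⟨m', hm'⟩ := (h.le_maxMultiple_iff hx (m + k • x) _).1 le_rfl
    rcases le_total (maxMultiple x (m + k • x)) k with hk | hk
    · omega
    · have : maxMultiple x (m + k • x) - k ≤ maxMultiple x m := by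
        rw [h.le_maxMultiple_iff hx]
        refine ⟨m', ?_⟩
        rw [← Nat.sub_add_cancel hk, add_smul, ← add_assoc] at hm'
        exact add_right_cancel hm'
      omega
  · obtain ⟨m', hm'⟩ := (h.le_maxMultiple_iff hx m _).1 le_rfl
    rw [h.le_maxMultiple_iff hx]
    refine ⟨m', ?_⟩
    rw [add_smul, ← add_assoc, ← hm']

theorem weight_testSymmetry {ι : Type} (i : ι) (a : ι →₀ ℕ) :
    Finsupp.weight (testSymmetry i) a = a i := by
  classical
  rw [Finsupp.weight_apply, Finsupp.sum]
  simp only [testSymmetry, smul_eq_mul]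
  by_cases hi : i ∈ a.support
  · rw [Finset.sum_eq_single_of_mem i hi]
    · simp
    · intro b _ hb
      simp [hb]
  · rw [Finsupp.notMem_support_iff.1 hi]
    refine Finset.sum_eq_zero fun b hb => ?_
    have : b ≠ i := fun e => hi (e ▸ hb)
    simp [this]

theorem generator_ne_zero (x : Generator P) : x.1 ≠ 0 := x.2.1

/-- The weight of a monomial is its exponent at x. The maximum is attained by writing m minus the
largest multiple of x in generators. -/
theorem isMaxWeight (h : IsPolygonData P A B) (x : Generator P) :
    IsMaxWeight (fun h : Generator P => h.1) (testSymmetry x) (maxMultiple x.1) := by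
  have hle : ∀ a : Generator P →₀ ℕ,
      a x ≤ maxMultiple x.1 (Finsupp.weight (fun h : Generator P => h.1) a) := by
    intro a
    rw [h.le_maxMultiple_iff (generator_ne_zero x)]
    refine ⟨Finsupp.weight (fun h : Generator P => h.1) (a.erase x), ?_⟩
    nth_rewrite 1 [← Finsupp.erase_add_single x a]
    rw [map_add, Finsupp.weight_single]
  refine ⟨fun a => by rw [weight_testSymmetry]; exact hle a, fun m => ?_⟩
  obtain ⟨m', hm'⟩ := (h.le_maxMultiple_iff (generator_ne_zero x) m _).1 le_rfl
  obtain ⟨a, ha⟩ := h.exists_weight_eq m'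
  have e : Finsupp.weight (fun h : Generator P => h.1)
      (a + Finsupp.single x (maxMultiple x.1 m)) = m := by
    rw [map_add, Finsupp.weight_single, ha]
    exact hm'.symm
  refine ⟨_, e, ?_⟩
  have h1 := hle (a + Finsupp.single x (maxMultiple x.1 m))
  rw [e] at h1
  rw [weight_testSymmetry]
  refine le_antisymm h1 ?_
  simp

/-- Unique writing m = m₀ + k x with m₀ not divisible by x factors the series. Shifting the charge
of x by ε only replaces one geometric factor. -/
theorem hasSum_maxMultiple (h : IsPolygonData P A B) {x : dualMonoid P} (hx : x ≠ 0)
    (ξ : dualMonoid P →+ ℝ) (hξ : 0 < ξ x) {ε : ℝ} (hε : 0 < ξ x + ε) {t G : ℝ}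
    (ht : t ∈ Set.Ioo (0 : ℝ) 1) (hG : HasSum (fun m => t ^ ξ m) G) :
    HasSum (fun m => t ^ (ξ m + ε * maxMultiple x m))
      (G * (1 - t ^ ξ x) * (1 - t ^ (ξ x + ε))⁻¹) := by
  set T := {m : dualMonoid P // maxMultiple x m = 0}
  have hbij : Function.Bijective fun p : T × ℕ => p.1.1 + p.2 • x := by
    constructor
    · rintro ⟨⟨m, hm⟩, k⟩ ⟨⟨m', hm'⟩, k'⟩ e
      have h1 := congrArg (maxMultiple x) e
      simp only [h.maxMultiple_add hx, hm, hm', zero_add] at h1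
      subst h1
      have := add_right_cancel e
      simp only at this
      subst this
      rfl
    · intro m
      obtain ⟨m', hm'⟩ := (h.le_maxMultiple_iff hx m _).1 le_rfl
      refine ⟨⟨⟨m', ?_⟩, maxMultiple x m⟩, hm'.symm⟩
      have h1 := h.maxMultiple_add hx m' (maxMultiple x m)
      rw [← hm'] at h1
      omega
  have key : ∀ δ : ℝ, 0 < ξ x + δ → HasSum (fun m => t ^ (ξ m + δ * maxMultiple x m))
      ((∑' m : T, t ^ ξ m.1) * (1 - t ^ (ξ x + δ))⁻¹) := by
    intro δ hδ
    rw [← (Equiv.ofBijective _ hbij).hasSum_iff]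
    have hT : HasSum (fun m : T => t ^ ξ m.1) (∑' m : T, t ^ ξ m.1) :=
      (hG.summable.subtype _).hasSum
    have hg := hasSum_rpow ht hδ
    have := hT.mul hg (hT.summable.mul_of_nonneg hg.summable
      (fun _ => Real.rpow_nonneg ht.1.le _) fun _ => pow_nonneg (Real.rpow_nonneg ht.1.le _) _)
    refine this.congr_fun fun p => ?_
    obtain ⟨⟨m, hm⟩, k⟩ := p
    simp only [Function.comp_apply, Equiv.ofBijective_apply]
    rw [h.maxMultiple_add hx, hm, map_add, map_nsmul, nsmul_eq_mul, ← Real.rpow_natCast,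
      ← Real.rpow_mul ht.1.le, ← Real.rpow_add ht.1]
    congr 1
    push_cast
    ring
  -- The case δ = 0 identifies the sum over indivisible elements as G (1 - t^ξ(x)).
  have h0 := key 0 (by rwa [add_zero])
  simp only [zero_mul, add_zero] at h0
  have hne : 1 - t ^ ξ x ≠ 0 := (sub_pos.2 (Real.rpow_lt_one ht.1.le ht.2 hξ)).ne'
  rw [hG.unique h0, inv_mul_cancel_right₀ hne]
  exact key ε hε

theorem weight_eq_add {ι M : Type} [AddCommMonoid M] (γ : ι → M) (ξ : M →+ ℝ) (η : ι → ℕ) (ε : ℝ)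
    (a : ι →₀ ℕ) : Finsupp.weight (fun i => ξ (γ i) + ε * (η i : ℝ)) a =
      ξ (Finsupp.weight γ a) + ε * (Finsupp.weight η a : ℕ) := by
  induction a using Finsupp.induction_linear with
  | zero => simp
  | add f g hf hg => rw [map_add, hf, hg, map_add, map_add, map_add]; push_cast; ring
  | single i n => simp [Finsupp.weight_single]; ring

theorem isHilbertSeries_toricIdeal (h : IsPolygonData P A B) {β : Fin 2 → ℝ}
    (hβ : ∀ u ∈ B, 0 < rho β u) :
    IsHilbertSeries (toricIdeal P) (fun x => reeb P β x.1) (hilbertFn A B β) := by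
  have h1 := isNormalIdeal_ker h.exists_weight_eq
  refine h1.isHilbertSeries (wt := reeb P β) (fun a _ => ?_) fun t ht => h.hasSum_reeb hβ ht
  have := weight_eq_add (fun h : Generator P => h.1) (reeb P β) 0 0 a
  simpa using this

theorem isHilbertSeries_centralFibreIdeal (h : IsPolygonData P A B) {β : Fin 2 → ℝ}
    (hβ : ∀ u ∈ B, 0 < rho β u) (x : Generator P) {ε : ℝ} (hx : 0 < reeb P β x.1)
    (hε : 0 < reeb P β x.1 + ε) :
    IsHilbertSeries (centralFibreIdeal (toricIdeal P) (testSymmetry x))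
      (fun y => reeb P β y.1 + ε * (testSymmetry x y : ℝ))
      fun t => hilbertFn A B β t * (1 - t ^ reeb P β x.1) * (1 - t ^ (reeb P β x.1 + ε))⁻¹ := by
  have h1 := isNormalIdeal_centralFibreIdeal (h.isMaxWeight x)
  refine h1.isHilbertSeries (wt := fun m => reeb P β m + ε * maxMultiple x.1 m) (fun a ha => ?_)
    fun t ht => h.hasSum_maxMultiple (generator_ne_zero x) _ hx hε ht (h.hasSum_reeb hβ ht)
  rw [weight_eq_add (fun h : Generator P => h.1) (reeb P β) (testSymmetry x) ε a, ha]

end IsPolygonData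

/-! ### First order expansions -/

/-- `f s = a + b s + O(s²)` as `s → 0⁺`. -/
def HasExpansion (f : ℝ → ℝ) (a b : ℝ) : Prop :=
  (fun s => f s - (a + b * s)) =O[𝓝[>] (0 : ℝ)] fun s => s ^ 2

namespace HasExpansion

variable {f g : ℝ → ℝ} {a b c d : ℝ}

theorem congr (h : HasExpansion f a b) (e : f =ᶠ[𝓝[>] 0] g) : HasExpansion g a b :=
  IsBigO.congr' h (by filter_upwards [e] with s hs; rw [hs]) EventuallyEq.rfl

theorem of_eq (h : HasExpansion f a b) (ha : a = c) (hb : b = d) : HasExpansion f c d := by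
  rwa [← ha, ← hb]

theorem affine (a b : ℝ) : HasExpansion (fun s => a + b * s) a b := by
  simp only [HasExpansion, sub_self]
  exact isBigO_zero _ _

theorem sq : HasExpansion (fun s => s ^ 2) 0 0 := by
  simp only [HasExpansion, zero_mul, add_zero, sub_zero]
  exact isBigO_refl _ _

theorem add (hf : HasExpansion f a b) (hg : HasExpansion g c d) :
    HasExpansion (fun s => f s + g s) (a + c) (b + d) := by
  refine (IsBigO.add hf hg).congr_left fun s => ?_
  ring

theorem sum {ι : Type*} {S : Finset ι} {F : ι → ℝ → ℝ} {p q : ι → ℝ}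
    (h : ∀ i ∈ S, HasExpansion (F i) (p i) (q i)) :
    HasExpansion (fun s => ∑ i ∈ S, F i s) (∑ i ∈ S, p i) (∑ i ∈ S, q i) := by
  refine (IsBigO.sum h).congr_left fun s => ?_
  simp only [Finset.sum_apply, Finset.sum_sub_distrib, Finset.sum_add_distrib, Finset.sum_mul]

theorem tendsto (h : HasExpansion f a b) : Tendsto f (𝓝[>] 0) (𝓝 a) := by
  have hs : Tendsto (fun s : ℝ => s ^ 2) (𝓝[>] 0) (𝓝 0) := by
    have : ContinuousAt (fun s : ℝ => s ^ 2) 0 := by fun_prop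
    simpa using this.tendsto.mono_left nhdsWithin_le_nhds
  have h1 := IsBigO.trans_tendsto h hs
  have h2 : Tendsto (fun s : ℝ => a + b * s) (𝓝[>] 0) (𝓝 a) := by
    have : ContinuousAt (fun s : ℝ => a + b * s) 0 := by fun_prop
    simpa using this.tendsto.mono_left nhdsWithin_le_nhds
  simpa using h1.add h2

theorem unique (h : HasExpansion f a b) (h' : HasExpansion f c d) : a = c ∧ b = d := by
  have e := tendsto_nhds_unique h.tendsto h'.tendsto
  subst e
  refine ⟨rfl, ?_⟩
  have h1 : (fun s : ℝ => (b - d) * s) =O[𝓝[>] (0 : ℝ)] fun s => s ^ 2 := by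
    refine (IsBigO.sub h' h).congr_left fun s => ?_
    ring
  have h2 : (fun _ : ℝ => b - d) =O[𝓝[>] (0 : ℝ)] fun s => s := by
    refine (h1.mul (isBigO_refl (fun s : ℝ => s⁻¹) _)).congr' ?_ ?_
    · filter_upwards [self_mem_nhdsWithin] with s hs
      have : s ≠ 0 := (Set.mem_Ioi.1 hs).ne'
      field_simp
    · filter_upwards [self_mem_nhdsWithin] with s hs
      have : s ≠ 0 := (Set.mem_Ioi.1 hs).ne'
      field_simp
  have h3 := h2.trans_tendsto (tendsto_id.mono_left nhdsWithin_le_nhds)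
  have := tendsto_nhds_unique h3 tendsto_const_nhds
  linarith

theorem mul (hf : HasExpansion f a b) (hg : HasExpansion g c d) :
    HasExpansion (fun s => f s * g s) (a * c) (a * d + b * c) := by
  have h1 := IsBigO.mul hf (hg.tendsto.isBigO_one ℝ)
  have hA : (fun s : ℝ => a + b * s) =O[𝓝[>] (0 : ℝ)] fun _ => (1 : ℝ) :=
    (affine a b).tendsto.isBigO_one ℝ
  have h2 := hA.mul hg
  have h3 : (fun s : ℝ => b * d * s ^ 2) =O[𝓝[>] (0 : ℝ)] fun s => s ^ 2 :=
    (isBigO_refl _ _).const_mul_left _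
  simp only [mul_one, one_mul] at h1 h2
  refine ((h1.add h2).add h3).congr_left fun s => ?_
  ring

theorem inv (hf : HasExpansion f a b) (ha : a ≠ 0) :
    HasExpansion (fun s => (f s)⁻¹) a⁻¹ (-b / a ^ 2) := by
  have h1 := (hf.mul (affine a⁻¹ (-b / a ^ 2))).of_eq (c := 1) (d := 0) (by field_simp)
    (by field_simp; ring)
  have h2 := IsBigO.mul ((hf.tendsto.inv₀ ha).isBigO_one ℝ) h1
  simp only [one_mul] at h2
  refine h2.neg_left.congr' ?_ EventuallyEq.rfl
  filter_upwards [hf.tendsto.eventually_ne ha] with s hs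
  field_simp
  ring

theorem exp_neg (R : ℝ) : HasExpansion (fun s => Real.exp (-s) ^ R) 1 (-R) := by
  have h0 : Tendsto (fun s : ℝ => -s * R) (𝓝[>] 0) (𝓝 0) := by
    have : ContinuousAt (fun s : ℝ => -s * R) 0 := by fun_prop
    simpa using this.tendsto.mono_left nhdsWithin_le_nhds
  have h1 := (Real.exp_sub_sum_range_isBigO_pow 2).comp_tendsto h0
  have h2 : ((fun x : ℝ => x ^ 2) ∘ fun s : ℝ => -s * R) =O[𝓝[>] (0 : ℝ)] fun s : ℝ => s ^ 2 := by
    refine ((isBigO_refl (fun s : ℝ => s ^ 2) _).const_mul_left (R ^ 2)).congr_left fun s => ?_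
    simp only [Function.comp_apply]; ring
  refine (h1.trans h2).congr_left fun s => ?_
  simp only [Function.comp_apply, Finset.sum_range_succ, Finset.sum_range_zero, Real.exp_mul]
  norm_num
  ring

theorem one_sub_exp_div (R : ℝ) :
    HasExpansion (fun s => (1 - Real.exp (-s) ^ R) / s) R (-R ^ 2 / 2) := by
  have h0 : Tendsto (fun s : ℝ => -s * R) (𝓝[>] 0) (𝓝 0) := by
    have : ContinuousAt (fun s : ℝ => -s * R) 0 := by fun_prop
    simpa using this.tendsto.mono_left nhdsWithin_le_nhds
  have h1 := (Real.exp_sub_sum_range_isBigO_pow 3).comp_tendsto h0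
  have h2 : ((fun x : ℝ => x ^ 3) ∘ fun s : ℝ => -s * R) =O[𝓝[>] (0 : ℝ)] fun s : ℝ => s ^ 3 := by
    refine ((isBigO_refl (fun s : ℝ => s ^ 3) _).const_mul_left (-R ^ 3)).congr_left fun s => ?_
    simp only [Function.comp_apply]; ring
  refine ((h1.trans h2).mul (isBigO_refl (fun s : ℝ => s⁻¹) _)).neg_left.congr' ?_ ?_
  · filter_upwards [self_mem_nhdsWithin] with s hs
    have : s ≠ 0 := (Set.mem_Ioi.1 hs).ne'
    simp only [Function.comp_apply, Finset.sum_range_succ, Finset.sum_range_zero, Real.exp_mul]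
    norm_num [Nat.factorial]
    field_simp
    ring
  · filter_upwards [self_mem_nhdsWithin] with s hs
    have : s ≠ 0 := (Set.mem_Ioi.1 hs).ne'
    field_simp

theorem div_one_sub_exp {R : ℝ} (hR : 0 < R) :
    HasExpansion (fun s => s * (1 - Real.exp (-s) ^ R)⁻¹) (1 / R) (1 / 2) := by
  refine (((one_sub_exp_div R).inv hR.ne').of_eq (by simp) (by field_simp)).congr ?_
  filter_upwards with s
  rw [inv_div, div_eq_mul_inv]

end HasExpansion

theorem hasExpansion_iff_isBigO {g : ℝ → ℝ} {A₀ A₁ : ℝ} :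
    HasExpansion (fun s => s ^ 3 * g (Real.exp (-s))) (2 * A₀) A₁ ↔
      (fun s : ℝ => g (Real.exp (-s)) - (2 * A₀ / s ^ 3 + A₁ / s ^ 2))
        =O[𝓝[>] (0 : ℝ)] (fun s : ℝ => 1 / s) := by
  constructor
  · intro h
    refine (IsBigO.mul h (isBigO_refl (fun s : ℝ => (s ^ 3)⁻¹) _)).congr' ?_ ?_
    all_goals
      filter_upwards [self_mem_nhdsWithin] with s hs
      have : s ≠ 0 := (Set.mem_Ioi.1 hs).ne'
      field_simp
  · intro h
    refine (IsBigO.mul h (isBigO_refl (fun s : ℝ => s ^ 3) _)).congr' ?_ ?_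
    all_goals
      filter_upwards [self_mem_nhdsWithin] with s hs
      have : s ≠ 0 := (Set.mem_Ioi.1 hs).ne'
      field_simp

/-! ### Uniqueness of Laurent coefficients and the Futaki formula. -/

section Uniqueness

variable {ι : Type} {J : Ideal (MvPolynomial ι ℂ)} {w : ι → ℝ}

theorem IsHilbertSeries.eventuallyEq {g g' : ℝ → ℝ} (h : IsHilbertSeries J w g)
    (h' : IsHilbertSeries J w g') :
    (fun s : ℝ => s ^ 3 * g (Real.exp (-s))) =ᶠ[𝓝[>] 0] fun s => s ^ 3 * g' (Real.exp (-s)) := by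
  filter_upwards [self_mem_nhdsWithin] with s hs
  have ht : Real.exp (-s) ∈ Set.Ioo (0 : ℝ) 1 :=
    ⟨Real.exp_pos _, by rw [Real.exp_lt_one_iff]; exact neg_lt_zero.2 hs⟩
  rw [(h.2 _ ht).unique (h'.2 _ ht)]

theorem IsHilbertSeries.hasLaurentCoefficients_iff {g : ℝ → ℝ} (h : IsHilbertSeries J w g)
    {A₀ A₁ : ℝ} : HasLaurentCoefficients J w A₀ A₁ ↔
      HasExpansion (fun s => s ^ 3 * g (Real.exp (-s))) (2 * A₀) A₁ := by
  constructor
  · rintro ⟨g', hg', h1⟩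
    exact (hasExpansion_iff_isBigO.2 h1).congr (hg'.eventuallyEq h)
  · intro h1
    exact ⟨g, h, hasExpansion_iff_isBigO.1 h1⟩

theorem HasLaurentCoefficients.unique {A₀ A₁ A₀' A₁' : ℝ} (h : HasLaurentCoefficients J w A₀ A₁)
    (h' : HasLaurentCoefficients J w A₀' A₁') : A₀ = A₀' ∧ A₁ = A₁' := by
  obtain ⟨g, hg, h1⟩ := h
  have h2 := hg.hasLaurentCoefficients_iff.1 h'
  obtain ⟨e1, e2⟩ := (hasExpansion_iff_isBigO.2 h1).unique h2
  exact ⟨by linarith, e2⟩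

/-- The Futaki invariant for explicit expansions of the Hilbert series. -/
theorem isFutakiInvariant_iff {I : Ideal (MvPolynomial ι ℂ)} {q : ι → ℝ} {η : ι → ℕ} {a R F : ℝ}
    (ha : a ≠ 0) (hR : 0 < R) (h : HasLaurentCoefficients I q a (2 * a))
    (hc : ∀ ε : ℝ, 0 < R + ε → HasLaurentCoefficients (centralFibreIdeal I η)
      (fun i => q i + ε * (η i : ℝ)) (a * (R / (R + ε))) (R / (R + ε) * (2 * a + a * ε))) :
    IsFutakiInvariant I q η F ↔ F = a * (1 / 2 - 1 / (3 * R)) := by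
  have hev : ∀ᶠ ε in 𝓝 (0 : ℝ), 0 < R + ε := by
    have : ContinuousAt (fun ε : ℝ => R + ε) 0 := by fun_prop
    exact this.tendsto.eventually_const_lt (by simpa using hR)
  have hD0 : HasDerivAt (fun ε => a * (R / (R + ε))) (-a / R) 0 := by
    have h1 := ((hasDerivAt_id (0 : ℝ)).const_add R).inv (by simpa using hR.ne')
    have h2 := h1.const_mul (a * R)
    refine (h2.congr_deriv ?_).congr_of_eventuallyEq ?_
    · simp; field_simp
    · filter_upwards with ε
      simp [div_eq_mul_inv]; ring
  have hD : HasDerivAt (fun ε => R / (R + ε) * (2 * a + a * ε) / (a * (R / (R + ε)))) 1 0 := by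
    have h1 := (hasDerivAt_id (0 : ℝ)).const_add 2
    refine h1.congr_of_eventuallyEq ?_
    filter_upwards [hev] with ε hε
    simp only [id]
    field_simp
  constructor
  · rintro ⟨a₀, a₁, A₀, A₁, D, D₀, h1, -, h2, h3, h4, rfl⟩
    obtain ⟨rfl, rfl⟩ := h1.unique h
    have e : ∀ᶠ ε in 𝓝 (0 : ℝ), A₀ ε = a₀ * (R / (R + ε)) ∧
        A₁ ε = R / (R + ε) * (2 * a₀ + a₀ * ε) := by
      filter_upwards [h2, hev] with ε hε hpos
      exact hε.unique (hc ε hpos)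
    have e0 := h4.unique (hD0.congr_of_eventuallyEq (e.mono fun ε h => h.1))
    have e1 := h3.unique (hD.congr_of_eventuallyEq (e.mono fun ε h => by simp only [h.1, h.2]))
    rw [e0, e1]
    field_simp
    ring
  · rintro rfl
    refine ⟨a, 2 * a, _, _, _, _, h, ha, hev.mono hc, hD, hD0, ?_⟩
    field_simp
    ring

end Uniqueness

/-! ### Laurent coefficients of the 3-fold and of its central fibres. -/

namespace IsPolygonData

variable {P : Set (Fin 2 → ℝ)} {A B : Finset (Fin 2 → ℤ)}

/-- The second-order terms 1/ρ_u - 1/ρ_{N u} cancel around the cycle, which is why A₁ = 2 A₀. -/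
theorem hasExpansion_hilbertFn (h : IsPolygonData P A B) {β : Fin 2 → ℝ}
    (hβ : ∀ u ∈ B, 0 < rho β u) :
    HasExpansion (fun s => s ^ 3 * hilbertFn A B β (Real.exp (-s)))
      (2 * (dualArea B (IsDualPair.next A B) β / 16))
      (2 * (dualArea B (IsDualPair.next A B) β / 16)) := by
  have hF := h.isDualPair.isSmoothFan
  have hterm : ∀ u ∈ B, HasExpansion (fun s => Real.exp (-s) ^ (2 * rho β u) *
      ((s * (1 - Real.exp (-s) ^ (2 * rho β u))⁻¹) *
        (s * (1 - Real.exp (-s) ^ (2 * rho β (IsDualPair.next A B u)))⁻¹)))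
      (1 / (rho β u * rho β (IsDualPair.next A B u)) / 4)
      (1 / rho β u / 4 - 1 / rho β (IsDualPair.next A B u) / 4) := by
    intro u hu
    have h1 := hβ u hu
    have h2 := hβ _ (hF.maps u hu)
    refine ((HasExpansion.exp_neg (2 * rho β u)).mul
      ((HasExpansion.div_one_sub_exp (by linarith : 0 < 2 * rho β u)).mul
        (HasExpansion.div_one_sub_exp
          (by linarith : 0 < 2 * rho β (IsDualPair.next A B u))))).of_eq ?_ ?_
    · field_simp; norm_num
    · field_simp; ring
  have hsum := HasExpansion.sum hterm
  rw [Finset.sum_sub_distrib, hF.sum_next (fun u => 1 / rho β u / 4), sub_self,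
    ← Finset.sum_div] at hsum
  refine (((HasExpansion.div_one_sub_exp two_pos).mul (HasExpansion.sq.add hsum)).of_eq ?_ ?_).congr
    ?_
  · rw [dualArea]; ring
  · rw [dualArea]; ring
  · filter_upwards with s
    simp only [hilbertFn, mul_add, Finset.mul_sum]
    congr 1
    · ring
    · exact Finset.sum_congr rfl fun u _ => by ring

theorem hasLaurentCoefficients_toricIdeal (h : IsPolygonData P A B) {β : Fin 2 → ℝ}
    (hβ : ∀ u ∈ B, 0 < rho β u) :
    HasLaurentCoefficients (toricIdeal P) (fun x => reeb P β x.1)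
      (dualArea B (IsDualPair.next A B) β / 16)
      (2 * (dualArea B (IsDualPair.next A B) β / 16)) :=
  (h.isHilbertSeries_toricIdeal hβ).hasLaurentCoefficients_iff.2 (h.hasExpansion_hilbertFn hβ)

theorem hasLaurentCoefficients_centralFibreIdeal (h : IsPolygonData P A B) {β : Fin 2 → ℝ}
    (hβ : ∀ u ∈ B, 0 < rho β u) (x : Generator P) (hx : 0 < reeb P β x.1) {ε : ℝ}
    (hε : 0 < reeb P β x.1 + ε) :
    HasLaurentCoefficients (centralFibreIdeal (toricIdeal P) (testSymmetry x))
      (fun y => reeb P β y.1 + ε * (testSymmetry x y : ℝ))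
      (dualArea B (IsDualPair.next A B) β / 16 * (reeb P β x.1 / (reeb P β x.1 + ε)))
      (reeb P β x.1 / (reeb P β x.1 + ε) * (2 * (dualArea B (IsDualPair.next A B) β / 16) +
        dualArea B (IsDualPair.next A B) β / 16 * ε)) := by
  rw [(h.isHilbertSeries_centralFibreIdeal hβ x hx hε).hasLaurentCoefficients_iff]
  refine (((h.hasExpansion_hilbertFn hβ).mul ((HasExpansion.one_sub_exp_div (reeb P β x.1)).mul
    (HasExpansion.div_one_sub_exp hε))).of_eq ?_ ?_).congr ?_
  · field_simp
  · field_simp; ring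
  · filter_upwards [self_mem_nhdsWithin] with s hs
    have : s ≠ 0 := (Set.mem_Ioi.1 hs).ne'
    field_simp

end IsPolygonData

/-! ### Minima of the dual area -/

namespace IsDualPair

variable {A B : Finset (Fin 2 → ℤ)}

/-- Telescoping identities for the facets seen from a fixed boundary point. -/
theorem sum_facet (hd : IsDualPair A B) {ρ σ : (Fin 2 → ℤ) → ℝ} (hρ : ∀ u ∈ B, 0 < ρ u)
    {β : Fin 2 → ℝ} (hβ : ∀ u, ρ u = rho β u) {γ : Fin 2 → ℝ} (hσ : ∀ u, σ u = pair u γ)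
    (x : Fin 2 → ℤ) :
    ∑ u ∈ B, (1 + dt x (facet A B u) : ℝ) / (ρ u * ρ (next A B u)) =
      ρ x * ∑ u ∈ B, 1 / (ρ u * ρ (next A B u)) ∧
    ∑ u ∈ B, (1 + dt x (facet A B u) : ℝ) * (σ u / ρ u + σ (next A B u) / ρ (next A B u)) /
        (ρ u * ρ (next A B u)) =
      ρ x * ∑ u ∈ B, (σ u / ρ u + σ (next A B u) / ρ (next A B u)) / (ρ u * ρ (next A B u)) -
        σ x * ∑ u ∈ B, 1 / (ρ u * ρ (next A B u)) := by
  have hF := hd.isSmoothFan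
  -- Expand x in the basis (u, N u), on which the facet takes the value -1. After division by ρ_u
  -- ρ_{N u} the right side is a difference of consecutive values of `cr x u / ρ u`.
  have hlin : ∀ u ∈ B, (1 + dt x (facet A B u) : ℝ) - ρ x =
      cr x u * ρ (next A B u) - cr x (next A B u) * ρ u := by
    intro u hu
    obtain ⟨-, a2, -⟩ := hd.facet_spec hu
    simp only [hβ, rho, next, rot, cr, dt, Pi.sub_apply, Matrix.cons_val_zero,
      Matrix.cons_val_one]
    have a2' : (u 0 * facet A B u 0 + u 1 * facet A B u 1 : ℝ) = -1 := by exact_mod_cast a2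
    push_cast
    linear_combination (-x 0 * β 0 - x 1 * β 1 : ℝ) * a2'
  have hlin2 : ∀ u ∈ B, σ x = cr x (next A B u) * σ u - cr x u * σ (next A B u) := by
    intro u hu
    obtain ⟨-, a2, -⟩ := hd.facet_spec hu
    simp only [hσ, pair, next, rot, cr, Pi.sub_apply, Matrix.cons_val_zero,
      Matrix.cons_val_one]
    have a2' : (u 0 * facet A B u 0 + u 1 * facet A B u 1 : ℝ) = -1 := by exact_mod_cast a2
    push_cast
    linear_combination (x 0 * γ 0 + x 1 * γ 1 : ℝ) * a2'
  have t1 := hF.sum_next fun u => (cr x u : ℝ) / ρ u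
  have t2 := hF.sum_next fun u => (cr x u : ℝ) * σ u / ρ u ^ 2
  constructor
  · rw [← sub_eq_zero, Finset.mul_sum, ← Finset.sum_sub_distrib]
    rw [← sub_eq_zero, ← Finset.sum_sub_distrib] at t1
    rw [← neg_zero, ← t1, ← Finset.sum_neg_distrib]
    refine Finset.sum_congr rfl fun u hu => ?_
    have h1 := (hρ u hu).ne'
    have h2 := (hρ _ (hF.maps u hu)).ne'
    field_simp
    linear_combination hlin u hu
  · rw [Finset.mul_sum, Finset.mul_sum, ← sub_eq_zero, ← Finset.sum_sub_distrib,
      ← Finset.sum_sub_distrib]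
    rw [← sub_eq_zero, ← Finset.sum_sub_distrib] at t2
    rw [← neg_zero, ← t2, ← Finset.sum_neg_distrib]
    refine Finset.sum_congr rfl fun u hu => ?_
    have h1 := (hρ u hu).ne'
    have h2 := (hρ _ (hF.maps u hu)).ne'
    field_simp
    linear_combination (σ u * ρ (next A B u) + σ (next A B u) * ρ u) * hlin u hu +
      ρ u * ρ (next A B u) * hlin2 u hu

theorem dualArea_pos (hd : IsDualPair A B) {β : Fin 2 → ℝ} (hβ : ∀ u ∈ B, 0 < rho β u) :
    0 < dualArea B (next A B) β :=
  Finset.sum_pos (fun u hu => one_div_pos.2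
    (mul_pos (hβ u hu) (hβ _ (hd.isSmoothFan.maps u hu)))) hd.isSmoothFan.nonempty

/-- At a minimum of the dual area all the charges are bounded below. -/
theorem two_thirds_le_rho (hd : IsDualPair A B) {β : Fin 2 → ℝ} (hβ : ∀ u ∈ B, 0 < rho β u)
    (hmin : ∀ β', (∀ u ∈ B, 0 < rho β' u) →
      dualArea B (next A B) β ≤ dualArea B (next A B) β') {x : Fin 2 → ℤ} (hx : x ∈ B) :
    2 / 3 ≤ rho β x := by
  have hF := hd.isSmoothFan
  -- A point v of A with ⟨x, v⟩ ≥ 1; the dual area is varied from β in the direction of v.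
  obtain ⟨v, hv, -, -, -, -, -, hxv, -⟩ := hd.flag_left (-x) (neg_ne_zero.2 (hF.ne_zero hx))
  have hxv' : (1 : ℝ) ≤ dt x v := by
    have : dt (-x) v = -dt x v := by simp [dt]; ring
    have : 1 ≤ dt x v := by omega
    exact_mod_cast this
  set γ : Fin 2 → ℝ := latticeToReal v - β with hγ
  have hσ : ∀ u, pair u γ = 1 + dt u v - rho β u := by
    intro u
    simp only [hγ, pair, rho, dt, latticeToReal, Pi.sub_apply]; push_cast; ring
  have hτ : ∀ u ∈ B, -1 ≤ pair u γ / rho β u := by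
    intro u hu
    rw [le_div_iff₀ (hβ u hu), hσ]
    have : (-1 : ℝ) ≤ dt u v := by exact_mod_cast hd.neg_one_le hu hv
    linarith
  have hrho : ∀ (s : ℝ) u, rho (β + s • γ) u = rho β u + s * pair u γ := by
    intro s u
    simp only [rho, pair, Pi.add_apply, Pi.smul_apply, smul_eq_mul]; ring
  have hlin : ∀ u, HasDerivAt (fun s : ℝ => rho (β + s • γ) u) (pair u γ) 0 := by
    intro u
    simp only [hrho]
    simpa using ((hasDerivAt_id (0 : ℝ)).mul_const (pair u γ)).const_add (rho β u)
  have hder : HasDerivAt (fun s : ℝ => dualArea B (next A B) (β + s • γ))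
      (∑ u ∈ B, -((pair u γ / rho β u + pair (next A B u) γ / rho β (next A B u)) /
        (rho β u * rho β (next A B u)))) 0 := by
    refine HasDerivAt.fun_sum fun u hu => ?_
    have h1 := (hβ u hu).ne'
    have h2 := (hβ _ (hF.maps u hu)).ne'
    have := ((hlin u).mul (hlin (next A B u))).inv (by simp [h1, h2])
    simp only [one_div]
    refine this.congr_deriv ?_
    simp only [Pi.mul_apply, zero_smul, add_zero]
    field_simp
  have hloc : IsLocalMin (fun s : ℝ => dualArea B (next A B) (β + s • γ)) 0 := by
    have hev : ∀ᶠ s in 𝓝 (0 : ℝ), ∀ u ∈ B, 0 < rho (β + s • γ) u := by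
      rw [Filter.eventually_all_finset]
      intro u hu
      exact (hlin u).continuousAt.tendsto.eventually_const_lt (by simpa using hβ u hu)
    filter_upwards [hev] with s hs
    simpa using hmin _ hs
  have hG := hloc.hasDerivAt_eq_zero hder
  rw [Finset.sum_neg_distrib, neg_eq_zero] at hG
  obtain ⟨h1, h2⟩ := hd.sum_facet hβ (fun _ => rfl) (σ := fun u => pair u γ) (fun _ => rfl) x
  rw [hG, mul_zero, zero_sub] at h2
  have hw := hd.dualArea_pos hβ
  rw [dualArea] at hw
  set w := ∑ u ∈ B, 1 / (rho β u * rho β (next A B u))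
  -- The centroid bound: the weights 1 + ⟨x, facet⟩ are nonnegative and each σ/ρ is at least -1,
  -- since v lies in the polygon. Hence σ_x ≤ 2 ρ_x, while σ_x ≥ 2 - ρ_x by the choice of v.
  have hle : -2 * (rho β x * w) ≤ -(pair x γ * w) := by
    rw [← h1, ← h2, Finset.mul_sum]
    refine Finset.sum_le_sum fun u hu => ?_
    have p1 := hβ u hu
    have p2 := hβ _ (hF.maps u hu)
    have e : (-1 : ℝ) ≤ dt x (facet A B u) := by
      exact_mod_cast hd.neg_one_le hx (hd.facet_spec hu).1
    rw [mul_div_assoc']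
    refine div_le_div_of_nonneg_right ?_ (mul_pos p1 p2).le
    have := hτ u hu
    have := hτ _ (hF.maps u hu)
    nlinarith
  have : pair x γ ≤ 2 * rho β x := by
    by_contra! hc
    nlinarith
  rw [hσ] at this
  linarith

end IsDualPair

namespace IsPolygonData

variable {P : Set (Fin 2 → ℝ)} {A B : Finset (Fin 2 → ℤ)}

theorem continuous_rho (u : Fin 2 → ℤ) : Continuous fun β => rho β u := by
  unfold rho; fun_prop

/-- The dual area blows up at the boundary: as each ρ is at most M, the bound w ≤ w₀ forces every
ρ_u ≥ 1/(w₀ M). The minimum can be sought on a compact set. -/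
theorem exists_isMin_dualArea (h : IsPolygonData P A B) (hP : IsCompact P) :
    ∃ β : Fin 2 → ℝ, (∀ u ∈ B, 0 < rho β u) ∧ ∀ β', (∀ u ∈ B, 0 < rho β' u) →
      dualArea B (IsDualPair.next A B) β ≤ dualArea B (IsDualPair.next A B) β' := by
  have hF := h.isDualPair.isSmoothFan
  have h0 : ∀ u : Fin 2 → ℤ, rho 0 u = 1 := fun u => by simp [rho]
  obtain ⟨M, hM⟩ := hP.exists_bound_of_continuousOn (f := fun x => ∑ u ∈ B, rho x u)
    (continuous_finsetSum _ fun u _ => continuous_rho u).continuousOn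
  have hM' : ∀ x, (∀ u ∈ B, 0 < rho x u) → ∀ u ∈ B, rho x u ≤ M := by
    intro x hx u hu
    have h1 := hM x ((h.mem_polygon x).2 fun u hu => (hx u hu).le)
    have h2 := Finset.single_le_sum (f := fun u => rho x u) (fun u hu => (hx u hu).le) hu
    exact h2.trans ((le_abs_self _).trans h1)
  have hM1 : 1 ≤ M := by
    obtain ⟨u, hu⟩ := hF.nonempty
    have := hM' 0 (fun u _ => by rw [h0]; exact one_pos) u hu
    rwa [h0] at this
  set w₀ := dualArea B (IsDualPair.next A B) 0 with hw₀
  have hw₀pos : 0 < w₀ := h.isDualPair.dualArea_pos fun u _ => by rw [h0]; exact one_pos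
  set c := min 1 (1 / (w₀ * M)) with hc
  have hc0 : 0 < c := lt_min one_pos (by positivity)
  set K := {β : Fin 2 → ℝ | ∀ u ∈ B, c ≤ rho β u} with hK
  have hKc : IsCompact K := by
    refine hP.of_isClosed_subset ?_ fun β hβ => (h.mem_polygon β).2 fun u hu =>
      hc0.le.trans (hβ u hu)
    have : K = ⋂ u ∈ B, {β | c ≤ rho β u} := by ext; simp [hK]
    rw [this]
    exact isClosed_biInter fun u _ => isClosed_le continuous_const (continuous_rho u)
  have h0K : (0 : Fin 2 → ℝ) ∈ K := fun u _ => by rw [h0]; exact min_le_left _ _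
  have hcont : ContinuousOn (dualArea B (IsDualPair.next A B)) K := by
    refine continuousOn_finsetSum _ fun u hu => ?_
    refine ContinuousOn.div continuousOn_const
      ((continuous_rho u).mul (continuous_rho _)).continuousOn fun β hβ => ?_
    exact (mul_pos (hc0.trans_le (hβ u hu)) (hc0.trans_le (hβ _ (hF.maps u hu)))).ne'
  obtain ⟨β, hβ, hmin⟩ := hKc.exists_isMinOn ⟨0, h0K⟩ hcont
  refine ⟨β, fun u hu => hc0.trans_le (hβ u hu), fun β' hβ' => ?_⟩
  by_cases hK' : β' ∈ K
  · exact hmin hK'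
  refine (hmin h0K).trans ?_
  rw [← hw₀]
  by_contra! hlt
  refine hK' fun u hu => (min_le_right _ _).trans ?_
  have p1 := hβ' u hu
  have p2 := hβ' _ (hF.maps u hu)
  have h1 : 1 / (rho β' u * rho β' (IsDualPair.next A B u)) ≤ w₀ := by
    refine le_trans ?_ hlt.le
    exact Finset.single_le_sum
      (f := fun u => 1 / (rho β' u * rho β' (IsDualPair.next A B u)))
      (fun u hu => (one_div_pos.2 (mul_pos (hβ' u hu) (hβ' _ (hF.maps u hu)))).le) hu
  rw [div_le_iff₀ (mul_pos p1 p2)] at h1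
  rw [div_le_iff₀ (by positivity)]
  have h2 := mul_le_mul_of_nonneg_left (hM' β' hβ' _ (hF.maps u hu)) (mul_pos hw₀pos p1).le
  linarith

end IsPolygonData

/-! ### Charges of the GLSM fields -/

variable {P : Set (Fin 2 → ℝ)} {A B : Finset (Fin 2 → ℤ)}

theorem IsLatticePolytope.finite_extremePoints (hP : IsLatticePolytope P) :
    (P.extremePoints ℝ).Finite := by
  obtain ⟨S, rfl⟩ := hP
  exact (S.finite_toSet.image latticeToReal).subset extremePoints_convexHull_subset

/-- Half of the weighted sum of the vertices. -/
noncomputable def center (P : Set (Fin 2 → ℝ)) (b : Vertex P → ℝ) : Fin 2 → ℝ :=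
  fun i => (∑ᶠ α : Vertex P, b α * α.1 i) / 2

theorem charge_eq_reeb (hP : IsLatticePolytope P) {b : Vertex P → ℝ}
    (hb : ∑ᶠ α : Vertex P, b α = 2) (m : dualMonoid P) :
    charge P b m = IsPolygonData.reeb P (center P b) m := by
  have := hP.finite_extremePoints.fintype
  rw [finsum_eq_sum_of_fintype] at hb
  simp only [charge, finsum_eq_sum_of_fintype, IsPolygonData.reeb_apply, center, dotProduct_lift, pair]
  have e : ∀ α : Vertex P, b α * (base m.1 0 * α.1 0 + base m.1 1 * α.1 1 + m.1 2) =
      base m.1 0 * (b α * α.1 0) + base m.1 1 * (b α * α.1 1) + m.1 2 * b α := fun α => by ring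
  simp only [e, Finset.sum_add_distrib, ← Finset.mul_sum, hb]
  ring

theorem generatorCharge_eq (hP : IsLatticePolytope P) {b : Vertex P → ℝ}
    (hb : ∑ᶠ α : Vertex P, b α = 2) :
    generatorCharge P b = fun x => IsPolygonData.reeb P (center P b) x.1 :=
  funext fun x => charge_eq_reeb hP hb x.1

/-- By Krein–Milman β is a convex combination of vertices. Minimizing over charges thus amounts to
minimizing over points of the polygon. -/
theorem exists_center_eq (hP : IsLatticePolytope P) {β : Fin 2 → ℝ} (hβ : β ∈ P) :
    ∃ b : Vertex P → ℝ, ∑ᶠ α : Vertex P, b α = 2 ∧ center P b = β := by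
  have hfin := hP.finite_extremePoints
  have hconv : Convex ℝ P := by
    obtain ⟨S, rfl⟩ := hP
    exact convex_convexHull ℝ _
  have hKM := closure_convexHull_extremePoints (isCompact_of_isLatticePolytope hP) hconv
  rw [(hfin.isClosed_convexHull ℝ).closure_eq] at hKM
  rw [← hKM, ← hfin.coe_toFinset, Finset.mem_convexHull'] at hβ
  obtain ⟨w, -, hw1, hw2⟩ := hβ
  have e : ∀ f : (Fin 2 → ℝ) → ℝ, ∑ᶠ α : Vertex P, f α.1 = ∑ y ∈ hfin.toFinset, f y := fun f => by
    rw [finsum_set_coe_eq_finsum_mem, finsum_mem_eq_finite_toFinset_sum _ hfin]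
  refine ⟨fun α => 2 * w α.1, ?_, ?_⟩
  · rw [e fun y => 2 * w y, ← Finset.mul_sum, hw1, mul_one]
  · funext i
    rw [center, e fun y => 2 * w y * y i, ← hw2, Finset.sum_apply, Finset.sum_div]
    refine Finset.sum_congr rfl fun y _ => ?_
    simp only [Pi.smul_apply, smul_eq_mul]
    ring

/-! ### Volume, R-charges and Futaki invariants in terms of the dual area. -/

namespace IsPolygonData

/-- A nonzero element over the origin has charge at least 2, and any other contains a ray u with
charge 2 ρ_u. So bounds on the rays bound every generator. -/
theorem le_reeb (h : IsPolygonData P A B) {β : Fin 2 → ℝ} {c : ℝ} (hc : 0 < c) (hc1 : c ≤ 1)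
    (hβ : ∀ u ∈ B, c ≤ rho β u) {m : dualMonoid P} (hm : m ≠ 0) : 2 * c ≤ reeb P β m := by
  obtain ⟨y, rfl⟩ := h.coneMap_bijective.2 m
  obtain n | ⟨u, n, b, d⟩ := y
  · rw [h.reeb_coneMap_inl]
    have hn : n ≠ 0 := by
      rintro rfl
      refine hm (Subtype.ext ?_)
      funext i; fin_cases i <;> simp [coneMap, liftInt]
    have : (1 : ℝ) ≤ n := by exact_mod_cast Nat.one_le_iff_ne_zero.2 hn
    linarith
  · rw [h.reeb_coneMap_inr]
    have h1 := hβ _ u.2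
    have h2 := hβ _ (h.isDualPair.isSmoothFan.maps _ u.2)
    have h3 : 0 ≤ rho β u * b := mul_nonneg (hc.le.trans h1) (Nat.cast_nonneg b)
    have h4 : 0 ≤ rho β (IsDualPair.next A B u) * d :=
      mul_nonneg (hc.le.trans h2) (Nat.cast_nonneg d)
    push_cast
    nlinarith [(Nat.cast_nonneg n : (0 : ℝ) ≤ n)]

theorem reeb_pos (h : IsPolygonData P A B) {β : Fin 2 → ℝ} (hβ : ∀ u ∈ B, 0 < rho β u)
    {m : dualMonoid P} (hm : m ≠ 0) : 0 < reeb P β m := by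
  obtain ⟨x, hx, hmin⟩ := B.exists_min_image (rho β) h.isDualPair.isSmoothFan.nonempty
  have hc : 0 < min 1 (rho β x) := lt_min one_pos (hβ x hx)
  have := h.le_reeb hc (min_le_left _ _) (fun u hu => (min_le_right _ _).trans (hmin u hu)) hm
  linarith

theorem isTrialCharge_iff (h : IsPolygonData P A B) (hP : IsLatticePolytope P)
    {b : Vertex P → ℝ} (hb : ∑ᶠ α : Vertex P, b α = 2) :
    IsTrialCharge P b ↔ ∀ u ∈ B, 0 < rho (center P b) u := by
  constructor
  · intro ht u hu
    have hm : h.coneMap (Sum.inr (⟨u, hu⟩, 0, 0, 0)) ≠ 0 := by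
      intro e
      have e0 := h.coneMap_bijective.1 (e.trans (show (0 : dualMonoid P) = h.coneMap (Sum.inl 0) by
        refine Subtype.ext ?_
        funext i; fin_cases i <;> simp [coneMap, liftInt]))
      simp at e0
    have := ht.1 _ hm
    rw [charge_eq_reeb hP hb, h.reeb_coneMap_inr] at this
    simpa using this
  · intro hβ
    refine ⟨fun m hm => ?_, hb⟩
    rw [charge_eq_reeb hP hb]
    exact h.reeb_pos hβ hm

theorem hasVolume_iff (h : IsPolygonData P A B) (hP : IsLatticePolytope P)
    {b : Vertex P → ℝ} (hb : IsTrialCharge P b) {V : ℝ} :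
    HasVolume P b V ↔ V = dualArea B (IsDualPair.next A B) (center P b) / 27 := by
  have hβ := (h.isTrialCharge_iff hP hb.2).1 hb
  have hH := h.isHilbertSeries_toricIdeal hβ
  have hT : Tendsto (fun s : ℝ => 8 / 27 * (s ^ 3 * hilbertFn A B (center P b) (Real.exp (-s))))
      (𝓝[>] (0 : ℝ)) (𝓝 (dualArea B (IsDualPair.next A B) (center P b) / 27)) := by
    have := (h.hasExpansion_hilbertFn hβ).tendsto.const_mul (8 / 27)
    convert this using 2
    ring
  rw [HasVolume, generatorCharge_eq hP hb.2]
  constructor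
  · rintro ⟨g, hg, hV⟩
    refine tendsto_nhds_unique (hV.congr' ?_) hT
    filter_upwards [hg.eventuallyEq hH] with s hs
    rw [hs]
  · rintro rfl
    exact ⟨_, hH, hT⟩

theorem isRCharge_iff (h : IsPolygonData P A B) (hP : IsLatticePolytope P)
    {r : Vertex P → ℝ} : IsRCharge P r ↔ IsTrialCharge P r ∧ ∀ β, (∀ u ∈ B, 0 < rho β u) →
      dualArea B (IsDualPair.next A B) (center P r) ≤ dualArea B (IsDualPair.next A B) β := by
  constructor
  · rintro ⟨hr, V, hV, hmin⟩
    refine ⟨hr, fun β hβ => ?_⟩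
    obtain ⟨b, hb, rfl⟩ := exists_center_eq hP ((h.mem_polygon β).2 fun u hu => (hβ u hu).le)
    have hb' := (h.isTrialCharge_iff hP hb).2 hβ
    obtain ⟨V', hV', hle⟩ := hmin b hb'
    rw [(h.hasVolume_iff hP hr).1 hV, (h.hasVolume_iff hP hb').1 hV'] at hle
    linarith
  · rintro ⟨hr, hmin⟩
    refine ⟨hr, _, (h.hasVolume_iff hP hr).2 rfl, fun b hb =>
      ⟨_, (h.hasVolume_iff hP hb).2 rfl, ?_⟩⟩
    have := hmin _ ((h.isTrialCharge_iff hP hb.2).1 hb)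
    linarith

theorem exists_isRCharge (h : IsPolygonData P A B) (hP : IsLatticePolytope P) :
    ∃ r : Vertex P → ℝ, IsRCharge P r := by
  obtain ⟨β, hβ, hmin⟩ := h.exists_isMin_dualArea (isCompact_of_isLatticePolytope hP)
  obtain ⟨b, hb, rfl⟩ := exists_center_eq hP ((h.mem_polygon β).2 fun u hu => (hβ u hu).le)
  exact ⟨b, (h.isRCharge_iff hP).2 ⟨(h.isTrialCharge_iff hP hb).2 hβ, hmin⟩⟩

theorem isFutakiR_iff (h : IsPolygonData P A B) (hP : IsLatticePolytope P)
    {r : Vertex P → ℝ} (hr : IsTrialCharge P r) (x : Generator P) {F : ℝ} :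
    IsFutakiR P r x F ↔ F = dualArea B (IsDualPair.next A B) (center P r) / 16 *
      (1 / 2 - 1 / (3 * reeb P (center P r) x.1)) := by
  have hβ := (h.isTrialCharge_iff hP hr.2).1 hr
  have hx := h.reeb_pos hβ (generator_ne_zero x)
  rw [IsFutakiR, generatorCharge_eq hP hr.2]
  exact isFutakiInvariant_iff (by have := h.isDualPair.dualArea_pos hβ; positivity) hx
    (h.hasLaurentCoefficients_toricIdeal hβ)
    fun ε hε => h.hasLaurentCoefficients_centralFibreIdeal hβ x hx hε

/-- Charges R ≥ 4/3 give 1/2 - 1/(3R) ≥ 1/4, so F ≥ w/64. Mahler's inequality χ w ≥ 27 finishes. -/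
theorem le_isFutakiR (h : IsPolygonData P A B) (hP : IsLatticePolytope P)
    {r : Vertex P → ℝ} (hr : IsRCharge P r) {x : Generator P} {F : ℝ} (hF : IsFutakiR P r x F) :
    27 ≤ 64 * (A.card * F) := by
  obtain ⟨ht, hmin⟩ := (h.isRCharge_iff hP).1 hr
  have hβ := (h.isTrialCharge_iff hP ht.2).1 ht
  have hR := h.le_reeb (by norm_num) (by norm_num)
    (fun u hu => h.isDualPair.two_thirds_le_rho hβ hmin hu) (generator_ne_zero x)
  rw [h.isFutakiR_iff hP ht] at hF
  have hw := h.isDualPair.dualArea_pos hβ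
  have hle := h.isDualPair.isSmoothFan.le_dualArea h.isDualPair.cr_next_next_le hβ
  have hcard : (B.card : ℝ) + A.card = 12 := by exact_mod_cast h.isDualPair.card_add_card
  have e : (12 - B.card : ℝ) = A.card := by linarith
  rw [e] at hle
  have h3 : 1 / (3 * reeb P (center P r) x.1) ≤ 1 / 4 :=
    one_div_le_one_div_of_le (by norm_num) (by linarith)
  have h4 : dualArea B (IsDualPair.next A B) (center P r) / 64 ≤ F := by
    rw [hF]
    nlinarith
  have := mul_le_mul_of_nonneg_left h4 (Nat.cast_nonneg A.card)
  linarith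

end IsPolygonData

end FutakiReflexive
theorem mainTheorem5 (P : Set (Fin 2 → ℝ)) (hP : FutakiReflexive.IsReflexivePolygon P) :
    FutakiReflexive.chernNumber P + FutakiReflexive.eulerNumber P = 12 ∧
    (∃ r : FutakiReflexive.Vertex P → ℝ, FutakiReflexive.IsRCharge P r) ∧
    ∀ r : FutakiReflexive.Vertex P → ℝ, FutakiReflexive.IsRCharge P r →
      ∀ h : FutakiReflexive.Generator P,
        (∃! F : ℝ, FutakiReflexive.IsFutakiR P r h F) ∧
        ∀ F : ℝ, FutakiReflexive.IsFutakiR P r h F →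
          0 < F ∧
          1 / F ≤ 64 / 27 * (FutakiReflexive.eulerNumber P : ℝ) ∧
          1 / F ≤ 64 / 27 * (12 - (FutakiReflexive.chernNumber P : ℝ)) := by
  obtain ⟨A, B, hd⟩ := hP.exists_data
  have hsum : FutakiReflexive.chernNumber P + FutakiReflexive.eulerNumber P = 12 := by
    rw [hd.chern, hd.euler, hd.isDualPair.card_add_card]
  refine ⟨hsum, hd.exists_isRCharge hP.lattice, fun r hr h => ⟨?_, fun F hF => ?_⟩⟩
  · refine ⟨_, (hd.isFutakiR_iff hP.lattice hr.1 h).2 rfl, fun F hF => ?_⟩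
    exact (hd.isFutakiR_iff hP.lattice hr.1 h).1 hF
  · have key := hd.le_isFutakiR hP.lattice hr hF
    rw [← hd.euler] at key
    have hχ : (12 - (FutakiReflexive.chernNumber P : ℝ)) = FutakiReflexive.eulerNumber P := by
      rw [sub_eq_iff_eq_add']
      exact_mod_cast hsum.symm
    have hpos : 0 < F := by
      by_contra! hc
      nlinarith [(Nat.cast_nonneg (FutakiReflexive.eulerNumber P) :
        (0 : ℝ) ≤ FutakiReflexive.eulerNumber P)]
    have hle : 1 / F ≤ 64 / 27 * (FutakiReflexive.eulerNumber P : ℝ) := by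
      rw [div_le_iff₀ hpos]
      linarith
    exact ⟨hpos, hle, hχ ▸ hle⟩
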